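/- Let $a\in\mathbb R$, $s>0$, $\gamma>0$ and $\alpha>2$. For $k\in\mathbb Z^2$ write $k^2=k_1^2+k_2^2$, $k^\perp=(-k_2,k_1)$, and call $k$ positive ($k>0$) if $k_1>0$, or $k_1=0$ and $k_2>0$. Let $e_k(x)=\frac1{2\pi}e^{ik\cdot x}$ on the torus $\mathbb T^2=[0,2\pi]^2$. For $p\in\mathbb R$ let $H^{p,s}$ be the Hilbert space of real mean-free (generalized) functions $v=\sum_{k\neq0}v_ke_k$ on $\mathbb T^2$ (so $v_{-k}=\overline{v_k}$, $v_0=0$) with $$\|v\|_{p,s}^2=\sum_{k>0}k^{2p}(1+a^2k^2)^{ps}|v_k|^2<\infty .$$ Let $\mu_\gamma=\prod_{k>0}\mu_{\gamma,k}$, regarded as a Borel measure on $H^{1-\alpha,s}$ through the coordinates $(v_k)_{k>0}$, where $$d\mu_{\gamma,k}(z)=\frac{\gamma k^4(1+a^2k^2)^{2s}}{2\pi}\exp\Bigl(-\tfrac12\gamma k^4(1+a^2k^2)^{2s}|z|^2\Bigr)dx\,dy,\qquad z=x+iy .$$ For $k>0$ let $$B_k(\varphi)=\lim_{n\to\infty}\sum_{h\in\mathbb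 Z^2,\ h^2\le n}\alpha_{h,k}\,\varphi_h\varphi_{k-h},\qquad \alpha_{h,k}=\frac{(h\cdot h'^\perp)\bigl[h^2(1+a^2h^2)^s-h'^2(1+a^2h'^2)^s\bigr]}{4\pi k^2(1+a^2k^2)^s},\quad h'=k-h,$$ whenever the limit exists. These are the Fourier components of the averaged-Euler equation $\partial_tA\Delta\varphi+(\nabla^\perp\varphi\cdot\nabla)A\Delta\varphi=0$, $A=(1-a^2\Delta)^s$, $\nabla^\perp=(-\partial_2,\partial_1)$; that is, the equation formally reads $\frac{d\varphi_k}{dt}=B_k(\varphi)$ for all $k>0$. Let $\mathcal D$ be the set of functions $f(v)=g(v_{k_1},\dots,v_{k_d})$ on $H^{1-\alpha,s}$ with $k_1,\dots,k_d>0$ and $g:\mathbb C^d\to\mathbb C$ differentiable in the real sense. Theorem. There exist a probability space $(\Omega,\mathcal F,P_\gamma)$ and an $H^{1-\alpha,s}$-valued process $(U(t,\cdot))_{t\in\mathbb R}$ on it such that $U(\cdot,\omega)\in C(\mathbb R;H^{1-\alpha,s})$ for every $\omega\in\Omega$, and: (i) for $P_\gamma$-a.e. $\omega$ and every $k>0$,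 the limit defining $B_k(U(r,\omega))$ exists for a.e. $r\in\mathbb R$, the function $r\mapsto B_k(U(r,\omega))$ is locally integrable on $\mathbb R$, and $$U_k(t,\omega)=U_k(0,\omega)+\int_0^tB_k(U(r,\omega))\,dr\qquad\text{for all }t\in\mathbb R;$$ (ii) $\mu_\gamma$ is invariant for $U$: for all $t\in\mathbb R$ and $f\in\mathcal D$, $f(U(t,\cdot))$ is $P_\gamma$-integrable if and only if $f$ is $\mu_\gamma$-integrable, and in that case $$\int f(U(t,\omega))\,dP_\gamma(\omega)=\int f\,d\mu_\gamma .$$ -/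

import Mathlib

open MeasureTheory Filter Topology

noncomputable section

namespace AveragedEuler

/-- `k² = k₁² + k₂²` for a frequency `k ∈ ℤ²`. -/
def freqSq (k : ℤ × ℤ) : ℝ := (k.1 : ℝ) ^ 2 + (k.2 : ℝ) ^ 2

/-- `k > 0` for `k ∈ ℤ²`: either `k₁ > 0`, or `k₁ = 0` and `k₂ > 0`. -/
def IsPos (k : ℤ × ℤ) : Prop := 0 < k.1 ∨ (k.1 = 0 ∧ 0 < k.2)

/-- The positive frequencies. -/
abbrev PosFreq : Type := {k : ℤ × ℤ // IsPos k}

/-- The symbol `1 + a² k²` of the operator `1 - a² Δ`. -/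
def helmholtz (a : ℝ) (k : ℤ × ℤ) : ℝ := 1 + a ^ 2 * freqSq k

/-- The symbol `(1 + a² k²)^s` of the operator `A = (1 - a² Δ)^s`. -/
def symbolA (a s : ℝ) (k : ℤ × ℤ) : ℝ := helmholtz a k ^ s

lemma freqSq_nonneg (k : ℤ × ℤ) : 0 ≤ freqSq k := by unfold freqSq; positivity

lemma freqSq_pos (k : PosFreq) : 0 < freqSq k.1 := by
  obtain ⟨⟨k₁, k₂⟩, hk⟩ := k
  unfold freqSq
  rcases hk with h | ⟨-, h⟩
  · have h' : (0 : ℝ) < k₁ := by exact_mod_cast h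
    positivity
  · have h' : (0 : ℝ) < k₂ := by exact_mod_cast h
    positivity

lemma helmholtz_pos (a : ℝ) (k : ℤ × ℤ) : 0 < helmholtz a k := by
  have := freqSq_nonneg k
  unfold helmholtz; positivity

lemma symbolA_pos (a s : ℝ) (k : ℤ × ℤ) : 0 < symbolA a s k :=
  Real.rpow_pos_of_pos (helmholtz_pos a k) s

/-! ### The Sobolev spaces `H^{p,s}` -/

/-- The weight `k^{2p} (1 + a² k²)^{ps}`. -/
def weight (a s p : ℝ) (k : PosFreq) : ℝ :=
  freqSq k.1 ^ p * helmholtz a k.1 ^ (p * s)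

lemma weight_pos (a s p : ℝ) (k : PosFreq) : 0 < weight a s p k :=
  mul_pos (Real.rpow_pos_of_pos (freqSq_pos k) _) (Real.rpow_pos_of_pos (helmholtz_pos a k.1) _)

/-- The families `(v_k)_{k>0}` with `∑_{k>0} k^{2p} (1 + a² k²)^{ps} |v_k|² < ∞`. -/
def sobolevSubmodule (a s p : ℝ) : Submodule ℂ (PosFreq → ℂ) where
  carrier := {v | Summable fun k => weight a s p k * ‖v k‖ ^ 2}
  zero_mem' := by simp [summable_zero]
  add_mem' := by
    intro x y hx hy
    refine Summable.of_nonneg_of_le (fun k => ?_) (fun k => ?_) ((hx.mul_left 2).add (hy.mul_left 2))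
    · have := weight_pos a s p k
      positivity
    · have h1 : ‖(x + y) k‖ ≤ ‖x k‖ + ‖y k‖ := norm_add_le _ _
      have h2 : ‖(x + y) k‖ ^ 2 ≤ 2 * ‖x k‖ ^ 2 + 2 * ‖y k‖ ^ 2 := by
        nlinarith [norm_nonneg ((x + y) k), norm_nonneg (x k), norm_nonneg (y k),
          sq_nonneg (‖x k‖ - ‖y k‖)]
      nlinarith [mul_le_mul_of_nonneg_left h2 (weight_pos a s p k).le]
  smul_mem' := by
    intro c x hx
    have hx' : Summable fun k => weight a s p k * ‖x k‖ ^ 2 := hx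
    refine (hx'.mul_left (‖c‖ ^ 2)).congr fun k => ?_
    simp only [Pi.smul_apply, smul_eq_mul, norm_mul]
    ring

/-- The space `H^{p,s}` of real (generalized) functions `v = ∑_k v_k e_k` on the torus with
`v_0 = 0`, where `e_k(x) = e^{ik·x}/(2π)`; as `v_{-k}` is the conjugate of `v_k`, an element is
given by its coefficients with `k > 0`. -/
def Sobolev (a s p : ℝ) : Type := sobolevSubmodule a s p

instance (a s p : ℝ) : AddCommGroup (Sobolev a s p) :=
  inferInstanceAs (AddCommGroup (sobolevSubmodule a s p))

instance (a s p : ℝ) : Module ℂ (Sobolev a s p) :=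
  inferInstanceAs (Module ℂ (sobolevSubmodule a s p))

/-- The Fourier coefficients `(v_k)_{k>0}` of an element of `H^{p,s}`. -/
def modes {a s p : ℝ} (v : Sobolev a s p) : PosFreq → ℂ := v.1

/-- The map `v ↦ (√(weight k) v_k)_k` to `ℓ²`, from which `H^{p,s}` gets its norm. -/
def toL2 (a s p : ℝ) : Sobolev a s p →ₗ[ℂ] lp (fun _ : PosFreq => ℂ) 2 where
  toFun v := ⟨fun k => (Real.sqrt (weight a s p k) : ℂ) * modes v k, by
    apply memℓp_gen
    refine Summable.congr v.2 fun k => ?_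
    have h := Real.sq_sqrt (weight_pos a s p k).le
    simp only [ENNReal.toReal_ofNat, Real.rpow_ofNat, norm_mul, Complex.norm_real, mul_pow,
      Real.norm_eq_abs, sq_abs, h]
    rfl⟩
  map_add' x y := by
    ext k
    exact mul_add _ _ _
  map_smul' c x := by
    ext k
    exact mul_left_comm _ _ _

lemma modes_injective (a s p : ℝ) : Function.Injective (modes (a := a) (s := s) (p := p)) :=
  Subtype.val_injective

lemma toL2_injective (a s p : ℝ) : Function.Injective (toL2 a s p) := by
  intro x y h
  apply modes_injective
  funext k
  have hk : (Real.sqrt (weight a s p k) : ℂ) * modes x k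
      = (Real.sqrt (weight a s p k) : ℂ) * modes y k :=
    congrArg (fun f : lp (fun _ : PosFreq => ℂ) 2 => f k) h
  have hw : (Real.sqrt (weight a s p k) : ℂ) ≠ 0 := by
    exact_mod_cast (Real.sqrt_pos.2 (weight_pos a s p k)).ne'
  exact mul_left_cancel₀ hw hk

lemma toL2_surjective (a s p : ℝ) : Function.Surjective (toL2 a s p) := by
  intro f
  have hw : ∀ k, (Real.sqrt (weight a s p k) : ℂ) ≠ 0 := fun k => by
    exact_mod_cast (Real.sqrt_pos.2 (weight_pos a s p k)).ne'
  refine ⟨⟨fun k => f k / (Real.sqrt (weight a s p k) : ℂ), ?_⟩, ?_⟩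
  · have hf := (memℓp_gen_iff (p := 2) (by norm_num)).1 f.2
    refine Summable.congr hf fun k => ?_
    have h := Real.sq_sqrt (weight_pos a s p k).le
    have h0 := (weight_pos a s p k).ne'
    simp only [ENNReal.toReal_ofNat, Real.rpow_ofNat, norm_div, Complex.norm_real, div_pow,
      Real.norm_eq_abs, sq_abs, h]
    field_simp
  · ext k
    exact mul_div_cancel₀ _ (hw k)

instance (a s p : ℝ) : NormedAddCommGroup (Sobolev a s p) :=
  NormedAddCommGroup.induced _ _ (toL2 a s p) (toL2_injective a s p)

instance (a s p : ℝ) : NormedSpace ℂ (Sobolev a s p) :=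
  NormedSpace.induced ℂ _ _ (toL2 a s p)

/-- The norm of `H^{p,s}`: `‖v‖² = ∑_{k>0} k^{2p} (1 + a² k²)^{ps} |v_k|²`. -/
lemma norm_sq_eq {a s p : ℝ} (v : Sobolev a s p) :
    ‖v‖ ^ 2 = ∑' k, weight a s p k * ‖modes v k‖ ^ 2 := by
  have h := lp.norm_rpow_eq_tsum (p := 2) (by norm_num) (toL2 a s p v)
  simp only [ENNReal.toReal_ofNat, Real.rpow_ofNat] at h
  refine h.trans (tsum_congr fun k => ?_)
  have hs := Real.sq_sqrt (weight_pos a s p k).le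
  change ‖(Real.sqrt (weight a s p k) : ℂ) * modes v k‖ ^ 2 = _
  rw [norm_mul, mul_pow, Complex.norm_real, Real.norm_eq_abs, sq_abs, hs]

instance (a s p : ℝ) : MeasurableSpace (Sobolev a s p) := borel _

instance (a s p : ℝ) : BorelSpace (Sobolev a s p) := ⟨rfl⟩

/-- `H^{p,s}` is isometric to `ℓ²`. -/
def isometryL2 (a s p : ℝ) : Sobolev a s p ≃ₗᵢ[ℂ] lp (fun _ : PosFreq => ℂ) 2 where
  toLinearEquiv := LinearEquiv.ofBijective (toL2 a s p) ⟨toL2_injective a s p, toL2_surjective a s p⟩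
  norm_map' _ := rfl

instance (a s p : ℝ) : CompleteSpace (Sobolev a s p) :=
  (isometryL2 a s p).toIsometryEquiv.completeSpace

instance : SecondCountableTopology (lp (fun _ : PosFreq => ℂ) 2) := by
  have : TopologicalSpace.SeparableSpace (lp (fun _ : PosFreq => ℂ) 2) := by
    let b : HilbertBasis PosFreq ℂ (lp (fun _ : PosFreq => ℂ) 2) :=
      ⟨LinearIsometryEquiv.refl ℂ _⟩
    have h := ((Set.countable_range b).isSeparable.span (R := ℂ)).closure
    rw [← Submodule.topologicalClosure_coe, b.dense_span] at h
    exact TopologicalSpace.isSeparable_univ_iff.1 h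
  exact UniformSpace.secondCountable_of_separable _

instance (a s p : ℝ) : SecondCountableTopology (Sobolev a s p) :=
  (isometryL2 a s p).toHomeomorph.secondCountableTopology

lemma continuous_modes (a s p : ℝ) : Continuous (modes (a := a) (s := s) (p := p)) := by
  refine continuous_pi fun k => ?_
  have hw : (Real.sqrt (weight a s p k) : ℂ) ≠ 0 := by
    exact_mod_cast (Real.sqrt_pos.2 (weight_pos a s p k)).ne'
  have h1 : Continuous fun v : Sobolev a s p => (isometryL2 a s p v) k :=
    ((lp.uniformContinuous_coe (E := fun _ : PosFreq => ℂ) (p := 2)).continuous.comp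
      (isometryL2 a s p).continuous) |> (continuous_apply k).comp
  have h2 : (fun v : Sobolev a s p => modes v k)
      = fun v => (isometryL2 a s p v) k / (Real.sqrt (weight a s p k) : ℂ) := by
    funext v
    exact (mul_div_cancel_left₀ _ hw).symm
  rw [h2]
  exact h1.div_const _

/-- The inclusion of `H^{p,s}` into the space of all families `(v_k)_{k>0}` is a Borel
isomorphism onto a Borel subset. -/
lemma measurableEmbedding_modes (a s p : ℝ) :
    MeasurableEmbedding (modes (a := a) (s := s) (p := p)) :=
  (continuous_modes a s p).measurableEmbedding (modes_injective a s p)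

/-! ### The enstrophy Gaussian measure -/

/-- The measure `(γ k⁴ (1 + a² k²)^{2s} / 2π) exp(-γ k⁴ (1 + a² k²)^{2s} |z|² / 2) dx dy` on
`ℂ`, where `z = x + iy`. -/
def modeMeasure (a s γ : ℝ) (k : PosFreq) : Measure ℂ :=
  volume.withDensity fun z => ENNReal.ofReal
    (γ * freqSq k.1 ^ 2 * symbolA a s k.1 ^ 2 / (2 * Real.pi) *
      Real.exp (-(1 / 2) * γ * freqSq k.1 ^ 2 * symbolA a s k.1 ^ 2 * ‖z‖ ^ 2))

/-- The modes have probability distributions, so that their infinite product makes sense. -/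
lemma isProbabilityMeasure_modeMeasure (a s γ : ℝ) (hγ : 0 < γ) (k : PosFreq) :
    IsProbabilityMeasure (modeMeasure a s γ k) := by
  set c : ℝ := γ * freqSq k.1 ^ 2 * symbolA a s k.1 ^ 2 with hc
  have hc0 : 0 < c := by
    have h1 := freqSq_pos k
    have h2 := symbolA_pos a s k.1
    positivity
  have hint := GaussianFourier.integral_rexp_neg_mul_sq_norm (V := ℂ) (b := c / 2) (by positivity)
  rw [Complex.finrank_real_complex] at hint
  norm_num at hint
  constructor
  rw [modeMeasure, withDensity_apply _ MeasurableSet.univ, Measure.restrict_univ,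
    ← ofReal_integral_eq_lintegral_ofReal]
  · rw [integral_const_mul]
    have : (fun z : ℂ => Real.exp (-(1 / 2) * γ * freqSq k.1 ^ 2 * symbolA a s k.1 ^ 2 * ‖z‖ ^ 2))
        = fun z : ℂ => Real.exp (-(c / 2 * ‖z‖ ^ 2)) := by
      funext z; congr 1; rw [hc]; ring
    rw [this, hint]
    rw [← ENNReal.ofReal_one]; congr 1
    have := Real.pi_pos
    rw [← hc]
    field_simp
  · refine Integrable.const_mul ?_ _
    have : (fun z : ℂ => Real.exp (-(1 / 2) * γ * freqSq k.1 ^ 2 * symbolA a s k.1 ^ 2 * ‖z‖ ^ 2))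
        = fun z : ℂ => Real.exp (-(c / 2 * ‖z‖ ^ 2)) := by
      funext z; congr 1; rw [hc]; ring
    rw [this]
    apply Integrable.of_integral_ne_zero
    rw [hint]
    have := Real.pi_pos
    positivity
  · refine Eventually.of_forall fun z => ?_
    have := Real.pi_pos
    positivity

/-- The product measure `∏_{k>0} μ_{γ,k}` on the families `(v_k)_{k>0}`. -/
def productGaussian (a s γ : ℝ) : Measure (PosFreq → ℂ) :=
  Measure.infinitePi (modeMeasure a s γ)

/-- The enstrophy measure `μ_γ` on `H^{p,s}`: the trace on `H^{p,s}` of the product measure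
`∏_{k>0} μ_{γ,k}`. -/
def enstrophyMeasure (a s γ p : ℝ) : Measure (Sobolev a s p) :=
  (productGaussian a s γ).comap modes

/-! ### The averaged-Euler vector field -/

open scoped Classical in
/-- All Fourier coefficients of the real mean-free generalized function with coefficients `v_k`
for `k > 0`: `v_{-k}` is the conjugate of `v_k`, and `v_0 = 0`. -/
def fullMode (v : PosFreq → ℂ) (k : ℤ × ℤ) : ℂ :=
  if h : IsPos k then v ⟨k, h⟩
  else if h' : IsPos (-k) then (starRingEnd ℂ) (v ⟨-k, h'⟩)
  else 0

/-- `h · h'^⊥ = - h^⊥ · h'`, where `h'^⊥ = (-h'₂, h'₁)`. -/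
def dotPerp (h h' : ℤ × ℤ) : ℝ := -(h.1 : ℝ) * h'.2 + (h.2 : ℝ) * h'.1

/-- The coefficient of `v_h v_{k-h}` in the Fourier form of
`∂_t AΔφ + (∇^⊥φ · ∇) AΔφ = 0`, symmetrized in `h` and `h' = k - h`:
`(h · h'^⊥) (h² (1+a²h²)^s - h'² (1+a²h'²)^s) / (4π k² (1+a²k²)^s)`. -/
def coeffB (a s : ℝ) (h k : ℤ × ℤ) : ℝ :=
  dotPerp h (k - h) * (freqSq h * symbolA a s h - freqSq (k - h) * symbolA a s (k - h)) /
    (4 * Real.pi * freqSq k * symbolA a s k)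

/-- Before symmetrization the coefficient is `-(h · h'^⊥) h'² (1+a²h'²)^s / (2π k² (1+a²k²)^s)`,
`h' = k - h`: indeed `Δe_h = -h² e_h`, `∇^⊥e_h · ∇e_{h'} = (h · h'^⊥) e_{h+h'} / (2π)`. -/
lemma coeffB_eq_symmetrization (a s : ℝ) (h h' k : ℤ × ℤ) (hk : h + h' = k) :
    coeffB a s h k =
      (-dotPerp h h' * freqSq h' * symbolA a s h' / (2 * Real.pi * freqSq k * symbolA a s k) +
        -dotPerp h' h * freqSq h * symbolA a s h / (2 * Real.pi * freqSq k * symbolA a s k)) / 2 := by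
  have e : k - h = h' := by rw [← hk]; abel
  have e2 : dotPerp h' h = -dotPerp h h' := by unfold dotPerp; ring
  rw [coeffB, e, e2, show 4 * Real.pi * freqSq k * symbolA a s k
    = 2 * (2 * Real.pi * freqSq k * symbolA a s k) by ring, div_mul_eq_div_div_swap]
  ring

open scoped Classical in
/-- The finite set of the `h ∈ ℤ²` with `h² ≤ n`. -/
def freqBall (n : ℕ) : Finset (ℤ × ℤ) :=
  (Finset.Icc (-(n : ℤ)) n ×ˢ Finset.Icc (-(n : ℤ)) n).filter fun h => freqSq h ≤ n

lemma mem_freqBall (n : ℕ) (h : ℤ × ℤ) : h ∈ freqBall n ↔ freqSq h ≤ n := by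
  refine ⟨fun hh => (Finset.mem_filter.1 hh).2, fun hh => Finset.mem_filter.2 ⟨?_, hh⟩⟩
  have h0 : h.1 ^ 2 + h.2 ^ 2 ≤ (n : ℤ) := by
    have : (h.1 : ℝ) ^ 2 + (h.2 : ℝ) ^ 2 ≤ (n : ℝ) := hh
    exact_mod_cast this
  simp only [Finset.mem_product, Finset.mem_Icc]
  refine ⟨⟨?_, ?_⟩, ?_, ?_⟩ <;> nlinarith [sq_nonneg (h.1 - 1), sq_nonneg (h.1 + 1),
    sq_nonneg (h.2 - 1), sq_nonneg (h.2 + 1), sq_nonneg h.1, sq_nonneg h.2, Int.le_self_sq h.1,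
    Int.le_self_sq h.2, Int.le_self_sq (-h.1), Int.le_self_sq (-h.2)]

/-- The truncated sum `B^n_k(φ) = ∑_{h² ≤ n} α_{h,k} φ_h φ_{k-h}`. -/
def truncB (a s : ℝ) (n : ℕ) (k : PosFreq) (v : PosFreq → ℂ) : ℂ :=
  ∑ h ∈ freqBall n, (coeffB a s h k.1 : ℂ) * fullMode v h * fullMode v (k.1 - h)

/-- The component `B_k(φ) = ∑_h α_{h,k} φ_h φ_{k-h}` of the averaged-Euler vector field, as
the limit of the sums over `h² ≤ n` (a junk value where this limit does not exist). -/
def vectorB (a s : ℝ) (k : PosFreq) (v : PosFreq → ℂ) : ℂ :=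
  limUnder atTop fun n : ℕ => truncB a s n k v

/-- The space `𝒟` of (complex-valued) differentiable functions on `H^{p,s}` that depend on
finitely many coordinates. -/
def IsCylinder {a s p : ℝ} (f : Sobolev a s p → ℂ) : Prop :=
  ∃ (S : Finset PosFreq) (g : (S → ℂ) → ℂ), Differentiable ℝ g ∧
    ∀ v, f v = g fun k => modes v k.1

end AveragedEuler

end

open AveragedEuler

/-!
The measure `μ_γ` is a product of Gaussians with exponent `-γ/2` times the averaged enstrophy
`∑ lam_k² |φ_k|²`, where `lam_k = k² (1 + a² k²)^s`. The averaged-Euler flow conserves this quantity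
formally and is formally divergence free, so `μ_γ` ought to be invariant. The flow itself is not
available on the support of `μ_γ`; a stationary process is obtained instead as a weak limit of
discrete dynamics that preserve `μ_γ` exactly.

*The vector field.* The coefficient `α_{h,k}` is symmetric in `h` and `k - h`, and this produces a
cancellation: `α_{h,k} / (lam_h lam_{k-h})` is `O(1 / (|h| |k - h|))` (`coeffB_sq_le`). Under `μ_γ`
the products `φ_h φ_{k-h}` have variance of order `1 / (lam_h² lam_{k-h}²)`, and different products
are orthogonal because the measure is invariant under a change of sign of one mode. Hence the sums
for `B_k` are dominated in `L²` by the sums of `1 / (h² (k - h)²)` (`lintegral_quadSum_le`); they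
converge in `L²`, with `∫ |B_k|² dμ_γ` bounded uniformly in `k` (`lintegral_vectorB_le`). They also
converge almost everywhere: the series above still converges with the weight `|h|^{3/2}`, which
controls the sums over the balls of radius `m ∈ ℕ`, and the variation between consecutive such
radii (`ae_tendsto_truncB`).

*Discrete dynamics.* In terms of the variables `lam_k φ_k`, advection by a fixed velocity field is
an antihermitian matrix, that is, a sum of infinitesimal rotations, each of which exchanges enstrophy
between two modes. The coefficient that couples the modes `p` and `±q` is a multiple of the mode
`p ∓ q`, which differs from both unless the coefficient vanishes; so each rotation is a linear
isometry of two coordinates depending on the others as parameters, and it preserves `μ_γ`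
(`measurePreserving_add_stepRate`). The increment rates of these rotations add up, at time step zero,
to the truncated vector field (`sum_stepRate_zero_eq_quadSum`). Composing finitely many of them over
a time `2^{-j}`, with `j` large depending on the truncation, gives maps `T_n` that preserve `μ_γ` and
whose difference quotients converge to `B_k` in `L²` for every `k`
(`exists_measurePreserving_approximation`).

*The limit.* The orbits of `T_n` started from `μ_γ` are stationary. Their polygonal interpolations
have velocities bounded in `L²`, which makes their laws tight on `C(ℝ, ℂ^{k>0})`
(`isTightMeasureSet_orbitPath`). A weak limit has the law `μ_γ` at every time. In it the defect of
the integral equation vanishes: `B_k` is approximated in `L²(μ_γ)` by a continuous finite sum, for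
which the defect is a continuous function of the path (`exists_stationary_pathMeasure`).

*Regularity of the paths.* For `α > 2` the sum over `k` of `k^{2(1-α)}` is finite, so that almost
surely the initial values and the actions `∫_{-T}^T |B_k|² dr` have finite sums with the weights of
`H^{1-α,s}` (`ae_tsum_weight_lt_top`). These dominate all `|U_k(t)|²`, `|t| ≤ T`, and dominated
convergence gives continuity in `H^{1-α,s}` (`continuous_ofModes`). On the remaining null set
the process is replaced by zero.
-/

noncomputable section

namespace AveragedEuler

/-! ### Hölder balls are compact -/

section HolderBall

variable {ι : Type}

/-- The paths in `ι → ℂ` whose `k`-th coordinate is bounded by `R k` at time `0` and is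
`1/2`-Hölder on `[-T, T]` with constant `√(H k T)`, for every coordinate `k` and every `T`. -/
def holderBall (R : ι → ℝ) (H : ι → ℕ → ℝ) : Set C(ℝ, ι → ℂ) :=
  {u | (∀ k, ‖u 0 k‖ ≤ R k) ∧
    ∀ k (T : ℕ) (s t : ℝ), |s| ≤ T → |t| ≤ T → ‖u t k - u s k‖ ^ 2 ≤ H k T * |t - s|}

lemma tendsto_sub_of_sq_le {F : ℝ → ℝ} {t₀ C : ℝ} (hF0 : ∀ t, 0 ≤ F t)
    (hF : ∀ᶠ t in 𝓝 t₀, F t ^ 2 ≤ C * |t - t₀|) : Tendsto F (𝓝 t₀) (𝓝 0) := by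
  have h1 : Tendsto (fun t : ℝ => Real.sqrt (C * |t - t₀|)) (𝓝 t₀) (𝓝 0) := by
    have : Continuous fun t : ℝ => Real.sqrt (C * |t - t₀|) := by fun_prop
    simpa using this.tendsto t₀
  refine tendsto_of_tendsto_of_tendsto_of_le_of_le' tendsto_const_nhds h1
    (Eventually.of_forall hF0) ?_
  filter_upwards [hF] with t ht
  exact Real.le_sqrt_of_sq_le ht

lemma eventually_abs_le_nat (t₀ : ℝ) : ∀ᶠ t : ℝ in 𝓝 t₀, |t| ≤ ((⌈|t₀|⌉₊ + 1 : ℕ) : ℝ) := by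
  have h1 : |t₀| < ((⌈|t₀|⌉₊ + 1 : ℕ) : ℝ) := by
    push_cast
    linarith [Nat.le_ceil |t₀|]
  exact (continuous_abs.tendsto t₀).eventually (eventually_le_nhds h1)

lemma isCompact_holderBall (R : ι → ℝ) (H : ι → ℕ → ℝ) : IsCompact (holderBall R H) := by
  refine ArzelaAscoli.isCompact_of_equicontinuous _ ?_ ?_
  · have himage : ContinuousMap.toFun '' holderBall R H = {f : ℝ → ι → ℂ |
        (∀ k, ‖f 0 k‖ ≤ R k) ∧ ∀ k (T : ℕ) (s t : ℝ), |s| ≤ T → |t| ≤ T →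
          ‖f t k - f s k‖ ^ 2 ≤ H k T * |t - s|} := by
      ext f
      constructor
      · rintro ⟨u, hu, rfl⟩
        exact hu
      · intro hf
        refine ⟨⟨f, ?_⟩, hf, rfl⟩
        refine continuous_pi fun k => continuous_iff_continuousAt.2 fun t₀ => ?_
        refine tendsto_iff_norm_sub_tendsto_zero.2 ?_
        refine tendsto_sub_of_sq_le (C := H k (⌈|t₀|⌉₊ + 1)) (fun t => norm_nonneg _) ?_
        filter_upwards [eventually_abs_le_nat t₀] with t ht
        exact hf.2 k _ t₀ t (eventually_abs_le_nat t₀).self_of_nhds ht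
    rw [himage]
    refine IsCompact.of_isClosed_subset (isCompact_univ_pi fun t : ℝ =>
      isCompact_univ_pi fun k : ι => isCompact_closedBall (0 : ℂ)
        (R k + Real.sqrt (H k ⌈|t|⌉₊ * |t|))) ?_ ?_
    · have e : {f : ℝ → ι → ℂ |
        (∀ k, ‖f 0 k‖ ≤ R k) ∧ ∀ k (T : ℕ) (s t : ℝ), |s| ≤ T → |t| ≤ T →
          ‖f t k - f s k‖ ^ 2 ≤ H k T * |t - s|} =
        (⋂ k, {f | ‖f 0 k‖ ≤ R k}) ∩ ⋂ (k) (T : ℕ) (s : ℝ) (t : ℝ) (_ : |s| ≤ T) (_ : |t| ≤ T),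
          {f | ‖f t k - f s k‖ ^ 2 ≤ H k T * |t - s|} := by
        ext f; simp
      rw [e]
      refine (isClosed_iInter fun k => isClosed_le (by fun_prop) (by fun_prop)).inter ?_
      refine isClosed_iInter fun k => isClosed_iInter fun T => isClosed_iInter fun s =>
        isClosed_iInter fun t => isClosed_iInter fun _ => isClosed_iInter fun _ =>
        isClosed_le (by fun_prop) (by fun_prop)
    · intro f hf
      refine fun t _ k _ => ?_
      rw [mem_closedBall_zero_iff]
      have h1 := hf.2 k ⌈|t|⌉₊ 0 t (by simp) (Nat.le_ceil _)
      rw [sub_zero] at h1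
      calc ‖f t k‖ = ‖f 0 k + (f t k - f 0 k)‖ := by congr 1; ring
        _ ≤ _ := norm_add_le _ _
        _ ≤ _ := add_le_add (hf.1 k) (Real.le_sqrt_of_sq_le h1)
  · intro t₀ U hU
    have key : Tendsto (fun p : ℝ × holderBall R H => (p.2.1 t₀, p.2.1 p.1))
        (𝓝 t₀ ×ˢ 𝓟 Set.univ) (uniformity (ι → ℂ)) := by
      rw [Pi.uniformity, tendsto_iInf]
      intro k
      rw [tendsto_comap_iff, Metric.uniformity_eq_comap_nhds_zero, tendsto_comap_iff]
      have h1 : Tendsto (fun t : ℝ => Real.sqrt (H k (⌈|t₀|⌉₊ + 1) * |t - t₀|)) (𝓝 t₀) (𝓝 0) := by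
        have : Continuous fun t : ℝ => Real.sqrt (H k (⌈|t₀|⌉₊ + 1) * |t - t₀|) := by fun_prop
        simpa using this.tendsto t₀
      refine tendsto_of_tendsto_of_tendsto_of_le_of_le' tendsto_const_nhds
        (h1.comp tendsto_fst) (Eventually.of_forall fun _ => dist_nonneg) ?_
      rw [eventually_prod_principal_iff]
      filter_upwards [eventually_abs_le_nat t₀] with t ht u _
      have := u.2.2 k _ t₀ t (eventually_abs_le_nat t₀).self_of_nhds ht
      simp only [Function.comp_apply]
      rw [dist_comm, dist_eq_norm]
      exact Real.le_sqrt_of_sq_le this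
    have := key hU
    rw [mem_map, mem_prod_principal] at this
    filter_upwards [this] with t ht u
    exact ht u (Set.mem_univ _)

end HolderBall

/-! ### Polygonal interpolation of a sequence -/

section Polygon

variable {f : ℕ → ℂ} {δ : ℝ} {N : ℕ}

/-- The step function with the value `f n` on `[-N + nδ, -N + (n+1)δ)`, and `f 0` before `-N`. -/
def stepFun (f : ℕ → ℂ) (δ : ℝ) (N : ℕ) (r : ℝ) : ℂ := f ⌊(r + N) / δ⌋₊

/-- The interpolation of the values `f n` at the times `-N + nδ`, written as a moving average of
the step function; it is piecewise linear. -/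
def polygon (f : ℕ → ℂ) (δ : ℝ) (N : ℕ) (t : ℝ) : ℂ := δ⁻¹ • ∫ r in t..t + δ, stepFun f δ N r

lemma measurable_stepFun : Measurable (stepFun f δ N) := by
  unfold stepFun
  exact (measurable_from_top (f := f)).comp (Nat.measurable_floor.comp (by fun_prop))

lemma intervalIntegrable_stepFun (hδ : 0 < δ) (a b : ℝ) :
    IntervalIntegrable (stepFun f δ N) volume a b := by
  refine IntervalIntegrable.mono_fun' (g := fun _ => ∑ i ∈ Finset.range
      (⌊(max a b + N) / δ⌋₊ + 1), ‖f i‖) intervalIntegrable_const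
    measurable_stepFun.aestronglyMeasurable ?_
  refine (ae_restrict_mem measurableSet_uIoc).mono fun r hr => ?_
  refine Finset.single_le_sum (f := fun i => ‖f i‖) (fun i _ => norm_nonneg _) ?_
  rw [Finset.mem_range, Nat.lt_succ_iff]
  refine Nat.floor_le_floor ?_
  have := hr.2
  gcongr

lemma stepFun_add (hδ : 0 < δ) (r : ℝ) (hr : -N ≤ r) :
    stepFun f δ N (r + δ) = f (⌊(r + N) / δ⌋₊ + 1) := by
  unfold stepFun
  rw [show (r + δ + N) / δ = (r + N) / δ + 1 by field_simp; ring,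
    Nat.floor_add_one (div_nonneg (by linarith) hδ.le)]

lemma stepFun_add_of_lt (hδ : 0 < δ) (r : ℝ) (hr : r < -N) :
    stepFun f δ N (r + δ) = stepFun f δ N r := by
  unfold stepFun
  have h1 : (r + N) / δ < 0 := div_neg_of_neg_of_pos (by linarith) hδ
  rw [show (r + δ + N) / δ = (r + N) / δ + 1 by field_simp; ring,
    Nat.floor_of_nonpos h1.le, Nat.floor_eq_zero.2 (by linarith)]

lemma polygon_sub (hδ : 0 < δ) (s t : ℝ) :
    polygon f δ N t - polygon f δ N s =
      ∫ r in s..t, δ⁻¹ • (stepFun f δ N (r + δ) - stepFun f δ N r) := by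
  have hi := fun a b => intervalIntegrable_stepFun (f := f) (N := N) hδ a b
  have hi' : ∀ a b, IntervalIntegrable (fun r => stepFun f δ N (r + δ)) volume a b := fun a b => by
    have := (hi (a + δ) (b + δ)).comp_add_right δ
    simpa using this
  rw [intervalIntegral.integral_smul, intervalIntegral.integral_sub (hi' _ _) (hi _ _),
    intervalIntegral.integral_comp_add_right, polygon, polygon, ← smul_sub]
  congr 1
  have h1 := intervalIntegral.integral_add_adjacent_intervals (hi s t) (hi t (t + δ))
  have h2 := intervalIntegral.integral_add_adjacent_intervals (hi s (s + δ)) (hi (s + δ) (t + δ))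
  linear_combination h1 - h2

lemma intervalIntegrable_stepFun_diff (hδ : 0 < δ) (a b : ℝ) : IntervalIntegrable
    (fun r => δ⁻¹ • (stepFun f δ N (r + δ) - stepFun f δ N r)) volume a b := by
  have := (intervalIntegrable_stepFun (f := f) (N := N) hδ (a + δ) (b + δ)).comp_add_right δ
  have h' : IntervalIntegrable (fun r => stepFun f δ N (r + δ)) volume a b := by simpa using this
  exact (h'.sub (intervalIntegrable_stepFun hδ a b)).smul (δ⁻¹ : ℝ)

lemma continuous_polygon (hδ : 0 < δ) : Continuous (polygon f δ N) := by
  have h : polygon f δ N = fun t => polygon f δ N 0 +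
      ∫ r in (0 : ℝ)..t, δ⁻¹ • (stepFun f δ N (r + δ) - stepFun f δ N r) := by
    funext t
    rw [← polygon_sub hδ]; ring
  rw [h]
  exact continuous_const.add (intervalIntegral.continuous_primitive
    (intervalIntegrable_stepFun_diff hδ) 0)

lemma polygon_grid (hδ : 0 < δ) {t : ℝ} {m : ℕ} (ht : t = m * δ - N) :
    polygon f δ N t = f m := by
  have h : ∫ r in t..t + δ, stepFun f δ N r = ∫ r in t..t + δ, f m := by
    rw [intervalIntegral.integral_of_le (by linarith),
      intervalIntegral.integral_of_le (by linarith), integral_Ioc_eq_integral_Ioo, integral_Ioc_eq_integral_Ioo]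
    refine setIntegral_congr_fun measurableSet_Ioo fun r hr => ?_
    have h1 : ⌊(r + N) / δ⌋₊ = m := by
      rw [Nat.floor_eq_iff (div_nonneg (by
        have := hr.1; have : (0 : ℝ) ≤ m * δ := by positivity
        linarith) hδ.le), le_div_iff₀ hδ, div_lt_iff₀ hδ]
      constructor <;> nlinarith [hr.1, hr.2]
    simp only [stepFun, h1]
  rw [polygon, h, intervalIntegral.integral_const, add_sub_cancel_left, smul_smul,
    inv_mul_cancel₀ hδ.ne', one_smul]

/-- The interpolation stays close to the step function. -/
lemma norm_polygon_sub_stepFun_le (hδ : 0 < δ) (t : ℝ) :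
    ‖polygon f δ N t - stepFun f δ N t‖ ≤
      ‖f (⌊(t + N) / δ⌋₊ + 1) - f ⌊(t + N) / δ⌋₊‖ := by
  set n := ⌊(t + N) / δ⌋₊ with hn
  have h0 : polygon f δ N t - stepFun f δ N t =
      δ⁻¹ • ∫ r in t..t + δ, (stepFun f δ N r - f n) := by
    rw [intervalIntegral.integral_sub (intervalIntegrable_stepFun hδ _ _)
      intervalIntegrable_const, intervalIntegral.integral_const, smul_sub, add_sub_cancel_left,
      smul_smul, inv_mul_cancel₀ hδ.ne', one_smul, polygon]
    rfl
  have h1 : ∀ r ∈ Set.uIoc t (t + δ), ‖stepFun f δ N r - f n‖ ≤ ‖f (n + 1) - f n‖ := by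
    intro r hr
    rw [Set.uIoc_of_le (by linarith)] at hr
    have hle : n ≤ ⌊(r + N) / δ⌋₊ := Nat.floor_le_floor (by gcongr; exact hr.1.le)
    have hle' : ⌊(r + N) / δ⌋₊ ≤ n + 1 := by
      calc ⌊(r + N) / δ⌋₊ ≤ ⌊(t + N) / δ + 1⌋₊ := by
            refine Nat.floor_le_floor ?_
            rw [div_add_one hδ.ne']
            refine div_le_div_of_nonneg_right ?_ hδ.le
            linarith [hr.2]
        _ ≤ n + 1 := by
            rcases le_or_gt 0 ((t + N) / δ) with h | h
            · rw [Nat.floor_add_one h]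
            · have : ⌊(t + N) / δ + 1⌋₊ = 0 := Nat.floor_eq_zero.2 (by linarith)
              omega
    unfold stepFun
    rcases (show ⌊(r + N) / δ⌋₊ = n ∨ ⌊(r + N) / δ⌋₊ = n + 1 by omega) with h | h
    · rw [h]; simp
    · rw [h]
  rw [h0, norm_smul, norm_inv, Real.norm_of_nonneg hδ.le]
  have h2 := intervalIntegral.norm_integral_le_of_norm_le_const h1
  rw [add_sub_cancel_left, abs_of_pos hδ] at h2
  calc δ⁻¹ * _ ≤ δ⁻¹ * (‖f (n + 1) - f n‖ * δ) := by gcongr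
    _ = _ := by field_simp

end Polygon

/-! ### Interpolated orbits of a measure-preserving map -/

section Orbit

variable {ι : Type}

instance : MeasurableSpace C(ℝ, ι → ℂ) := borel _

instance : BorelSpace C(ℝ, ι → ℂ) := ⟨rfl⟩

/-- A map into the path space is measurable if it is at every time: the path space is Polish, and
evaluation at the rational times is injective. -/
lemma measurable_path_of_eval [Countable ι] {Y : Type*} [MeasurableSpace Y] {g : Y → C(ℝ, ι → ℂ)}
    (hg : ∀ t, Measurable fun y => g y t) : Measurable g := by
  have hc : Continuous fun (u : C(ℝ, ι → ℂ)) (q : ℚ) => u (q : ℝ) :=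
    continuous_pi fun q => continuous_eval_const _
  have hinj : Function.Injective fun (u : C(ℝ, ι → ℂ)) (q : ℚ) => u (q : ℝ) := by
    intro u v h
    refine DFunLike.coe_injective ?_
    refine DenseRange.equalizer (f := fun q : ℚ => (q : ℝ)) Rat.denseRange_cast
      u.continuous v.continuous ?_
    funext q
    exact congrFun h q
  refine (hc.measurableEmbedding hinj).measurable_comp_iff.1 ?_
  exact measurable_pi_lambda _ fun q => hg q

lemma measurable_path_eval [Countable ι] : Measurable fun p : C(ℝ, ι → ℂ) × ℝ => p.1 p.2 :=
  ContinuousEval.continuous_eval.measurable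

lemma sq_lintegral_le {Y : Type*} [MeasurableSpace Y] (ν : Measure Y) {h : Y → ENNReal}
    (hh : AEMeasurable h ν) : (∫⁻ y, h y ∂ν) ^ 2 ≤ ν Set.univ * ∫⁻ y, h y ^ 2 ∂ν := by
  have h2 : (2 : ℝ).HolderConjugate 2 := by
    rw [Real.holderConjugate_iff]; norm_num
  have := ENNReal.lintegral_mul_le_Lp_mul_Lq ν h2 (f := fun _ => 1) (g := h) aemeasurable_const hh
  simp only [Pi.mul_apply, one_mul, ENNReal.one_rpow, lintegral_const] at this
  calc (∫⁻ y, h y ∂ν) ^ 2 ≤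
      (ν Set.univ ^ (1 / 2 : ℝ) * (∫⁻ y, h y ^ (2 : ℝ) ∂ν) ^ (1 / 2 : ℝ)) ^ 2 :=
        pow_le_pow_left' this 2
    _ = _ := by
      rw [mul_pow, ← ENNReal.rpow_natCast, ← ENNReal.rpow_natCast, ← ENNReal.rpow_mul,
        ← ENNReal.rpow_mul]
      norm_num

lemma sq_enorm_intervalIntegral_le {g : ℝ → ℂ} (hg : Measurable g) (s t : ℝ) :
    ‖∫ r in s..t, g r‖ₑ ^ 2 ≤ ENNReal.ofReal |t - s| * ∫⁻ r in Set.uIoc s t, ‖g r‖ₑ ^ 2 := by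
  have h1 : ‖∫ r in s..t, g r‖ₑ ≤ ∫⁻ r in Set.uIoc s t, ‖g r‖ₑ := by
    rw [← ofReal_norm, intervalIntegral.norm_intervalIntegral_eq, ofReal_norm]
    exact enorm_integral_le_lintegral_enorm _
  refine (pow_le_pow_left' h1 2).trans ((sq_lintegral_le _ hg.enorm.aemeasurable).trans ?_)
  rw [Measure.restrict_apply_univ, Set.uIoc, Real.volume_Ioc, max_sub_min_eq_abs]

variable {μ : Measure (ι → ℂ)} {T : (ι → ℂ) → ι → ℂ} {δ : ℝ} {N : ℕ}

/-- The path that interpolates the orbit `x, T x, T² x, …` at the times `-N, -N + δ, …`. -/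
def orbitPath (T : (ι → ℂ) → ι → ℂ) {δ : ℝ} (hδ : 0 < δ) (N : ℕ) (x : ι → ℂ) : C(ℝ, ι → ℂ) :=
  ⟨fun t k => polygon (fun n => T^[n] x k) δ N t, continuous_pi fun _ => continuous_polygon hδ⟩

/-- The point of the orbit `x, T x, T² x, …` at time `r`. -/
def orbitPoint (T : (ι → ℂ) → ι → ℂ) (δ : ℝ) (N : ℕ) (x : ι → ℂ) (r : ℝ) : ι → ℂ :=
  T^[⌊(r + N) / δ⌋₊] x

lemma measurable_orbitPoint (hT : Measurable T) :
    Measurable fun p : (ι → ℂ) × ℝ => orbitPoint T δ N p.1 p.2 := by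
  have h1 : Measurable fun q : ℕ × (ι → ℂ) => T^[q.1] q.2 :=
    measurable_from_prod_countable_right fun n => hT.iterate n
  exact h1.comp ((Nat.measurable_floor.comp
    ((measurable_snd.add_const _).div_const _)).prodMk measurable_fst)

lemma measurePreserving_orbitPoint (hT : MeasurePreserving T μ μ) (r : ℝ) :
    MeasurePreserving (fun x => orbitPoint T δ N x r) μ μ := hT.iterate _

lemma measurable_orbitPath [Countable ι] (hT : Measurable T) (hδ : 0 < δ) :
    Measurable (orbitPath T hδ N) := by
  refine measurable_path_of_eval fun t => measurable_pi_lambda _ fun k => ?_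
  change Measurable fun x => polygon (fun n => T^[n] x k) δ N t
  unfold polygon
  refine Measurable.fun_const_smul ?_ (δ⁻¹ : ℝ)
  simp_rw [intervalIntegral.integral_of_le (show t ≤ t + δ by linarith)]
  have : Measurable fun p : (ι → ℂ) × ℝ => orbitPoint T δ N p.1 p.2 k :=
    (measurable_pi_apply k).comp (measurable_orbitPoint hT)
  exact (this.stronglyMeasurable.integral_prod_right' (ν := volume.restrict _)).measurable

/-- The velocity of the interpolated orbit at time `r`. -/
def orbitVel (T : (ι → ℂ) → ι → ℂ) (δ : ℝ) (N : ℕ) (k : ι) (x : ι → ℂ) (r : ℝ) : ℂ :=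
  δ⁻¹ • (orbitPoint T δ N x (r + δ) k - orbitPoint T δ N x r k)

lemma measurable_orbitVel (hT : Measurable T) (k : ι) :
    Measurable fun p : (ι → ℂ) × ℝ => orbitVel T δ N k p.1 p.2 := by
  have h1 : Measurable fun p : (ι → ℂ) × ℝ => orbitPoint T δ N p.1 p.2 k :=
    (measurable_pi_apply k).comp (measurable_orbitPoint hT)
  have h2 : Measurable fun p : (ι → ℂ) × ℝ => orbitPoint T δ N p.1 (p.2 + δ) k :=
    h1.comp (measurable_fst.prodMk (measurable_snd.add_const δ))
  exact (h2.sub h1).const_smul (δ⁻¹ : ℝ)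

lemma orbitPath_sub (hδ : 0 < δ) (x : ι → ℂ) (k : ι) (s t : ℝ) :
    orbitPath T hδ N x t k - orbitPath T hδ N x s k = ∫ r in s..t, orbitVel T δ N k x r :=
  polygon_sub hδ s t

lemma intervalIntegrable_orbitVel (hδ : 0 < δ) (x : ι → ℂ) (k : ι) (s t : ℝ) :
    IntervalIntegrable (orbitVel T δ N k x) volume s t := by
  have h := intervalIntegrable_stepFun_diff (f := fun n => T^[n] x k) (N := N) hδ s t
  exact h

lemma orbitVel_eq (hδ : 0 < δ) (x : ι → ℂ) (k : ι) {r : ℝ} (hr : -N ≤ r) :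
    orbitVel T δ N k x r = δ⁻¹ • (T (orbitPoint T δ N x r) k - orbitPoint T δ N x r k) := by
  have := stepFun_add (f := fun n => T^[n] x k) hδ r hr
  unfold orbitVel
  congr 2
  refine this.trans ?_
  rw [Function.iterate_succ_apply']
  rfl

lemma orbitVel_eq_zero (hδ : 0 < δ) (x : ι → ℂ) (k : ι) {r : ℝ} (hr : r < -N) :
    orbitVel T δ N k x r = 0 := by
  have := stepFun_add_of_lt (f := fun n => T^[n] x k) hδ r hr
  have h2 : orbitPoint T δ N x (r + δ) k = orbitPoint T δ N x r k := this
  rw [orbitVel, h2, sub_self, smul_zero]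

lemma lintegral_orbitVel_le (hT : MeasurePreserving T μ μ) (hδ : 0 < δ) {k : ι} (r : ℝ) :
    ∫⁻ x, ‖orbitVel T δ N k x r‖ₑ ^ 2 ∂μ ≤ ∫⁻ x, ‖δ⁻¹ • (T x k - x k)‖ₑ ^ 2 ∂μ := by
  rcases le_or_gt (-(N : ℝ)) r with hr | hr
  · simp_rw [orbitVel_eq hδ _ k hr]
    have hm : Measurable fun x : ι → ℂ => ‖δ⁻¹ • (T x k - x k)‖ₑ ^ 2 := by
      have := hT.measurable
      fun_prop
    exact ((measurePreserving_orbitPoint hT r).lintegral_comp hm).le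
  · simp [orbitVel_eq_zero hδ _ k hr]

lemma lintegral_lintegral_orbitVel_le [SFinite μ] (hT : MeasurePreserving T μ μ) (hδ : 0 < δ)
    (k : ι) (S : ℝ) :
    ∫⁻ x, (∫⁻ r in Set.Icc (-S) S, ‖orbitVel T δ N k x r‖ₑ ^ 2) ∂μ ≤
      ENNReal.ofReal (2 * S) * ∫⁻ x, ‖δ⁻¹ • (T x k - x k)‖ₑ ^ 2 ∂μ := by
  rw [lintegral_lintegral_swap]
  · refine (lintegral_mono fun r => lintegral_orbitVel_le hT hδ r).trans ?_
    rw [lintegral_const, Measure.restrict_apply_univ, Real.volume_Icc, mul_comm,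
      show S - -S = 2 * S by ring]
  · exact ((measurable_orbitVel hT.measurable k).enorm.pow_const 2).aemeasurable

lemma sq_enorm_orbitPath_sub_le (hT : Measurable T) (hδ : 0 < δ) (x : ι → ℂ) (k : ι) {S s t : ℝ}
    (hs : |s| ≤ S) (ht : |t| ≤ S) :
    ‖orbitPath T hδ N x t k - orbitPath T hδ N x s k‖ₑ ^ 2 ≤
      ENNReal.ofReal |t - s| * ∫⁻ r in Set.Icc (-S) S, ‖orbitVel T δ N k x r‖ₑ ^ 2 := by
  have hm : Measurable (orbitVel T δ N k x) :=
    Measurable.of_uncurry_left (f := orbitVel T δ N k) (measurable_orbitVel hT k)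
  have h1 := sq_enorm_intervalIntegral_le hm s t
  rw [← orbitPath_sub hδ] at h1
  refine h1.trans (mul_le_mul_right (lintegral_mono_set fun r hr => ?_) _)
  rw [abs_le] at hs ht
  rw [Set.mem_uIoc] at hr
  constructor <;> rcases hr with hr | hr <;> linarith [hr.1, hr.2]

lemma norm_orbitPath_sub_orbitPoint_le (hδ : 0 < δ) (x : ι → ℂ) (k : ι) (t : ℝ) :
    ‖orbitPath T hδ N x t k - orbitPoint T δ N x t k‖ ≤
      ‖T (orbitPoint T δ N x t) k - orbitPoint T δ N x t k‖ := by
  have := norm_polygon_sub_stepFun_le (f := fun n => T^[n] x k) (N := N) hδ t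
  simp only [Function.iterate_succ_apply'] at this
  exact this

lemma orbitPath_grid (hδ : 0 < δ) (x : ι → ℂ) {t : ℝ} {m : ℕ} (ht : t = m * δ - N) :
    orbitPath T hδ N x t = T^[m] x :=
  funext fun _ => polygon_grid hδ ht

/-- The laws of interpolated orbits are tight, if the squares of the velocities have uniformly
bounded means. -/
lemma isTightMeasureSet_orbitPath [Countable ι] [IsProbabilityMeasure μ]
    (hμ : ∀ k, ∫⁻ x, ‖x k‖ₑ ^ 2 ∂μ ≠ ⊤)
    {T : ℕ → (ι → ℂ) → ι → ℂ} (hT : ∀ n, MeasurePreserving (T n) μ μ)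
    {δ : ℕ → ℝ} (hδ : ∀ n, 0 < δ n) (hgrid : ∀ n, ∃ m : ℕ, (0 : ℝ) = m * δ n - n) {D : ι → ENNReal}
    (hD : ∀ k, D k ≠ ⊤) (hTD : ∀ n k, ∫⁻ x, ‖(δ n)⁻¹ • (T n x k - x k)‖ₑ ^ 2 ∂μ ≤ D k) :
    IsTightMeasureSet (Set.range fun n => μ.map (orbitPath (T n) (hδ n) n)) := by
  rw [isTightMeasureSet_iff_exists_isCompact_measure_compl_le]
  intro ε hε
  obtain ⟨ε₁, hε₁, hs₁⟩ := ENNReal.exists_pos_sum_of_countable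
    (ENNReal.half_pos hε.ne').ne' ι
  obtain ⟨ε₂, hε₂, hs₂⟩ := ENNReal.exists_pos_sum_of_countable
    (ENNReal.half_pos hε.ne').ne' (ι × ℕ)
  -- Markov's inequality dictates the thresholds.
  set a : ι → ENNReal := fun k => (∫⁻ x, ‖x k‖ₑ ^ 2 ∂μ) / ε₁ k + 1 with ha
  set b : ι → ℕ → ENNReal := fun k S => (ENNReal.ofReal (2 * S) * D k) / ε₂ (k, S) + 1 with hb
  have ha_top : ∀ k, a k ≠ ⊤ := fun k => ENNReal.add_ne_top.2
    ⟨ENNReal.div_ne_top (hμ k) (ENNReal.coe_ne_zero.2 (hε₁ k).ne'), ENNReal.one_ne_top⟩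
  have hb_top : ∀ k S, b k S ≠ ⊤ := fun k S => ENNReal.add_ne_top.2
    ⟨ENNReal.div_ne_top (ENNReal.mul_ne_top ENNReal.ofReal_ne_top (hD k))
      (ENNReal.coe_ne_zero.2 (hε₂ (k, S)).ne'), ENNReal.one_ne_top⟩
  refine ⟨holderBall (fun k => Real.sqrt (a k).toReal) (fun k S => (b k S).toReal),
    isCompact_holderBall _ _, ?_⟩
  rintro _ ⟨n, rfl⟩
  have hmT := (hT n).measurable
  dsimp only
  rw [Measure.map_apply (measurable_orbitPath hmT (hδ n))
    (isCompact_holderBall _ _).measurableSet.compl]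
  have hsub : orbitPath (T n) (hδ n) n ⁻¹' (holderBall (fun k => Real.sqrt (a k).toReal)
      (fun k S => (b k S).toReal))ᶜ ⊆
      (⋃ k, {x | a k ≤ ‖orbitPath (T n) (hδ n) n x 0 k‖ₑ ^ 2}) ∪
      ⋃ p : ι × ℕ, {x | b p.1 p.2 ≤
        ∫⁻ r in Set.Icc (-(p.2 : ℝ)) p.2, ‖orbitVel (T n) (δ n) n p.1 x r‖ₑ ^ 2} := by
    intro x hx
    by_contra hcon
    simp only [Set.mem_union, Set.mem_iUnion, Set.mem_ofPred_eq, not_or, not_exists, not_le] at hcon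
    refine hx ⟨fun k => ?_, fun k S s t hs ht => ?_⟩
    · refine Real.le_sqrt_of_sq_le ?_
      have h1 := ENNReal.toReal_mono (ha_top k) (hcon.1 k).le
      simpa using h1
    · have h1 := sq_enorm_orbitPath_sub_le (N := n) hmT (hδ n) x k hs ht
      have h2 : ‖orbitPath (T n) (hδ n) n x t k - orbitPath (T n) (hδ n) n x s k‖ₑ ^ 2 ≤
          ENNReal.ofReal |t - s| * b k S := h1.trans
            (mul_le_mul_right (hcon.2 (k, S)).le _)
      have h3 := ENNReal.toReal_mono (ENNReal.mul_ne_top ENNReal.ofReal_ne_top (hb_top k S)) h2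
      rw [ENNReal.toReal_mul, ENNReal.toReal_ofReal (abs_nonneg _), mul_comm] at h3
      simpa using h3
  have markov : ∀ (g : (ι → ℂ) → ENNReal), Measurable g → ∀ (E e : ENNReal), e ≠ 0 → e ≠ ⊤ →
      ∫⁻ x, g x ∂μ ≤ E → E ≠ ⊤ → μ {x | E / e + 1 ≤ g x} ≤ e := by
    intro g hg E e he he' hE hE'
    refine (meas_ge_le_lintegral_div hg.aemeasurable (by simp)
      (ENNReal.add_ne_top.2 ⟨ENNReal.div_ne_top hE' he, ENNReal.one_ne_top⟩)).trans ?_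
    refine ENNReal.div_le_of_le_mul (hE.trans ?_)
    rw [mul_add, ENNReal.mul_div_cancel he he']
    exact le_self_add
  obtain ⟨m, hm⟩ := hgrid n
  calc _ ≤ _ := measure_mono hsub
    _ ≤ _ := measure_union_le _ _
    _ ≤ (∑' k, (ε₁ k : ENNReal)) + ∑' p, (ε₂ p : ENNReal) := by
      refine add_le_add ((measure_iUnion_le _).trans (ENNReal.tsum_le_tsum fun k => ?_))
        ((measure_iUnion_le _).trans (ENNReal.tsum_le_tsum fun p => ?_))
      · refine markov _ ?_ _ _ (ENNReal.coe_ne_zero.2 (hε₁ k).ne') ENNReal.coe_ne_top ?_ (hμ k)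
        · have : Measurable fun x => orbitPath (T n) (hδ n) n x 0 :=
            (continuous_eval_const (0 : ℝ)).measurable.comp (measurable_orbitPath hmT (hδ n))
          fun_prop
        · simp_rw [orbitPath_grid (hδ n) _ hm]
          exact (((hT n).iterate m).lintegral_comp
            (f := fun x : ι → ℂ => ‖x k‖ₑ ^ 2) (by fun_prop)).le
      · refine markov _ ?_ _ _ (ENNReal.coe_ne_zero.2 (hε₂ p).ne') ENNReal.coe_ne_top
          ((lintegral_lintegral_orbitVel_le (hT n) (hδ n) p.1 p.2).trans ?_)
          (ENNReal.mul_ne_top ENNReal.ofReal_ne_top (hD p.1))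
        · exact ((measurable_orbitVel hmT p.1).enorm.pow_const 2).lintegral_prod_right'
        · exact mul_le_mul_right (hTD n p.1) _
    _ ≤ ε / 2 + ε / 2 := add_le_add hs₁.le hs₂.le
    _ = ε := ENNReal.add_halves ε

end Orbit

/-! ### Stationary solutions as limits of orbits -/

section Stationary

variable {ι : Type}

/-- Local Lipschitz continuity with linear growth of the constant, in finitely many coordinates;
quadratic polynomials are of this kind. -/
def IsQuadLip (f : (ι → ℂ) → ℂ) : Prop :=
  ∃ (J : Finset ι) (C : ℝ), ∀ x y, ‖f x - f y‖ ≤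
    C * ∑ i ∈ J, ∑ l ∈ J, ‖x i - y i‖ * (‖x l‖ + ‖y l‖)

lemma IsQuadLip.continuous {f : (ι → ℂ) → ℂ} (hf : IsQuadLip f) : Continuous f := by
  obtain ⟨J, C, h⟩ := hf
  refine continuous_iff_continuousAt.2 fun x => tendsto_iff_norm_sub_tendsto_zero.2 ?_
  have h1 : Tendsto (fun y : ι → ℂ => C * ∑ i ∈ J, ∑ l ∈ J, ‖y i - x i‖ * (‖y l‖ + ‖x l‖))
      (𝓝 x) (𝓝 0) := by
    have : Continuous fun y : ι → ℂ => C * ∑ i ∈ J, ∑ l ∈ J, ‖y i - x i‖ * (‖y l‖ + ‖x l‖) := by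
      fun_prop
    simpa using this.tendsto x
  exact squeeze_zero (fun _ => norm_nonneg _) (fun y => h y x) h1

lemma lintegral_enorm_mul_le {Y : Type*} [MeasurableSpace Y] {ν : Measure Y} {f g : Y → ℂ}
    (hf : AEStronglyMeasurable f ν) (hg : AEStronglyMeasurable g ν) :
    ∫⁻ y, ‖f y‖ₑ * ‖g y‖ₑ ∂ν ≤ eLpNorm f 2 ν * eLpNorm g 2 ν := by
  have h2 : (2 : ℝ).HolderConjugate 2 := by
    rw [Real.holderConjugate_iff]; norm_num
  have := ENNReal.lintegral_mul_le_Lp_mul_Lq ν h2 hf.enorm hg.enorm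
  simpa [eLpNorm_eq_lintegral_rpow_enorm_toReal] using this

lemma eLpNorm_two_sq {Y : Type*} [MeasurableSpace Y] {ν : Measure Y} (f : Y → ℂ) :
    eLpNorm f 2 ν ^ 2 = ∫⁻ y, ‖f y‖ₑ ^ 2 ∂ν := by
  rw [eLpNorm_eq_lintegral_rpow_enorm_toReal (by norm_num) (by norm_num), ← ENNReal.rpow_natCast,
    ← ENNReal.rpow_mul]
  norm_num

lemma iSup_ne_top_of_eventually_le {u : ℕ → ENNReal} {c : ENNReal} (hc : c ≠ ⊤)
    (hu : ∀ n, u n ≠ ⊤) (h : ∀ᶠ n in atTop, u n ≤ c) : ⨆ n, u n ≠ ⊤ := by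
  obtain ⟨N, hN⟩ := eventually_atTop.1 h
  refine ne_top_of_le_ne_top (b := c + ∑ i ∈ Finset.range N, u i)
    (ENNReal.add_ne_top.2 ⟨hc, ENNReal.sum_ne_top.2 fun i _ => hu i⟩) (iSup_le fun n => ?_)
  rcases lt_or_ge n N with hn | hn
  · exact (Finset.single_le_sum (f := u) (fun _ _ => zero_le) (Finset.mem_range.2 hn)).trans
      le_add_self
  · exact (hN n hn).trans le_self_add

lemma exists_nat_grid {t : ℝ} {a : ℤ} {b n j : ℕ} (ht : t = a / 2 ^ b) (hbj : b ≤ j)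
    (hn : -(n : ℝ) ≤ t) : ∃ m : ℕ, t = m * ((2 : ℝ) ^ j)⁻¹ - n := by
  obtain ⟨c, rfl⟩ := Nat.exists_eq_add_of_le hbj
  have hm : (0 : ℤ) ≤ a * 2 ^ c + n * 2 ^ (b + c) := by
    have h2 : (0 : ℝ) ≤ (t + n) * 2 ^ (b + c) := mul_nonneg (by linarith) (by positivity)
    have h3 : (t + n) * 2 ^ (b + c) = a * 2 ^ c + n * 2 ^ (b + c) := by
      rw [ht, pow_add]; field_simp
    rw [h3] at h2
    exact_mod_cast h2
  obtain ⟨m, hm'⟩ := Int.eq_ofNat_of_zero_le hm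
  refine ⟨m, ?_⟩
  have h4 : (m : ℝ) = a * 2 ^ c + n * 2 ^ (b + c) := by
    have := congrArg (Int.cast (R := ℝ)) hm'
    push_cast at this
    exact this.symm
  rw [h4, ht, pow_add]
  field_simp
  ring

variable [Countable ι] {μ : Measure (ι → ℂ)} [IsProbabilityMeasure μ]

/-- The law of an interpolated orbit. -/
def orbitLaw (μ : Measure (ι → ℂ)) [IsProbabilityMeasure μ] {T : (ι → ℂ) → ι → ℂ}
    (hT : MeasurePreserving T μ μ) {δ : ℝ} (hδ : 0 < δ) (N : ℕ) :
    ProbabilityMeasure C(ℝ, ι → ℂ) :=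
  ⟨μ.map (orbitPath T hδ N),
    Measure.isProbabilityMeasure_map (measurable_orbitPath hT.measurable hδ).aemeasurable⟩

/-- A limit of laws of interpolated orbits on dyadic grids has the marginal `μ` at every time:
at a dyadic time the marginals of the approximations are eventually equal to `μ`, and the paths
are continuous. -/
lemma measurePreserving_eval_of_tendsto {T : ℕ → (ι → ℂ) → ι → ℂ}
    (hT : ∀ n, MeasurePreserving (T n) μ μ) {j : ℕ → ℕ} (hj : ∀ n, n ≤ j n)
    (hδ : ∀ n, 0 < ((2 : ℝ) ^ j n)⁻¹) {l : Filter ℕ} [l.NeBot] (hl : l ≤ atTop)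
    {Q : ProbabilityMeasure C(ℝ, ι → ℂ)}
    (hQ : Tendsto (fun n => orbitLaw μ (hT n) (hδ n) n) l (𝓝 Q)) (t : ℝ) :
    MeasurePreserving (fun u : C(ℝ, ι → ℂ) => u t) Q μ := by
  have hc : ∀ t : ℝ, Continuous fun u : C(ℝ, ι → ℂ) => u t := fun t => continuous_eval_const t
  refine ⟨(hc t).measurable, ?_⟩
  have dyadic : ∀ (t : ℝ) (a : ℤ) (b : ℕ), t = a / 2 ^ b →
      (Q : Measure C(ℝ, ι → ℂ)).map (fun u => u t) = μ := by
    intro t a b ht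
    have h1 := ((ProbabilityMeasure.continuous_map (hc t)).tendsto Q).comp hQ
    have h2 : ∀ᶠ n in l, (orbitLaw μ (hT n) (hδ n) n).map (hc t).measurable.aemeasurable =
        (⟨μ, inferInstance⟩ : ProbabilityMeasure (ι → ℂ)) := by
      refine hl ?_
      filter_upwards [eventually_ge_atTop b, eventually_ge_atTop ⌈-t⌉₊] with n hn hn'
      refine Subtype.ext ?_
      obtain ⟨m, hm⟩ := exists_nat_grid (n := n) ht (hn.trans (hj n))
        (by have := (Nat.le_ceil (-t)).trans (Nat.cast_le.2 hn'); linarith)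
      change Measure.map (fun u : C(ℝ, ι → ℂ) => u t) (μ.map (orbitPath (T n) (hδ n) n)) = μ
      rw [Measure.map_map (hc t).measurable (measurable_orbitPath (hT n).measurable (hδ n))]
      have h3 : (fun u : C(ℝ, ι → ℂ) => u t) ∘ orbitPath (T n) (hδ n) n = (T n)^[m] := by
        funext x
        exact orbitPath_grid (hδ n) x hm
      rw [h3]
      exact ((hT n).iterate m).map_eq
    have h4 := tendsto_nhds_unique h1 (tendsto_const_nhds.congr' (h2.mono fun n hn => hn.symm))
    exact congrArg Subtype.val h4
  have : IsProbabilityMeasure ((Q : Measure C(ℝ, ι → ℂ)).map (fun u => u t)) :=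
    Measure.isProbabilityMeasure_map (hc t).measurable.aemeasurable
  refine ext_of_forall_integral_eq_of_IsFiniteMeasure fun f => ?_
  rw [integral_map (hc t).measurable.aemeasurable f.continuous.aestronglyMeasurable]
  have hlim : Tendsto (fun i : ℕ => (⌊t * 2 ^ i⌋ : ℝ) / 2 ^ i) atTop (𝓝 t) := by
    have h0 : Tendsto (fun i : ℕ => t - (1 / 2 : ℝ) ^ i) atTop (𝓝 t) := by
      simpa using (tendsto_const_nhds (x := t)).sub (tendsto_pow_atTop_nhds_zero_of_lt_one
        (by norm_num : (0 : ℝ) ≤ 1 / 2) (by norm_num))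
    refine tendsto_of_tendsto_of_tendsto_of_le_of_le h0 tendsto_const_nhds ?_ ?_
    · intro i
      have h2 : (0 : ℝ) < 2 ^ i := by positivity
      simp only [one_div, inv_pow]
      rw [← sub_nonneg]
      have := Int.sub_one_lt_floor (t * 2 ^ i)
      have h3 : (⌊t * 2 ^ i⌋ : ℝ) / 2 ^ i - (t - (2 ^ i)⁻¹) =
        (⌊t * 2 ^ i⌋ - (t * 2 ^ i - 1)) / 2 ^ i := by field_simp
      rw [h3]
      exact div_nonneg (by linarith) h2.le
    · intro i
      have h2 : (0 : ℝ) < 2 ^ i := by positivity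
      rw [div_le_iff₀ h2]
      exact Int.floor_le _
  have h5 : Tendsto (fun i : ℕ => ∫ u : C(ℝ, ι → ℂ), f (u ((⌊t * 2 ^ i⌋ : ℝ) / 2 ^ i)) ∂Q) atTop
      (𝓝 (∫ u : C(ℝ, ι → ℂ), f (u t) ∂Q)) := by
    refine tendsto_integral_of_dominated_convergence (fun _ => ‖f‖)
      (fun i => (f.continuous.comp (hc _)).aestronglyMeasurable) (integrable_const _)
      (fun i => Eventually.of_forall fun u => f.norm_coe_le_norm _)
      (Eventually.of_forall fun u => ?_)
    exact ((f.continuous.comp u.continuous).tendsto t).comp hlim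
  refine tendsto_nhds_unique h5 (tendsto_const_nhds.congr fun i => ?_)
  rw [← dyadic _ _ _ rfl,
    integral_map (hc _).measurable.aemeasurable f.continuous.aestronglyMeasurable]

end Stationary

section Stationary

variable {ι : Type} {μ : Measure (ι → ℂ)}

/-! ### The defect of interpolated orbits -/

/-- Replacing the interpolated orbit by the orbit itself changes `f` little in the mean. -/
lemma lintegral_sub_orbitPoint_le {T : (ι → ℂ) → ι → ℂ} (hT : MeasurePreserving T μ μ) {δ : ℝ}
    (hδ : 0 < δ) (N : ℕ) {f : (ι → ℂ) → ℂ} {J : Finset ι} {C : ℝ} (hC : 0 ≤ C)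
    (hf : ∀ x y, ‖f x - f y‖ ≤ C * ∑ i ∈ J, ∑ l ∈ J, ‖x i - y i‖ * (‖x l‖ + ‖y l‖)) (r : ℝ) :
    ∫⁻ x, ‖f (orbitPoint T δ N x r) - f (orbitPath T hδ N x r)‖ₑ ∂μ ≤
      ENNReal.ofReal C * ∑ i ∈ J, ∑ l ∈ J, eLpNorm (fun x => T x i - x i) 2 μ *
        (2 * eLpNorm (fun x => x l) 2 μ + eLpNorm (fun x => T x l - x l) 2 μ) := by
  have hm := hT.measurable
  set G : (ι → ℂ) → ENNReal := fun x => ENNReal.ofReal C * ∑ i ∈ J, ∑ l ∈ J,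
    (2 * (‖T x i - x i‖ₑ * ‖x l‖ₑ) + ‖T x i - x i‖ₑ * ‖T x l - x l‖ₑ) with hG
  have hGm : Measurable G := by
    refine Measurable.const_mul (Finset.measurable_fun_sum _ fun i _ =>
      Finset.measurable_fun_sum _ fun l _ => ?_) _
    fun_prop
  have h1 : ∀ x, ‖f (orbitPoint T δ N x r) - f (orbitPath T hδ N x r)‖ₑ ≤
      G (orbitPoint T δ N x r) := by
    intro x
    set p := orbitPoint T δ N x r
    set q := orbitPath T hδ N x r
    have hd : ∀ i, ‖q i - p i‖ ≤ ‖T p i - p i‖ := fun i =>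
      norm_orbitPath_sub_orbitPoint_le hδ x i r
    have h2 : ‖f p - f q‖ ≤ C * ∑ i ∈ J, ∑ l ∈ J,
        (2 * (‖T p i - p i‖ * ‖p l‖) + ‖T p i - p i‖ * ‖T p l - p l‖) := by
      refine (hf p q).trans (mul_le_mul_of_nonneg_left (Finset.sum_le_sum fun i _ =>
        Finset.sum_le_sum fun l _ => ?_) hC)
      have h3 : ‖q l‖ ≤ ‖p l‖ + ‖T p l - p l‖ := by
        calc ‖q l‖ = ‖p l + (q l - p l)‖ := by congr 1; ring
          _ ≤ _ := (norm_add_le _ _).trans (by linarith [hd l])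
      have h4 : ‖p i - q i‖ ≤ ‖T p i - p i‖ := by rw [norm_sub_rev]; exact hd i
      calc ‖p i - q i‖ * (‖p l‖ + ‖q l‖) ≤
          ‖T p i - p i‖ * (‖p l‖ + (‖p l‖ + ‖T p l - p l‖)) := by gcongr
        _ = _ := by ring
    have h5 := ENNReal.ofReal_le_ofReal h2
    rw [ofReal_norm] at h5
    refine h5.trans (le_of_eq ?_)
    rw [hG, ENNReal.ofReal_mul hC, ENNReal.ofReal_sum_of_nonneg fun i _ => by positivity]
    congr 1
    refine Finset.sum_congr rfl fun i _ => ?_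
    rw [ENNReal.ofReal_sum_of_nonneg fun i _ => by positivity]
    refine Finset.sum_congr rfl fun l _ => ?_
    rw [ENNReal.ofReal_add (by positivity) (by positivity), ENNReal.ofReal_mul (by positivity),
      ENNReal.ofReal_mul (by positivity), ENNReal.ofReal_mul (by positivity)]
    simp [ofReal_norm]
  refine (lintegral_mono h1).trans ?_
  rw [(measurePreserving_orbitPoint hT r).lintegral_comp hGm, hG, lintegral_const_mul]
  swap
  · refine Finset.measurable_fun_sum _ fun i _ => Finset.measurable_fun_sum _ fun l _ => ?_
    fun_prop
  refine mul_le_mul_right ?_ _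
  rw [lintegral_finsetSum _ fun i _ => Finset.measurable_fun_sum _ fun l _ => by fun_prop]
  refine Finset.sum_le_sum fun i _ => ?_
  rw [lintegral_finsetSum _ fun l _ => by fun_prop]
  refine Finset.sum_le_sum fun l _ => ?_
  have hTm : ∀ i, AEStronglyMeasurable (fun x => T x i - x i) μ := fun i => by
    have : Measurable fun x => T x i - x i := by fun_prop
    exact this.aestronglyMeasurable
  have hxm : AEStronglyMeasurable (fun x : ι → ℂ => x l) μ :=
    (measurable_pi_apply l).aestronglyMeasurable
  rw [lintegral_add_left (by fun_prop), lintegral_const_mul _ (by fun_prop)]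
  calc _ ≤ 2 * (eLpNorm (fun x => T x i - x i) 2 μ * eLpNorm (fun x => x l) 2 μ) +
        eLpNorm (fun x => T x i - x i) 2 μ * eLpNorm (fun x => T x l - x l) 2 μ :=
      add_le_add (mul_le_mul_right (lintegral_enorm_mul_le (hTm i) hxm) _)
        (lintegral_enorm_mul_le (hTm i) (hTm l))
    _ = _ := by ring

/-- How much the interpolated orbit fails to solve the equation with the approximate right-hand
side `f`, in the mean. -/
lemma lintegral_defect_le [Countable ι] [IsProbabilityMeasure μ]
    {T : (ι → ℂ) → ι → ℂ} (hT : MeasurePreserving T μ μ) {δ : ℝ} (hδ : 0 < δ) (N : ℕ) {f b : (ι → ℂ) → ℂ} (hf : Continuous f) (hb : Measurable b) {k : ι}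
    {e : ENNReal}
    (he : ∀ r, ∫⁻ x, ‖f (orbitPoint T δ N x r) - f (orbitPath T hδ N x r)‖ₑ ∂μ ≤ e)
    {s t : ℝ} (hs : -N ≤ s) (hst : s ≤ t) :
    ∫⁻ x, ‖orbitPath T hδ N x t k - orbitPath T hδ N x s k
        - ∫ r in s..t, f (orbitPath T hδ N x r)‖ₑ ∂μ ≤
      ENNReal.ofReal (t - s) * (eLpNorm (fun x => δ⁻¹ • (T x k - x k) - b x) 2 μ +
        eLpNorm (fun x => f x - b x) 2 μ + e) := by
  have hm := hT.measurable
  have hfm := hf.measurable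
  have hpath : Measurable fun p : (ι → ℂ) × ℝ => orbitPath T hδ N p.1 p.2 :=
    measurable_path_eval.comp (((measurable_orbitPath hm hδ).comp measurable_fst).prodMk
      measurable_snd)
  have hvel := measurable_orbitVel (δ := δ) (N := N) hm k
  have hjoint : Measurable fun p : (ι → ℂ) × ℝ =>
      ‖orbitVel T δ N k p.1 p.2 - f (orbitPath T hδ N p.1 p.2)‖ₑ :=
    (hvel.sub (hfm.comp hpath)).enorm
  have h1 : ∀ x, ‖orbitPath T hδ N x t k - orbitPath T hδ N x s k
        - ∫ r in s..t, f (orbitPath T hδ N x r)‖ₑ ≤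
      ∫⁻ r in Set.Ioc s t, ‖orbitVel T δ N k x r - f (orbitPath T hδ N x r)‖ₑ := by
    intro x
    rw [orbitPath_sub hδ, ← intervalIntegral.integral_sub, intervalIntegral.integral_of_le hst]
    · exact enorm_integral_le_lintegral_enorm _
    · exact intervalIntegrable_orbitVel hδ x k s t
    · exact (hf.comp (orbitPath T hδ N x).continuous).intervalIntegrable _ _
  refine (lintegral_mono h1).trans ?_
  rw [lintegral_lintegral_swap hjoint.aemeasurable]
  have hV : Measurable fun x : ι → ℂ => δ⁻¹ • (T x k - x k) - b x := by fun_prop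
  have hF : Measurable fun x : ι → ℂ => f x - b x := hfm.sub hb
  have hle : ∀ {g : (ι → ℂ) → ℂ}, Measurable g → ∀ r,
      ∫⁻ x, ‖g (orbitPoint T δ N x r)‖ₑ ∂μ ≤ eLpNorm g 2 μ := by
    intro g hg r
    rw [(measurePreserving_orbitPoint hT r).lintegral_comp hg.enorm,
      ← eLpNorm_one_eq_lintegral_enorm]
    exact eLpNorm_le_eLpNorm_of_exponent_le (by norm_num) hg.aestronglyMeasurable
  have h3 : ∀ r ∈ Set.Ioc s t, ∫⁻ x, ‖orbitVel T δ N k x r - f (orbitPath T hδ N x r)‖ₑ ∂μ ≤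
      eLpNorm (fun x => δ⁻¹ • (T x k - x k) - b x) 2 μ + eLpNorm (fun x => f x - b x) 2 μ + e := by
    intro r hr
    have hptr := (measurePreserving_orbitPoint (δ := δ) (N := N) hT r).measurable
    calc _ ≤ ∫⁻ x, ((‖(fun x => δ⁻¹ • (T x k - x k) - b x) (orbitPoint T δ N x r)‖ₑ +
          ‖(fun x => f x - b x) (orbitPoint T δ N x r)‖ₑ) +
          ‖f (orbitPoint T δ N x r) - f (orbitPath T hδ N x r)‖ₑ) ∂μ := by
          refine lintegral_mono fun x => ?_
          rw [orbitVel_eq hδ x k (hs.trans hr.1.le)]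
          set p := orbitPoint T δ N x r
          have : δ⁻¹ • (T p k - p k) - f (orbitPath T hδ N x r) =
            (δ⁻¹ • (T p k - p k) - b p) + -(f p - b p) + (f p - f (orbitPath T hδ N x r)) := by ring
          rw [this]
          refine (enorm_add_le _ _).trans (add_le_add ((enorm_add_le _ _).trans ?_) le_rfl)
          rw [enorm_neg]
      _ ≤ _ := by
        have hVp : Measurable fun x => ‖(fun x => δ⁻¹ • (T x k - x k) - b x)
            (orbitPoint T δ N x r)‖ₑ := (hV.comp hptr).enorm
        have hFp : Measurable fun x => ‖(fun x => f x - b x) (orbitPoint T δ N x r)‖ₑ :=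
          (hF.comp hptr).enorm
        rw [lintegral_add_left (hVp.fun_add hFp), lintegral_add_left hVp]
        exact add_le_add (add_le_add (hle hV r) (hle hF r)) (he r)
  refine (setLIntegral_mono measurable_const h3).trans ?_
  rw [lintegral_const, Measure.restrict_apply_univ, Real.volume_Ioc, mul_comm]

/-- The defect of a path with respect to a continuous right-hand side is a continuous function on
the path space, so that its truncated mean is controlled in the limit. -/
lemma lintegral_min_defect_le_of_tendsto {l : Filter ℕ} [l.NeBot]
    {q : ℕ → ProbabilityMeasure C(ℝ, ι → ℂ)} {Q : ProbabilityMeasure C(ℝ, ι → ℂ)}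
    (hq : Tendsto q l (𝓝 Q)) {f : (ι → ℂ) → ℂ} (hf : Continuous f) (k : ι) (s t : ℝ)
    {E : ℕ → ENNReal} {e : ENNReal} (hE : Tendsto E l (𝓝 e))
    (h : ∀ᶠ n in l, ∫⁻ u : C(ℝ, ι → ℂ), ‖u t k - u s k - ∫ r in s..t, f (u r)‖ₑ ∂(q n) ≤ E n) :
    ∫⁻ u : C(ℝ, ι → ℂ), min 1 ‖u t k - u s k - ∫ r in s..t, f (u r)‖ₑ ∂Q ≤ e := by
  have hcont : Continuous fun u : C(ℝ, ι → ℂ) => u t k - u s k - ∫ r in s..t, f (u r) := by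
    have h1 : ∀ t : ℝ, Continuous fun u : C(ℝ, ι → ℂ) => u t k := fun t =>
      (continuous_apply k).comp (continuous_eval_const t)
    refine ((h1 t).sub (h1 s)).sub ?_
    exact intervalIntegral.continuous_parametric_intervalIntegral_of_continuous'
      (f := fun (u : C(ℝ, ι → ℂ)) r => f (u r)) (hf.comp ContinuousEval.continuous_eval) s t
  let φ : BoundedContinuousFunction C(ℝ, ι → ℂ) NNReal := BoundedContinuousFunction.mkOfBound
    ⟨fun u => min 1 ‖u t k - u s k - ∫ r in s..t, f (u r)‖₊, by fun_prop⟩ 1 (by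
      intro u v
      rw [NNReal.dist_eq, abs_le]
      have h1 : ∀ z : NNReal, ((min 1 z : NNReal) : ℝ) ≤ 1 := fun z => by
        exact_mod_cast min_le_left _ _
      constructor
      · have := h1 ‖v t k - v s k - ∫ r in s..t, f (v r)‖₊
        change (-1 : ℝ) ≤ ((min 1 ‖u t k - u s k - ∫ r in s..t, f (u r)‖₊ : NNReal) : ℝ) -
          ((min 1 ‖v t k - v s k - ∫ r in s..t, f (v r)‖₊ : NNReal) : ℝ)
        linarith [NNReal.coe_nonneg (min 1 ‖u t k - u s k - ∫ r in s..t, f (u r)‖₊)]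
      · have := h1 ‖u t k - u s k - ∫ r in s..t, f (u r)‖₊
        change ((min 1 ‖u t k - u s k - ∫ r in s..t, f (u r)‖₊ : NNReal) : ℝ) -
          ((min 1 ‖v t k - v s k - ∫ r in s..t, f (v r)‖₊ : NNReal) : ℝ) ≤ 1
        linarith [NNReal.coe_nonneg (min 1 ‖v t k - v s k - ∫ r in s..t, f (v r)‖₊)])
  have hφ : ∀ u, (φ u : ENNReal) = min 1 ‖u t k - u s k - ∫ r in s..t, f (u r)‖ₑ := fun u => by
    change ((min 1 ‖u t k - u s k - ∫ r in s..t, f (u r)‖₊ : NNReal) : ENNReal) = _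
    rw [ENNReal.coe_min]; rfl
  have h2 := ProbabilityMeasure.tendsto_iff_forall_lintegral_tendsto.1 hq φ
  simp_rw [hφ] at h2
  refine le_of_tendsto_of_tendsto h2 hE ?_
  filter_upwards [h] with n hn
  exact (lintegral_mono fun u => min_le_right _ _).trans hn

end Stationary

section Stationary

variable {ι : Type} [Countable ι] {μ : Measure (ι → ℂ)} [IsProbabilityMeasure μ]

/-- A path measure with one-time marginals `μ` for which the truncated defects with respect to
`f n` are small solves the equation with the `L²`-limit `b` of `f n` as right-hand side. -/
lemma ae_eq_integral_of_defect {Q : Measure C(ℝ, ι → ℂ)} [IsProbabilityMeasure Q]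
    (hQ : ∀ t : ℝ, MeasurePreserving (fun u : C(ℝ, ι → ℂ) => u t) Q μ)
    {f : ℕ → (ι → ℂ) → ℂ} (hf : ∀ n, Continuous (f n)) {b : (ι → ℂ) → ℂ} (hb : Measurable b)
    (hb2 : eLpNorm b 2 μ ≠ ⊤)
    (hfb : Tendsto (fun n => eLpNorm (fun x => f n x - b x) 2 μ) atTop (𝓝 0)) (k : ι) {s t : ℝ}
    (hst : s ≤ t)
    (h : ∀ n, ∫⁻ u : C(ℝ, ι → ℂ), min 1 ‖u t k - u s k - ∫ r in s..t, f n (u r)‖ₑ ∂Q ≤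
      ENNReal.ofReal (t - s) * eLpNorm (fun x => f n x - b x) 2 μ) :
    ∀ᵐ u ∂Q, u t k - u s k = ∫ r in s..t, b (u r) := by
  have hev := measurable_path_eval (ι := ι)
  have hbj : Measurable fun p : C(ℝ, ι → ℂ) × ℝ => b (p.1 p.2) := hb.comp hev
  -- time integrals of stationary quantities
  have hmean : ∀ {g : (ι → ℂ) → ℂ}, Measurable g →
      ∫⁻ u : C(ℝ, ι → ℂ), (∫⁻ r in Set.Ioc s t, ‖g (u r)‖ₑ) ∂Q ≤
        ENNReal.ofReal (t - s) * eLpNorm g 2 μ := by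
    intro g hg
    rw [lintegral_lintegral_swap ((hg.comp hev).enorm.aemeasurable)]
    have h1 : ∀ r : ℝ, ∫⁻ u : C(ℝ, ι → ℂ), ‖g (u r)‖ₑ ∂Q ≤ eLpNorm g 2 μ := by
      intro r
      rw [(hQ r).lintegral_comp hg.enorm, ← eLpNorm_one_eq_lintegral_enorm]
      exact eLpNorm_le_eLpNorm_of_exponent_le (by norm_num) hg.aestronglyMeasurable
    refine (lintegral_mono h1).trans ?_
    rw [lintegral_const, Measure.restrict_apply_univ, Real.volume_Ioc, mul_comm]
  have hint : ∀ᵐ u ∂Q, IntervalIntegrable (fun r => b (u r)) volume s t := by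
    have h1 : ∀ᵐ u : C(ℝ, ι → ℂ) ∂Q, ∫⁻ r in Set.Ioc s t, ‖b (u r)‖ₑ < ⊤ :=
      ae_lt_top (hbj.enorm.lintegral_prod_right' (ν := volume.restrict (Set.Ioc s t)))
        (ne_top_of_le_ne_top (ENNReal.mul_ne_top ENNReal.ofReal_ne_top hb2) (hmean hb))
    filter_upwards [h1] with u hu
    rw [intervalIntegrable_iff_integrableOn_Ioc_of_le hst]
    exact ⟨(hb.comp u.continuous.measurable).aestronglyMeasurable, hu⟩
  have hψm : Measurable fun u : C(ℝ, ι → ℂ) => u t k - u s k - ∫ r in s..t, b (u r) := by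
    have h1 : ∀ t : ℝ, Measurable fun u : C(ℝ, ι → ℂ) => u t k := fun t =>
      (measurable_pi_apply k).comp (hQ t).measurable
    refine ((h1 t).sub (h1 s)).sub ?_
    simp_rw [intervalIntegral.integral_of_le hst]
    exact (hbj.stronglyMeasurable.integral_prod_right' (ν := volume.restrict _)).measurable
  have hle : ∀ n, ∫⁻ u : C(ℝ, ι → ℂ), min 1 ‖u t k - u s k - ∫ r in s..t, b (u r)‖ₑ ∂Q ≤
      2 * (ENNReal.ofReal (t - s) * eLpNorm (fun x => f n x - b x) 2 μ) := by
    intro n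
    have hd : Measurable fun p : C(ℝ, ι → ℂ) × ℝ => ‖f n (p.1 p.2) - b (p.1 p.2)‖ₑ :=
      (((hf n).measurable.comp hev).sub hbj).enorm
    have h1 : ∀ᵐ u : C(ℝ, ι → ℂ) ∂Q, min 1 ‖u t k - u s k - ∫ r in s..t, b (u r)‖ₑ ≤
        min 1 ‖u t k - u s k - ∫ r in s..t, f n (u r)‖ₑ +
          ∫⁻ r in Set.Ioc s t, ‖f n (u r) - b (u r)‖ₑ := by
      filter_upwards [hint] with u hu
      have h2 : u t k - u s k - ∫ r in s..t, b (u r) =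
          (u t k - u s k - ∫ r in s..t, f n (u r)) + ∫ r in s..t, (f n (u r) - b (u r)) := by
        have h5 : IntervalIntegrable (fun r => f n (u r)) volume s t :=
          ((hf n).comp u.continuous).intervalIntegrable _ _
        rw [intervalIntegral.integral_sub h5 hu]
        ring
      have h3 : ‖∫ r in s..t, (f n (u r) - b (u r))‖ₑ ≤
          ∫⁻ r in Set.Ioc s t, ‖f n (u r) - b (u r)‖ₑ := by
        rw [intervalIntegral.integral_of_le hst]
        exact enorm_integral_le_lintegral_enorm _
      have h4 : ∀ a b : ENNReal, min 1 (a + b) ≤ min 1 a + b := fun a b => by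
        rcases le_total 1 a with h | h
        · rw [min_eq_left h]; exact (min_le_left _ _).trans le_self_add
        · rw [min_eq_right h]; exact min_le_right _ _
      rw [h2]
      exact (min_le_min le_rfl (enorm_add_le _ _)).trans ((h4 _ _).trans (add_le_add le_rfl h3))
    calc _ ≤ _ := lintegral_mono_ae h1
      _ = _ := lintegral_add_right _ (hd.lintegral_prod_right' (ν := volume.restrict (Set.Ioc s t)))
      _ ≤ _ := add_le_add (h n) (hmean ((hf n).measurable.sub hb))
      _ = _ := (two_mul _).symm
  have hlim : Tendsto (fun n => 2 * (ENNReal.ofReal (t - s) *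
      eLpNorm (fun x => f n x - b x) 2 μ)) atTop (𝓝 0) := by
    have h1 := ENNReal.Tendsto.const_mul (a := 2) (ENNReal.Tendsto.const_mul
      (a := ENNReal.ofReal (t - s)) hfb (Or.inr ENNReal.ofReal_ne_top)) (Or.inr (by norm_num))
    simpa using h1
  have hzero : ∫⁻ u : C(ℝ, ι → ℂ), min 1 ‖u t k - u s k - ∫ r in s..t, b (u r)‖ₑ ∂Q = 0 :=
    le_antisymm (ge_of_tendsto' hlim hle) zero_le
  rw [lintegral_eq_zero_iff (measurable_const.min hψm.enorm)] at hzero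
  filter_upwards [hzero] with u hu
  have hu' : min 1 ‖u t k - u s k - ∫ r in s..t, b (u r)‖ₑ = 0 := hu
  have : ‖u t k - u s k - ∫ r in s..t, b (u r)‖ₑ = 0 := by
    rcases min_choice (1 : ENNReal) ‖u t k - u s k - ∫ r in s..t, b (u r)‖ₑ with h1 | h1
    · rw [h1] at hu'; exact absurd hu' one_ne_zero
    · rwa [h1] at hu'
  exact sub_eq_zero.1 (enorm_eq_zero.1 this)

/-- **Existence of stationary solutions.** If the vector field `b` is the `L²(μ)`-limit of the
difference quotients of maps `T n` that preserve `μ`, with time steps that tend to `0`, and if its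
components are `L²(μ)`-limits of functions of quadratic type, then there is a measure on paths
whose marginals are `μ` and whose paths solve `du/dt = b(u)`. -/
theorem exists_stationary_pathMeasure (hμ : ∀ k, eLpNorm (fun x : ι → ℂ => x k) 2 μ ≠ ⊤)
    {b : ι → (ι → ℂ) → ℂ} (hb : ∀ k, Measurable (b k)) (hb2 : ∀ k, eLpNorm (b k) 2 μ ≠ ⊤)
    {f : ℕ → ι → (ι → ℂ) → ℂ} (hf : ∀ n k, IsQuadLip (f n k))
    (hfb : ∀ k, Tendsto (fun n => eLpNorm (fun x => f n k x - b k x) 2 μ) atTop (𝓝 0))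
    {T : ℕ → (ι → ℂ) → ι → ℂ} (hT : ∀ n, MeasurePreserving (T n) μ μ) {j : ℕ → ℕ}
    (hj : ∀ n, n ≤ j n)
    (hTb : ∀ k, Tendsto (fun n => eLpNorm (fun x => (((2 : ℝ) ^ j n)⁻¹)⁻¹ • (T n x k - x k) - b k x)
      2 μ) atTop (𝓝 0)) :
    ∃ Q : Measure C(ℝ, ι → ℂ), IsProbabilityMeasure Q ∧
      (∀ t : ℝ, MeasurePreserving (fun u : C(ℝ, ι → ℂ) => u t) Q μ) ∧
      ∀ k, ∀ s t : ℝ, s ≤ t → ∀ᵐ u ∂Q, u t k - u s k = ∫ r in s..t, b k (u r) := by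
  set δ : ℕ → ℝ := fun n => ((2 : ℝ) ^ j n)⁻¹ with hδdef
  have hδ : ∀ n, 0 < δ n := fun n => by positivity
  have hxm : ∀ k, Measurable fun x : ι → ℂ => x k := fun k => measurable_pi_apply k
  have hTm : ∀ n k, Measurable fun x => T n x k := fun n k =>
    (hxm k).comp (hT n).measurable
  have hdm : ∀ n k, Measurable fun x => T n x k - x k := fun n k => (hTm n k).sub (hxm k)
  have hvm : ∀ n k, Measurable fun x => (δ n)⁻¹ • (T n x k - x k) := fun n k =>
    (hdm n k).const_smul ((δ n)⁻¹ : ℝ)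
  have hd_top : ∀ n k, eLpNorm (fun x => T n x k - x k) 2 μ ≠ ⊤ := fun n k => by
    refine ne_top_of_le_ne_top (b := eLpNorm (fun x => T n x k) 2 μ +
      eLpNorm (fun x : ι → ℂ => x k) 2 μ) (ENNReal.add_ne_top.2 ⟨?_, hμ k⟩)
      (eLpNorm_sub_le (hTm n k).aestronglyMeasurable (hxm k).aestronglyMeasurable (by norm_num))
    have := eLpNorm_comp_measurePreserving (p := 2) (hxm k).aestronglyMeasurable (hT n)
    exact ne_of_eq_of_ne this (hμ k)
  -- uniform bounds for the velocities
  set V : ℕ → ι → ENNReal := fun n k => eLpNorm (fun x => (δ n)⁻¹ • (T n x k - x k)) 2 μ with hV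
  have hVd : ∀ n k, eLpNorm (fun x => T n x k - x k) 2 μ = ENNReal.ofReal (δ n) * V n k := by
    intro n k
    have h1 : (fun x => T n x k - x k) = (δ n) • fun x => (δ n)⁻¹ • (T n x k - x k) := by
      funext x
      simp only [Pi.smul_apply]
      rw [smul_smul, mul_inv_cancel₀ (hδ n).ne', one_smul]
    rw [h1, eLpNorm_const_smul, Real.enorm_of_nonneg (hδ n).le]
  have hV_top : ∀ n k, V n k ≠ ⊤ := fun n k h => hd_top n k (by
    rw [hVd, h, ENNReal.mul_top (by simpa using hδ n)])
  have hVsup : ∀ k, ⨆ n, V n k ≠ ⊤ := by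
    intro k
    refine iSup_ne_top_of_eventually_le (c := 1 + eLpNorm (b k) 2 μ)
      (ENNReal.add_ne_top.2 ⟨ENNReal.one_ne_top, hb2 k⟩) (fun n => hV_top n k) ?_
    filter_upwards [(hTb k).eventually (eventually_le_nhds zero_lt_one)] with n hn
    have h1 : (fun x => (δ n)⁻¹ • (T n x k - x k)) =
        (fun x => (δ n)⁻¹ • (T n x k - x k) - b k x) + b k := by
      funext x; simp
    calc V n k ≤ _ := by
          rw [hV]
          dsimp only
          rw [h1]
          exact eLpNorm_add_le ((hvm n k).sub (hb k)).aestronglyMeasurable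
            (hb k).aestronglyMeasurable (by norm_num)
      _ ≤ _ := add_le_add hn le_rfl
  have hδ0 : Tendsto δ atTop (𝓝 0) := by
    refine squeeze_zero (fun n => (hδ n).le) (fun n => ?_)
      (tendsto_pow_atTop_nhds_zero_of_lt_one (by norm_num : (0 : ℝ) ≤ 1 / 2) (by norm_num))
    rw [one_div, inv_pow, hδdef]
    exact inv_anti₀ (by positivity) (pow_le_pow_right₀ (by norm_num) (hj n))
  have hd0 : ∀ k, Tendsto (fun n => eLpNorm (fun x => T n x k - x k) 2 μ) atTop (𝓝 0) := by
    intro k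
    have h1 : Tendsto (fun n => ENNReal.ofReal (δ n) * ⨆ m, V m k) atTop (𝓝 0) := by
      have := ENNReal.Tendsto.mul_const (b := ⨆ m, V m k)
        ((ENNReal.continuous_ofReal.tendsto 0).comp hδ0) (Or.inr (hVsup k))
      simpa using this
    refine tendsto_of_tendsto_of_tendsto_of_le_of_le tendsto_const_nhds h1 (fun _ => zero_le)
      fun n => ?_
    dsimp only
    rw [hVd]
    exact mul_le_mul_right (le_iSup (fun m => V m k) n) _
  -- a weak limit point of the laws of the interpolated orbits
  have htight := isTightMeasureSet_orbitPath (D := fun k => (⨆ n, V n k) ^ 2)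
    (fun k => by rw [← eLpNorm_two_sq]; exact ENNReal.pow_ne_top (hμ k)) hT hδ
    (fun n => ⟨n * 2 ^ j n, by
      rw [hδdef]; push_cast; field_simp; ring⟩) (fun k => ENNReal.pow_ne_top (hVsup k))
    (fun n k => by
      rw [← eLpNorm_two_sq]; exact pow_le_pow_left' (le_iSup (fun m => V m k) n) 2)
  have hcomp := isCompact_closure_of_isTightMeasureSet
    (S := Set.range fun n => orbitLaw μ (hT n) (hδ n) n) (by
      convert htight using 1
      ext ν
      constructor
      · rintro ⟨_, ⟨n, rfl⟩, rfl⟩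
        exact ⟨n, rfl⟩
      · rintro ⟨n, rfl⟩
        exact ⟨_, ⟨n, rfl⟩, rfl⟩)
  obtain ⟨Q, -, hQ⟩ := hcomp.ultrafilter_le_nhds
    ((hyperfilter ℕ).map fun n => orbitLaw μ (hT n) (hδ n) n) (by
      rw [le_principal_iff]
      exact Filter.mem_of_superset (Filter.mem_map.2 (Filter.univ_mem' fun n =>
        Set.mem_range_self n)) subset_closure)
  set l : Filter ℕ := (hyperfilter ℕ : Filter ℕ) with hl
  have hl_le : l ≤ atTop := Nat.hyperfilter_le_atTop
  have hlim : Tendsto (fun n => orbitLaw μ (hT n) (hδ n) n) l (𝓝 Q) := hQ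
  have hmarg := measurePreserving_eval_of_tendsto hT hj hδ hl_le hlim
  refine ⟨Q, inferInstance, hmarg, fun k s t hst => ?_⟩
  refine ae_eq_integral_of_defect hmarg (fun n => (hf n k).continuous) (hb k) (hb2 k) (hfb k) k hst
    fun n => ?_
  obtain ⟨J, C₀, hC₀⟩ := hf n k
  set C := max C₀ 0
  have hC : ∀ x y, ‖f n k x - f n k y‖ ≤ C * ∑ i ∈ J, ∑ l ∈ J, ‖x i - y i‖ * (‖x l‖ + ‖y l‖) :=
    fun x y => (hC₀ x y).trans (mul_le_mul_of_nonneg_right (le_max_left _ _)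
      (Finset.sum_nonneg fun i _ => Finset.sum_nonneg fun l _ => by positivity))
  set e : ℕ → ENNReal := fun m => ENNReal.ofReal C * ∑ i ∈ J, ∑ l ∈ J,
    eLpNorm (fun x => T m x i - x i) 2 μ *
      (2 * eLpNorm (fun x : ι → ℂ => x l) 2 μ + eLpNorm (fun x => T m x l - x l) 2 μ) with he
  have he0 : Tendsto e atTop (𝓝 0) := by
    have h1 : ∀ i l, Tendsto (fun m => eLpNorm (fun x => T m x i - x i) 2 μ *
      (2 * eLpNorm (fun x : ι → ℂ => x l) 2 μ + eLpNorm (fun x => T m x l - x l) 2 μ)) atTop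
        (𝓝 0) := by
      intro i l
      have h2 : Tendsto (fun m => 2 * eLpNorm (fun x : ι → ℂ => x l) 2 μ +
          eLpNorm (fun x => T m x l - x l) 2 μ) atTop
          (𝓝 (2 * eLpNorm (fun x : ι → ℂ => x l) 2 μ + 0)) := tendsto_const_nhds.add (hd0 l)
      have h3 := ENNReal.Tendsto.mul (hd0 i) (Or.inr (by
        rw [add_zero]; exact ENNReal.mul_ne_top (by norm_num) (hμ l))) h2
        (Or.inr ENNReal.zero_ne_top)
      simpa using h3
    have h4 := ENNReal.Tendsto.const_mul (a := ENNReal.ofReal C)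
      (tendsto_finsetSum J fun i _ => tendsto_finsetSum J fun l _ => h1 i l)
      (Or.inr ENNReal.ofReal_ne_top)
    simpa using h4
  have hE : Tendsto (fun m => ENNReal.ofReal (t - s) *
      (eLpNorm (fun x => (δ m)⁻¹ • (T m x k - x k) - b k x) 2 μ +
        eLpNorm (fun x => f n k x - b k x) 2 μ + e m)) l
      (𝓝 (ENNReal.ofReal (t - s) * eLpNorm (fun x => f n k x - b k x) 2 μ)) := by
    have h1 := ENNReal.Tendsto.const_mul (a := ENNReal.ofReal (t - s))
      (((hTb k).add (tendsto_const_nhds (x := eLpNorm (fun x => f n k x - b k x) 2 μ))).add he0)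
      (Or.inr ENNReal.ofReal_ne_top)
    simp only [zero_add, add_zero] at h1
    exact h1.mono_left hl_le
  refine lintegral_min_defect_le_of_tendsto hlim (hf n k).continuous k s t hE (hl_le ?_)
  filter_upwards [eventually_ge_atTop ⌈-s⌉₊] with m hm
  have hms : -(m : ℝ) ≤ s := by
    have := (Nat.le_ceil (-s)).trans (Nat.cast_le.2 hm)
    linarith
  refine le_trans ?_ (lintegral_defect_le (hT m) (hδ m) m (hf n k).continuous (hb k) (k := k)
    (fun r => lintegral_sub_orbitPoint_le (hT m) (hδ m) m (le_max_right C₀ 0) hC r) hms hst)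
  have hΦm : Measurable fun u : C(ℝ, ι → ℂ) => u t k - u s k - ∫ r in s..t, f n k (u r) := by
    have h1 : ∀ t : ℝ, Measurable fun u : C(ℝ, ι → ℂ) => u t k := fun t =>
      (measurable_pi_apply k).comp (hmarg t).measurable
    refine ((h1 t).sub (h1 s)).sub ?_
    simp_rw [intervalIntegral.integral_of_le hst]
    exact (((hf n k).continuous.measurable.comp (measurable_path_eval (ι :=
      ι))).stronglyMeasurable.integral_prod_right' (ν := volume.restrict _)).measurable
  exact (lintegral_map hΦm.enorm (measurable_orbitPath (hT m).measurable (hδ m))).le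

end Stationary

/-! ### Bounds for the coefficients, and lattice sums -/

/-- The symbol `k² (1 + a² k²)^s` that turns `φ` into the (negative) averaged vorticity `-AΔφ`. -/
def lam (a s : ℝ) (k : ℤ × ℤ) : ℝ := freqSq k * symbolA a s k

lemma freqSq_neg (k : ℤ × ℤ) : freqSq (-k) = freqSq k := by simp [freqSq]

lemma lam_neg (a s : ℝ) (k : ℤ × ℤ) : lam a s (-k) = lam a s k := by
  simp [lam, symbolA, helmholtz, freqSq_neg]

lemma one_le_freqSq {k : ℤ × ℤ} (hk : k ≠ 0) : 1 ≤ freqSq k := by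
  have h : (0 : ℤ) < k.1 ^ 2 + k.2 ^ 2 := by
    rcases eq_or_ne k.1 0 with h1 | h1
    · have h2 : k.2 ≠ 0 := fun h2 => hk (Prod.ext h1 h2)
      positivity
    · positivity
  unfold freqSq
  exact_mod_cast h

lemma freqSq_zero : freqSq 0 = 0 := by simp [freqSq]

lemma one_le_symbolA (a : ℝ) {s : ℝ} (hs : 0 < s) (k : ℤ × ℤ) : 1 ≤ symbolA a s k := by
  refine Real.one_le_rpow ?_ hs.le
  have := freqSq_nonneg k
  unfold helmholtz
  nlinarith [mul_nonneg (sq_nonneg a) this]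

lemma lam_pos (a s : ℝ) {k : ℤ × ℤ} (hk : k ≠ 0) : 0 < lam a s k :=
  mul_pos (zero_lt_one.trans_le (one_le_freqSq hk)) (symbolA_pos a s k)

lemma freqSq_le_lam (a : ℝ) {s : ℝ} (hs : 0 < s) (k : ℤ × ℤ) : freqSq k ≤ lam a s k :=
  le_mul_of_one_le_right (freqSq_nonneg k) (one_le_symbolA a hs k)

lemma one_sub_rpow_le {s t : ℝ} (hs : 0 < s) (ht : 0 < t) (ht1 : t ≤ 1) :
    1 - t ^ s ≤ (1 + s) * (1 - t) := by
  rcases le_total 1 s with h | h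
  · have := one_add_mul_self_le_rpow_one_add (s := t - 1) (by linarith) h
    rw [add_sub_cancel] at this
    nlinarith
  · have : t ≤ t ^ s := by
      simpa using Real.rpow_le_rpow_of_exponent_ge ht ht1 h
    nlinarith

lemma lam_sub_le (a : ℝ) {s : ℝ} (hs : 0 < s) {h h' : ℤ × ℤ}
    (hle : freqSq h' ≤ freqSq h) :
    |lam a s h - lam a s h'| ≤
      (2 + s) * (freqSq h - freqSq h') * (symbolA a s h * symbolA a s h') := by
  set ρ := freqSq h with hρ
  set ρ' := freqSq h' with hρ'
  have hρ'0 : 0 ≤ ρ' := freqSq_nonneg h'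
  set A := symbolA a s h with hA
  set A' := symbolA a s h' with hA'
  have hA1 : 1 ≤ A := one_le_symbolA a hs h
  have hA'1 : 1 ≤ A' := one_le_symbolA a hs h'
  have hq : 0 < helmholtz a h := helmholtz_pos a h
  have hq' : 0 < helmholtz a h' := helmholtz_pos a h'
  set t := helmholtz a h' / helmholtz a h with ht
  have ht0 : 0 < t := div_pos hq' hq
  have hqle : helmholtz a h' ≤ helmholtz a h := by
    unfold helmholtz
    nlinarith [mul_le_mul_of_nonneg_left hle (sq_nonneg a)]
  have ht1 : t ≤ 1 := (div_le_one hq).2 hqle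
  have hAt : A' = A * t ^ s := by
    rw [hA, hA', ht, symbolA, symbolA, Real.div_rpow hq'.le hq.le, mul_div_cancel₀]
    exact (Real.rpow_pos_of_pos hq s).ne'
  have hts : t ^ s ≤ 1 := Real.rpow_le_one ht0.le ht1 hs.le
  have htρ : ρ * (1 - t) ≤ ρ - ρ' := by
    have h1 : ρ' ≤ ρ * t := by
      rw [ht, mul_div_assoc', le_div_iff₀ hq]
      unfold helmholtz
      rw [← hρ, ← hρ']
      nlinarith
    linarith
  have hsub := one_sub_rpow_le hs ht0 ht1
  have hbern : A - A' ≤ A * ((1 + s) * (1 - t)) := by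
    rw [hAt]
    nlinarith
  have h1t : 0 ≤ 1 - t := by linarith
  have h3 : ρ' * (A - A') ≤ (1 + s) * (ρ - ρ') * A := by
    calc ρ' * (A - A') ≤ ρ' * (A * ((1 + s) * (1 - t))) := by gcongr
      _ ≤ ρ * (A * ((1 + s) * (1 - t))) := by gcongr
      _ = (1 + s) * (ρ * (1 - t)) * A := by ring
      _ ≤ _ := by gcongr
  have h4 : 0 ≤ A - A' := by rw [hAt]; nlinarith
  have h5 : lam a s h - lam a s h' = (ρ - ρ') * A + ρ' * (A - A') := by
    unfold lam
    rw [← hρ, ← hρ', ← hA, ← hA']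
    ring
  have h6 : 0 ≤ ρ - ρ' := by linarith
  rw [h5, abs_of_nonneg (by positivity)]
  calc _ ≤ (2 + s) * (ρ - ρ') * (A * 1) := by linarith
    _ ≤ _ := by gcongr

/-- The cancellation in the symmetrized coefficient: its size relative to the vorticity symbols
is `O(1 / (|h| |k - h|))`, uniformly in `k`. -/
lemma coeffB_sq_le (a : ℝ) {s : ℝ} (hs : 0 < s) {h k : ℤ × ℤ} (hk : k ≠ 0) (hh : h ≠ 0)
    (hkh : k - h ≠ 0) :
    coeffB a s h k ^ 2 ≤ (2 + s) ^ 2 *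
      (lam a s h ^ 2 * lam a s (k - h) ^ 2 / (freqSq h * freqSq (k - h))) := by
  set h' := k - h with hh'
  have hκ := zero_lt_one.trans_le (one_le_freqSq hk)
  have hρ := zero_lt_one.trans_le (one_le_freqSq hh)
  have hρ' := zero_lt_one.trans_le (one_le_freqSq hkh)
  have hkx : (k.1 : ℝ) = h.1 + h'.1 := by rw [hh']; simp
  have hky : (k.2 : ℝ) = h.2 + h'.2 := by rw [hh']; simp
  -- two ways of bounding the cross product, and the difference of the squares
  have hd1 : dotPerp h h' ^ 2 ≤ freqSq k * freqSq h := by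
    unfold dotPerp freqSq
    rw [hkx, hky]
    nlinarith [sq_nonneg (((h.1 : ℝ) + h'.1) * h.1 + ((h.2 : ℝ) + h'.2) * h.2)]
  have hd2 : dotPerp h h' ^ 2 ≤ freqSq k * freqSq h' := by
    unfold dotPerp freqSq
    rw [hkx, hky]
    nlinarith [sq_nonneg (((h.1 : ℝ) + h'.1) * h'.1 + ((h.2 : ℝ) + h'.2) * h'.2)]
  have hr : (freqSq h - freqSq h') ^ 2 ≤ 2 * freqSq k * (freqSq h + freqSq h') := by
    have e : freqSq h - freqSq h' = ((h.1 : ℝ) - h'.1) * k.1 + ((h.2 : ℝ) - h'.2) * k.2 := by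
      unfold freqSq; rw [hkx, hky]; ring
    have c1 : (((h.1 : ℝ) - h'.1) * k.1 + ((h.2 : ℝ) - h'.2) * k.2) ^ 2 ≤
        (((h.1 : ℝ) - h'.1) ^ 2 + ((h.2 : ℝ) - h'.2) ^ 2) * freqSq k := by
      unfold freqSq
      nlinarith [sq_nonneg (((h.1 : ℝ) - h'.1) * k.2 - ((h.2 : ℝ) - h'.2) * k.1)]
    have c2 : ((h.1 : ℝ) - h'.1) ^ 2 + ((h.2 : ℝ) - h'.2) ^ 2 ≤ 2 * (freqSq h + freqSq h') := by
      unfold freqSq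
      nlinarith [sq_nonneg ((h.1 : ℝ) + h'.1), sq_nonneg ((h.2 : ℝ) + h'.2)]
    rw [e]
    nlinarith [mul_le_mul_of_nonneg_right c2 hκ.le]
  have hprod : dotPerp h h' ^ 2 * (freqSq h - freqSq h') ^ 2 ≤
      4 * freqSq k ^ 2 * (freqSq h * freqSq h') := by
    rcases le_total (freqSq h) (freqSq h') with hle | hle
    · have h2 : (freqSq h - freqSq h') ^ 2 ≤ 4 * freqSq k * freqSq h' := by nlinarith
      calc _ ≤ (freqSq k * freqSq h) * (4 * freqSq k * freqSq h') :=
            mul_le_mul hd1 h2 (sq_nonneg _) (by positivity)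
        _ = _ := by ring
    · have h2 : (freqSq h - freqSq h') ^ 2 ≤ 4 * freqSq k * freqSq h := by nlinarith
      calc _ ≤ (freqSq k * freqSq h') * (4 * freqSq k * freqSq h) :=
            mul_le_mul hd2 h2 (sq_nonneg _) (by positivity)
        _ = _ := by ring
  have hlam : (lam a s h - lam a s h') ^ 2 ≤
      (2 + s) ^ 2 * (freqSq h - freqSq h') ^ 2 * (symbolA a s h * symbolA a s h') ^ 2 := by
    rcases le_total (freqSq h') (freqSq h) with hle | hle
    · have := lam_sub_le a hs hle
      rw [← sq_abs, ← mul_pow, ← mul_pow]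
      gcongr
    · have := lam_sub_le a hs hle
      rw [← sq_abs, abs_sub_comm, ← mul_pow, ← mul_pow, ← neg_sub (freqSq h'),
        mul_neg, neg_mul, neg_sq, mul_comm (symbolA a s h)]
      gcongr
  have hB : coeffB a s h k ^ 2 = dotPerp h h' ^ 2 * (lam a s h - lam a s h') ^ 2 /
      (16 * Real.pi ^ 2 * lam a s k ^ 2) := by
    unfold coeffB lam
    rw [← hh']
    ring
  have hπ : 1 ≤ Real.pi ^ 2 := by nlinarith [Real.pi_gt_three]
  have hκ2 : freqSq k ^ 2 ≤ lam a s k ^ 2 := by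
    have := freqSq_le_lam a hs k
    gcongr
  rw [hB, div_le_iff₀ (by have := lam_pos a s hk; positivity)]
  set A2 := (symbolA a s h * symbolA a s h') ^ 2 with hA2
  have hA20 : 0 ≤ A2 := sq_nonneg _
  have hrhs : lam a s h ^ 2 * lam a s h' ^ 2 / (freqSq h * freqSq h') =
      freqSq h * freqSq h' * A2 := by
    rw [hA2]; unfold lam; field_simp
  rw [hrhs]
  calc _ ≤ dotPerp h h' ^ 2 * ((2 + s) ^ 2 * (freqSq h - freqSq h') ^ 2 * A2) := by gcongr
    _ = (2 + s) ^ 2 * A2 * (dotPerp h h' ^ 2 * (freqSq h - freqSq h') ^ 2) := by ring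
    _ ≤ (2 + s) ^ 2 * A2 * (4 * freqSq k ^ 2 * (freqSq h * freqSq h')) := by gcongr
    _ = (2 + s) ^ 2 * (freqSq h * freqSq h' * A2) * (4 * 1 * freqSq k ^ 2) := by ring
    _ ≤ (2 + s) ^ 2 * (freqSq h * freqSq h' * A2) * (16 * Real.pi ^ 2 * lam a s k ^ 2) := by
      gcongr; norm_num

lemma summable_freqSq_rpow {p : ℝ} (hp : 1 < p) :
    Summable fun h : ℤ × ℤ => freqSq h ^ (-p) := by
  have h1 := (finTwoArrowEquiv ℤ).symm.summable_iff.2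
    (EisensteinSeries.summable_one_div_norm_rpow (k := 2 * p) (by linarith))
  refine Summable.of_nonneg_of_le (fun h => Real.rpow_nonneg (freqSq_nonneg h) _) (fun h => ?_) h1
  simp only [Function.comp_apply]
  rcases eq_or_ne h 0 with rfl | hh
  · rw [freqSq_zero, Real.zero_rpow (by linarith)]
    positivity
  · set x : Fin 2 → ℤ := (finTwoArrowEquiv ℤ).symm h with hx
    have hx0 : x ≠ 0 := by
      intro h0
      apply hh
      have := congrArg (finTwoArrowEquiv ℤ) h0
      rw [hx, Equiv.apply_symm_apply] at this
      rw [this]; rfl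
    have hpos : 0 < ‖x‖ := norm_pos_iff.2 hx0
    have hle : ‖x‖ ≤ Real.sqrt (freqSq h) := by
      rw [pi_norm_le_iff_of_nonneg (Real.sqrt_nonneg _)]
      intro i
      rw [Int.norm_eq_abs]
      refine Real.abs_le_sqrt ?_
      unfold freqSq
      fin_cases i
      · change ((h.1 : ℤ) : ℝ) ^ 2 ≤ _
        nlinarith [sq_nonneg (h.2 : ℝ)]
      · change ((h.2 : ℤ) : ℝ) ^ 2 ≤ _
        nlinarith [sq_nonneg (h.1 : ℝ)]
    have hsq : ‖x‖ ^ (2 : ℝ) ≤ freqSq h := by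
      have := pow_le_pow_left₀ hpos.le hle 2
      rw [Real.sq_sqrt (freqSq_nonneg h)] at this
      exact_mod_cast this
    calc freqSq h ^ (-p) ≤ (‖x‖ ^ (2 : ℝ)) ^ (-p) :=
          Real.rpow_le_rpow_of_nonpos (Real.rpow_pos_of_pos hpos _) hsq (by linarith)
      _ = ‖x‖ ^ (-(2 * p)) := by rw [← Real.rpow_mul hpos.le]; ring_nf

/-- The majorant `1 / (h² (k - h)²)` of the second moments; it vanishes, by the convention for
division by zero, where `h` or `k - h` does. -/
def pairBound (k h : ℤ × ℤ) : ℝ := (freqSq h * freqSq (k - h))⁻¹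

lemma pairBound_nonneg (k h : ℤ × ℤ) : 0 ≤ pairBound k h :=
  inv_nonneg.2 (mul_nonneg (freqSq_nonneg _) (freqSq_nonneg _))

lemma summable_inv_freqSq_sq : Summable fun h : ℤ × ℤ => (freqSq h)⁻¹ ^ 2 := by
  refine (summable_freqSq_rpow (p := 2) (by norm_num)).congr fun h => ?_
  rw [Real.rpow_neg (freqSq_nonneg h), Real.rpow_two, inv_pow]

lemma pairBound_le (k h : ℤ × ℤ) :
    pairBound k h ≤ (freqSq h)⁻¹ ^ 2 + (freqSq (k - h))⁻¹ ^ 2 := by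
  unfold pairBound
  rw [mul_inv]
  nlinarith [sq_nonneg ((freqSq h)⁻¹ - (freqSq (k - h))⁻¹), sq_nonneg (freqSq h)⁻¹,
    sq_nonneg (freqSq (k - h))⁻¹]

lemma summable_pairBound (k : ℤ × ℤ) : Summable (pairBound k) :=
  Summable.of_nonneg_of_le (pairBound_nonneg k) (pairBound_le k)
    (summable_inv_freqSq_sq.add ((Equiv.subLeft k).summable_iff.2 summable_inv_freqSq_sq))

lemma tsum_pairBound_le (k : ℤ × ℤ) :
    ∑' h, pairBound k h ≤ 2 * ∑' h : ℤ × ℤ, (freqSq h)⁻¹ ^ 2 := by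
  have h2 : Summable fun h : ℤ × ℤ => (freqSq (k - h))⁻¹ ^ 2 :=
    (Equiv.subLeft k).summable_iff.2 summable_inv_freqSq_sq
  refine ((summable_pairBound k).tsum_le_tsum (pairBound_le k)
    (summable_inv_freqSq_sq.add h2)).trans (le_of_eq ?_)
  rw [summable_inv_freqSq_sq.tsum_add h2, two_mul]
  congr 1
  exact (Equiv.subLeft k).tsum_eq fun h : ℤ × ℤ => (freqSq h)⁻¹ ^ 2

lemma freqSq_le_mul_freqSq_sub (k h : ℤ × ℤ) (hkh : k - h ≠ 0) :
    freqSq h ≤ (2 + 2 * freqSq k) * freqSq (k - h) := by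
  have h1 := one_le_freqSq hkh
  have h2 : freqSq h ≤ 2 * freqSq (k - h) + 2 * freqSq k := by
    unfold freqSq
    simp only [Prod.fst_sub, Prod.snd_sub, Int.cast_sub]
    nlinarith [sq_nonneg (2 * (k.1 : ℝ) - h.1), sq_nonneg (2 * (k.2 : ℝ) - h.2)]
  nlinarith [freqSq_nonneg k]

lemma summable_rpow_mul_pairBound (k : ℤ × ℤ) :
    Summable fun h => freqSq h ^ (3 / 4 : ℝ) * pairBound k h := by
  refine Summable.of_nonneg_of_le
    (fun h => mul_nonneg (Real.rpow_nonneg (freqSq_nonneg h) _) (pairBound_nonneg k h))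
    (fun h => ?_) ((summable_freqSq_rpow (p := 5 / 4) (by norm_num)).mul_left (2 + 2 * freqSq k))
  have hk := freqSq_nonneg k
  rcases eq_or_ne h 0 with rfl | hh
  · have : (0 : ℝ) ≤ freqSq 0 ^ (-(5 / 4) : ℝ) := Real.rpow_nonneg (freqSq_nonneg _) _
    rw [freqSq_zero, Real.zero_rpow (by norm_num), zero_mul]
    rw [freqSq_zero] at this
    positivity
  rcases eq_or_ne (k - h) 0 with hkh | hkh
  · have : (0 : ℝ) ≤ freqSq h ^ (-(5 / 4) : ℝ) := Real.rpow_nonneg (freqSq_nonneg _) _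
    rw [pairBound, hkh, freqSq_zero, mul_zero, inv_zero, mul_zero]
    positivity
  have hρ := zero_lt_one.trans_le (one_le_freqSq hh)
  have hρ' := zero_lt_one.trans_le (one_le_freqSq hkh)
  have h1 : (freqSq (k - h))⁻¹ ≤ (2 + 2 * freqSq k) * (freqSq h)⁻¹ := by
    rw [inv_le_iff_one_le_mul₀ hρ', mul_right_comm, ← div_eq_mul_inv, one_le_div hρ]
    exact freqSq_le_mul_freqSq_sub k h hkh
  have h2 : freqSq h ^ (3 / 4 : ℝ) * ((freqSq h)⁻¹ * (freqSq h)⁻¹) = freqSq h ^ (-(5 / 4) : ℝ) := by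
    rw [← Real.rpow_neg_one, ← Real.rpow_add hρ, ← Real.rpow_add hρ]
    norm_num
  rw [pairBound, mul_inv, ← h2]
  calc _ ≤ freqSq h ^ (3 / 4 : ℝ) * ((freqSq h)⁻¹ * ((2 + 2 * freqSq k) * (freqSq h)⁻¹)) := by
        gcongr
    _ = _ := by ring

lemma weight_le (a : ℝ) {s p : ℝ} (hs : 0 < s) (hp : p ≤ 0) (k : PosFreq) :
    weight a s p k ≤ freqSq k.1 ^ p := by
  refine mul_le_of_le_one_right (Real.rpow_nonneg (freqSq_nonneg _) _) ?_
  refine Real.rpow_le_one_of_one_le_of_nonpos ?_ (mul_nonpos_of_nonpos_of_nonneg hp hs.le)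
  have := freqSq_nonneg k.1
  unfold helmholtz
  nlinarith [mul_nonneg (sq_nonneg a) this]

lemma summable_weight (a : ℝ) {s p : ℝ} (hs : 0 < s) (hp : p < -1) :
    Summable fun k : PosFreq => weight a s p k := by
  refine Summable.of_nonneg_of_le (fun k => (weight_pos a s p k).le)
    (fun k => weight_le a hs (by linarith) k) ?_
  have := (summable_freqSq_rpow (p := -p) (by linarith)).comp_injective
    (Subtype.val_injective (p := IsPos))
  simpa [Function.comp_def] using this

/-! ### Fourier coefficients with negative index -/

lemma isPos_trichotomy (k : ℤ × ℤ) : k = 0 ∨ IsPos k ∨ IsPos (-k) := by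
  obtain ⟨x, y⟩ := k
  simp only [IsPos, Prod.mk_eq_zero, Prod.fst_neg, Prod.snd_neg]
  omega

lemma not_isPos_neg {k : ℤ × ℤ} (hk : IsPos k) : ¬ IsPos (-k) := by
  obtain ⟨x, y⟩ := k
  simp only [IsPos, Prod.fst_neg, Prod.snd_neg] at hk ⊢
  omega

lemma not_isPos_zero : ¬ IsPos 0 := by simp [IsPos]

lemma PosFreq.ne_zero (p : PosFreq) : p.1 ≠ 0 := fun h => not_isPos_zero (h ▸ p.2)

lemma PosFreq.ne_neg (p q : PosFreq) : p.1 ≠ -q.1 := fun h => not_isPos_neg q.2 (h ▸ p.2)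

lemma exists_posFreq {h : ℤ × ℤ} (hh : h ≠ 0) : ∃ p : PosFreq, h = p.1 ∨ h = -p.1 := by
  rcases isPos_trichotomy h with h0 | h1 | h1
  · exact absurd h0 hh
  · exact ⟨⟨h, h1⟩, Or.inl rfl⟩
  · exact ⟨⟨-h, h1⟩, Or.inr (neg_neg h).symm⟩

lemma fullMode_pos (v : PosFreq → ℂ) (p : PosFreq) : fullMode v p.1 = v p := by
  unfold fullMode
  rw [dif_pos p.2]

lemma fullMode_negPos (v : PosFreq → ℂ) (p : PosFreq) :
    fullMode v (-p.1) = (starRingEnd ℂ) (v p) := by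
  have h : IsPos (- -p.1) := by rw [neg_neg]; exact p.2
  unfold fullMode
  rw [dif_neg (not_isPos_neg p.2), dif_pos h]
  congr 2
  exact Subtype.ext (neg_neg _)

lemma fullMode_zero (v : PosFreq → ℂ) : fullMode v 0 = 0 := by
  unfold fullMode
  rw [dif_neg not_isPos_zero, dif_neg (by rw [neg_zero]; exact not_isPos_zero)]

lemma fullMode_neg (v : PosFreq → ℂ) (h : ℤ × ℤ) :
    fullMode v (-h) = (starRingEnd ℂ) (fullMode v h) := by
  rcases eq_or_ne h 0 with rfl | hh
  · simp [fullMode_zero]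
  obtain ⟨p, rfl | rfl⟩ := exists_posFreq hh
  · rw [fullMode_pos, fullMode_negPos]
  · rw [neg_neg, fullMode_pos, fullMode_negPos, Complex.conj_conj]

lemma continuous_fullMode (h : ℤ × ℤ) : Continuous fun v : PosFreq → ℂ => fullMode v h := by
  rcases eq_or_ne h 0 with rfl | hh
  · simp_rw [fullMode_zero]; exact continuous_const
  obtain ⟨p, rfl | rfl⟩ := exists_posFreq hh
  · simp_rw [fullMode_pos]; exact continuous_apply p
  · simp_rw [fullMode_negPos]; exact Complex.continuous_conj.comp (continuous_apply p)

/-! ### Moments of the Gaussian measure -/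

section Moments

variable {a s γ : ℝ}

lemma lintegral_enorm_pow_four_modeMeasure (hγ : 0 < γ) (k : PosFreq) :
    ∫⁻ z, ‖z‖ₑ ^ 4 ∂(modeMeasure a s γ k) = ENNReal.ofReal (8 / (γ ^ 2 * lam a s k.1 ^ 4)) := by
  have hl := lam_pos a s k.ne_zero
  set c : ℝ := γ * lam a s k.1 ^ 2 with hc
  have hc0 : 0 < c := by positivity
  have hint := Complex.integral_rpow_mul_exp_neg_mul_rpow (p := 2) (q := 4) (b := c / 2)
    (by norm_num) (by norm_num) (by positivity)
  have hΓ : Real.Gamma ((4 + 2) / 2) = 2 := by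
    rw [show ((4 : ℝ) + 2) / 2 = (2 : ℕ) + 1 by norm_num, Real.Gamma_nat_eq_factorial]; rfl
  have hpow : (c / 2) ^ (-(4 + 2 : ℝ) / 2) = 8 / c ^ 3 := by
    rw [show (-(4 + 2 : ℝ) / 2) = -(3 : ℕ) by norm_num, Real.rpow_neg (by positivity),
      Real.rpow_natCast]
    field_simp
    norm_num
  rw [hΓ, hpow] at hint
  have hfun : (fun z : ℂ => ‖z‖ ^ (4 : ℝ) * Real.exp (-(c / 2) * ‖z‖ ^ (2 : ℝ))) =
      fun z : ℂ => ‖z‖ ^ 4 * Real.exp (-(c / 2) * ‖z‖ ^ 2) := by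
    funext z; norm_cast
  rw [hfun] at hint
  have hI : Integrable fun z : ℂ => ‖z‖ ^ 4 * Real.exp (-(c / 2) * ‖z‖ ^ 2) := by
    apply Integrable.of_integral_ne_zero
    rw [hint]
    have := Real.pi_pos
    positivity
  have hdens : Measurable fun z : ℂ => ENNReal.ofReal
      (γ * freqSq k.1 ^ 2 * symbolA a s k.1 ^ 2 / (2 * Real.pi) *
        Real.exp (-(1 / 2) * γ * freqSq k.1 ^ 2 * symbolA a s k.1 ^ 2 * ‖z‖ ^ 2)) := by fun_prop
  rw [modeMeasure, lintegral_withDensity_eq_lintegral_mul _ hdens (by fun_prop)]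
  have hπ := Real.pi_pos
  have h1 : ∀ z : ℂ, ((fun z : ℂ => ENNReal.ofReal
      (γ * freqSq k.1 ^ 2 * symbolA a s k.1 ^ 2 / (2 * Real.pi) *
        Real.exp (-(1 / 2) * γ * freqSq k.1 ^ 2 * symbolA a s k.1 ^ 2 * ‖z‖ ^ 2))) *
      fun z => ‖z‖ₑ ^ 4 : ℂ → ENNReal) z = ENNReal.ofReal (c / (2 * Real.pi) *
        (‖z‖ ^ 4 * Real.exp (-(c / 2) * ‖z‖ ^ 2))) := by
    intro z
    rw [Pi.mul_apply, ← ofReal_norm, ← ENNReal.ofReal_pow (norm_nonneg _),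
      ← ENNReal.ofReal_mul (by positivity)]
    congr 1
    rw [hc, lam]
    rw [show -(γ * (freqSq k.1 * symbolA a s k.1) ^ 2 / 2) * ‖z‖ ^ 2 =
      -(1 / 2) * γ * freqSq k.1 ^ 2 * symbolA a s k.1 ^ 2 * ‖z‖ ^ 2 by ring]
    ring
  rw [lintegral_congr h1, ← ofReal_integral_eq_lintegral_ofReal (hI.const_mul _)
    (Eventually.of_forall fun z => by positivity), integral_const_mul, hint]
  congr 1
  rw [hc]
  field_simp

lemma map_neg_modeMeasure (k : PosFreq) :
    (modeMeasure a s γ k).map (fun z => -z) = modeMeasure a s γ k := by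
  have hmp : MeasurePreserving (fun z : ℂ => -z) volume volume :=
    Measure.measurePreserving_neg volume
  ext S hS
  rw [Measure.map_apply measurable_neg hS, modeMeasure, withDensity_apply _ hS,
    withDensity_apply _ (measurable_neg hS)]
  have := hmp.setLIntegral_comp_preimage hS (f := fun z : ℂ => ENNReal.ofReal
    (γ * freqSq k.1 ^ 2 * symbolA a s k.1 ^ 2 / (2 * Real.pi) *
      Real.exp (-(1 / 2) * γ * freqSq k.1 ^ 2 * symbolA a s k.1 ^ 2 * ‖z‖ ^ 2))) (by fun_prop)
  simpa using this

/-- Changing the sign of one coordinate. -/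
def flipMode (p : PosFreq) (v : PosFreq → ℂ) : PosFreq → ℂ := fun i => if i = p then -v i else v i

open scoped Classical in
/-- The sign that the coefficient of index `h` gets when the coordinate `p` changes its sign. -/
def flipSign (p : PosFreq) (h : ℤ × ℤ) : ℂ := if h = p.1 ∨ h = -p.1 then -1 else 1

lemma fullMode_flipMode (p : PosFreq) (v : PosFreq → ℂ) (h : ℤ × ℤ) :
    fullMode (flipMode p v) h = flipSign p h * fullMode v h := by
  rcases eq_or_ne h 0 with rfl | hh
  · simp [fullMode_zero]
  obtain ⟨q, hq⟩ := exists_posFreq hh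
  by_cases hqp : q = p
  · subst hqp
    rw [flipSign, if_pos hq]
    rcases hq with rfl | rfl
    · rw [fullMode_pos, fullMode_pos, flipMode, if_pos rfl]; ring
    · rw [fullMode_negPos, fullMode_negPos, flipMode, if_pos rfl, map_neg]; ring
  · have hne : q.1 ≠ p.1 := fun h => hqp (Subtype.ext h)
    have : ¬ (h = p.1 ∨ h = -p.1) := by
      rintro (h1 | h1) <;> rcases hq with hq | hq
      · exact hne (hq.symm.trans h1)
      · exact p.ne_neg q (h1.symm.trans hq)
      · exact q.ne_neg p (hq.symm.trans h1)
      · exact hne (neg_injective (hq.symm.trans h1))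
    rw [flipSign, if_neg this]
    rcases hq with rfl | rfl
    · rw [fullMode_pos, fullMode_pos, flipMode, if_neg hqp]; ring
    · rw [fullMode_negPos, fullMode_negPos, flipMode, if_neg hqp]; ring

/-- Two different products `φ_h φ_{k-h}`, `φ_j φ_{k-j}` contain some coordinate an odd number of
times altogether. -/
lemma exists_flipSign_mul_eq_neg_one {k h j : ℤ × ℤ} (hk : k ≠ 0) (hh : h ≠ 0) (hkh : k - h ≠ 0)
    (hj : j ≠ 0) (hkj : k - j ≠ 0) (h1 : j ≠ h) (h2 : j ≠ k - h) :
    ∃ p, flipSign p h * flipSign p (k - h) * (flipSign p j * flipSign p (k - j)) = -1 := by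
  have pos : ∀ {p : PosFreq} {q r : ℤ × ℤ}, (q = p.1 ∨ q = -p.1) → (r = q ∨ r = -q) →
      flipSign p r = -1 := by
    rintro p q r (rfl | rfl) hr
    · exact if_pos hr
    · exact if_pos (by rw [neg_neg] at hr; exact hr.symm)
  have neg : ∀ {p : PosFreq} {q r : ℤ × ℤ}, (q = p.1 ∨ q = -p.1) → ¬ (r = q ∨ r = -q) →
      flipSign p r = 1 := by
    rintro p q r (rfl | rfl) hr
    · exact if_neg hr
    · exact if_neg (by rw [neg_neg] at hr; exact fun h => hr h.symm)
  have two : ∀ v : ℤ × ℤ, 2 * v = 0 → v = 0 := by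
    rintro ⟨x, y⟩ h
    simp only [Prod.ext_iff, Prod.fst_mul, Prod.snd_mul, Prod.fst_zero, Prod.snd_zero,
      Prod.fst_ofNat, Prod.snd_ofNat] at h ⊢
    omega
  by_cases hd : k - h = h
  · have hkd : k = 2 * h := by linear_combination hd
    subst hkd
    by_cases hjh : j = -h
    · -- the coordinate `3h` occurs once
      subst hjh
      obtain ⟨p, hp⟩ := exists_posFreq hkj
      refine ⟨p, ?_⟩
      rw [pos hp (r := 2 * h - -h) (Or.inl rfl), neg hp (r := h), neg hp (r := 2 * h - h),
        neg hp (r := -h)]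
      · norm_num
      · rintro (e | e)
        · exact hh (two _ (two _ (by linear_combination -e)))
        · exact hh (two _ (by linear_combination e))
      · rintro (e | e)
        · exact hh (two _ (by linear_combination -e))
        · exact hh (two _ (two _ (by linear_combination e)))
      · rintro (e | e)
        · exact hh (two _ (by linear_combination -e))
        · exact hh (two _ (two _ (by linear_combination e)))
    · -- `h` occurs twice, `j` once
      obtain ⟨p, hp⟩ := exists_posFreq hj
      refine ⟨p, ?_⟩
      rw [pos hp (r := j) (Or.inl rfl), neg hp (r := h), neg hp (r := 2 * h - h),
        neg hp (r := 2 * h - j)]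
      · norm_num
      · rintro (e | e)
        · exact h1 (sub_eq_zero.1 (two _ (by linear_combination -e)))
        · exact hk (by linear_combination e)
      · rintro (e | e)
        · exact h1 (by linear_combination -e)
        · exact hjh (by linear_combination e)
      · rintro (e | e)
        · exact h1 e.symm
        · exact hjh (by linear_combination e)
  · by_cases hcase : j = -h ∨ k - j = -h
    · -- `±h` occurs twice, `k - h` once
      obtain ⟨p, hp⟩ := exists_posFreq hkh
      refine ⟨p, ?_⟩
      have hh1 : flipSign p h = 1 := neg hp (by
        rintro (e | e)
        · exact hd e.symm
        · exact hk (by linear_combination e))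
      have hh2 : flipSign p (-h) = 1 := neg hp (by
        rintro (e | e)
        · exact hk (by linear_combination -e)
        · exact hd (by linear_combination e))
      have hh3 : flipSign p (k + h) = 1 := neg hp (by
        rintro (e | e)
        · exact hh (two _ (by linear_combination e))
        · exact hk (two _ (by linear_combination e)))
      rw [pos hp (r := k - h) (Or.inl rfl), hh1]
      rcases hcase with rfl | hc
      · rw [hh2, sub_neg_eq_add, hh3]; norm_num
      · have hj' : j = k + h := by linear_combination -hc
        rw [hc, hh2, hj', hh3]; norm_num
    · -- `h` occurs once
      rw [not_or] at hcase
      obtain ⟨p, hp⟩ := exists_posFreq hh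
      refine ⟨p, ?_⟩
      rw [pos hp (r := h) (Or.inl rfl), neg hp (r := k - h), neg hp (r := j), neg hp (r := k - j)]
      · norm_num
      · rintro (e | e)
        · exact h2 (by linear_combination -e)
        · exact hcase.2 e
      · rintro (e | e)
        · exact h1 e
        · exact hcase.1 e
      · rintro (e | e)
        · exact hd e
        · exact hk (by linear_combination e)

lemma isProbabilityMeasure_productGaussian (hγ : 0 < γ) :
    IsProbabilityMeasure (productGaussian a s γ) := by
  have := isProbabilityMeasure_modeMeasure a s γ hγ
  unfold productGaussian
  infer_instance

lemma measurePreserving_flipMode (hγ : 0 < γ) (p : PosFreq) :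
    MeasurePreserving (flipMode p) (productGaussian a s γ) (productGaussian a s γ) := by
  have := isProbabilityMeasure_modeMeasure a s γ hγ
  let f : PosFreq → ℂ → ℂ := fun i z => if i = p then -z else z
  have hf : ∀ i, Measurable (f i) := fun i => by
    by_cases h : i = p <;> simp only [f, h, if_true, if_false] <;> fun_prop
  have heq : flipMode p = fun v i => f i (v i) := rfl
  refine ⟨?_, ?_⟩
  · rw [heq]; fun_prop
  · rw [heq, productGaussian, Measure.infinitePi_map_pi _ hf]
    congr 1
    funext i
    by_cases h : i = p
    · simp only [f, h, if_true]; exact map_neg_modeMeasure p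
    · simp only [f, h, if_false]; exact Measure.map_id

lemma lintegral_enorm_pow_four (hγ : 0 < γ) {h : ℤ × ℤ} (hh : h ≠ 0) :
    ∫⁻ v, ‖fullMode v h‖ₑ ^ 4 ∂(productGaussian a s γ) =
      ENNReal.ofReal (8 / (γ ^ 2 * lam a s h ^ 4)) := by
  have := isProbabilityMeasure_modeMeasure a s γ hγ
  obtain ⟨p, hp⟩ := exists_posFreq hh
  have h1 : ∀ v : PosFreq → ℂ, ‖fullMode v h‖ₑ = ‖v p‖ₑ := fun v => by
    rcases hp with rfl | rfl
    · rw [fullMode_pos]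
    · rw [fullMode_negPos, ← ofReal_norm, ← ofReal_norm, RCLike.norm_conj]
  have h2 : lam a s h = lam a s p.1 := by
    rcases hp with rfl | rfl
    · rfl
    · rw [lam_neg]
  simp_rw [h1, h2]
  rw [← lintegral_enorm_pow_four_modeMeasure hγ p]
  exact (measurePreserving_eval_infinitePi (modeMeasure a s γ) p).lintegral_comp
    (f := fun z : ℂ => ‖z‖ₑ ^ 4) (by fun_prop)

end Moments

/-! ### Second moments of the quadratic sums -/

section SecondMoment

variable {a s γ : ℝ}

/-- The term `α_{h,k} φ_h φ_{k-h}`. -/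
def quadTerm (a s : ℝ) (k h : ℤ × ℤ) (v : PosFreq → ℂ) : ℂ :=
  (coeffB a s h k : ℂ) * fullMode v h * fullMode v (k - h)

/-- The sum of the terms `α_{h,k} φ_h φ_{k-h}` over a finite set of `h`. -/
def quadSum (a s : ℝ) (k : ℤ × ℤ) (S : Finset (ℤ × ℤ)) (v : PosFreq → ℂ) : ℂ :=
  ∑ h ∈ S, quadTerm a s k h v

lemma continuous_quadTerm (k h : ℤ × ℤ) : Continuous (quadTerm a s k h) :=
  (continuous_const.mul (continuous_fullMode h)).mul (continuous_fullMode (k - h))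

lemma continuous_quadSum (k : ℤ × ℤ) (S : Finset (ℤ × ℤ)) : Continuous (quadSum a s k S) :=
  continuous_finsetSum _ fun h _ => continuous_quadTerm k h

lemma quadTerm_sub (k h : ℤ × ℤ) (v : PosFreq → ℂ) :
    quadTerm a s k (k - h) v = quadTerm a s k h v := by
  have h1 : coeffB a s (k - h) k = coeffB a s h k := by
    unfold coeffB
    rw [sub_sub_cancel]
    congr 1
    unfold dotPerp
    ring
  unfold quadTerm
  rw [h1, sub_sub_cancel]
  ring

lemma quadTerm_eq_zero {k h : ℤ × ℤ} (hh : h = 0 ∨ k - h = 0) (v : PosFreq → ℂ) :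
    quadTerm a s k h v = 0 := by
  unfold quadTerm
  rcases hh with rfl | hh
  · simp [fullMode_zero]
  · simp [hh, fullMode_zero]

/-- The constant in the second moment bounds. -/
def momentConst (s γ : ℝ) : ℝ := 8 * (2 + s) ^ 2 / γ ^ 2

lemma momentConst_nonneg (s γ : ℝ) : 0 ≤ momentConst s γ := by unfold momentConst; positivity

lemma lintegral_quadTerm_le (hs : 0 < s) (hγ : 0 < γ) {k : ℤ × ℤ} (hk : k ≠ 0) (h : ℤ × ℤ) :
    ∫⁻ v, ‖quadTerm a s k h v‖ₑ ^ 2 ∂(productGaussian a s γ) ≤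
      ENNReal.ofReal (momentConst s γ * pairBound k h) := by
  by_cases h0 : h = 0 ∨ k - h = 0
  · simp [quadTerm_eq_zero h0]
  rw [not_or] at h0
  have hl := lam_pos a s h0.1
  have hl' := lam_pos a s h0.2
  have h2 : (2 : ℝ).HolderConjugate 2 := by
    rw [Real.holderConjugate_iff]; norm_num
  have hm : ∀ j, Measurable fun v : PosFreq → ℂ => ‖fullMode v j‖ₑ ^ 2 := fun j =>
    (continuous_fullMode j).measurable.enorm.pow_const 2
  have hCS := ENNReal.lintegral_mul_le_Lp_mul_Lq (productGaussian a s γ) h2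
    (hm h).aemeasurable (hm (k - h)).aemeasurable
  have h4 : ∀ x : ENNReal, (x ^ 2) ^ (2 : ℝ) = x ^ 4 := fun x => by
    rw [ENNReal.rpow_two, ← pow_mul]
  simp only [Pi.mul_apply, h4] at hCS
  rw [lintegral_enorm_pow_four hγ h0.1, lintegral_enorm_pow_four hγ h0.2,
    ENNReal.ofReal_rpow_of_nonneg (by positivity) (by norm_num),
    ENNReal.ofReal_rpow_of_nonneg (by positivity) (by norm_num),
    ← ENNReal.ofReal_mul (by positivity), ← Real.mul_rpow (by positivity) (by positivity),
    ← Real.sqrt_eq_rpow] at hCS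
  have hsq : Real.sqrt (8 / (γ ^ 2 * lam a s h ^ 4) * (8 / (γ ^ 2 * lam a s (k - h) ^ 4))) =
      8 / (γ ^ 2 * (lam a s h ^ 2 * lam a s (k - h) ^ 2)) := by
    rw [show 8 / (γ ^ 2 * lam a s h ^ 4) * (8 / (γ ^ 2 * lam a s (k - h) ^ 4)) =
      (8 / (γ ^ 2 * (lam a s h ^ 2 * lam a s (k - h) ^ 2))) ^ 2 by field_simp]
    exact Real.sqrt_sq (by positivity)
  rw [hsq] at hCS
  have he : ∀ v : PosFreq → ℂ, ‖quadTerm a s k h v‖ₑ ^ 2 =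
      ENNReal.ofReal (coeffB a s h k ^ 2) * (‖fullMode v h‖ₑ ^ 2 * ‖fullMode v (k - h)‖ₑ ^ 2) := by
    intro v
    rw [quadTerm, enorm_mul, enorm_mul, mul_pow, mul_pow, mul_assoc, ← ofReal_norm
      (coeffB a s h k : ℂ), Complex.norm_real, ← ENNReal.ofReal_pow (norm_nonneg _),
      Real.norm_eq_abs, sq_abs]
  simp_rw [he]
  rw [lintegral_const_mul _ ((hm h).fun_mul (hm (k - h)))]
  refine (mul_le_mul_right hCS _).trans ?_
  rw [← ENNReal.ofReal_mul (sq_nonneg _)]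
  refine ENNReal.ofReal_le_ofReal ?_
  have hB := coeffB_sq_le a hs hk h0.1 h0.2
  calc _ ≤ (2 + s) ^ 2 * (lam a s h ^ 2 * lam a s (k - h) ^ 2 / (freqSq h * freqSq (k - h))) *
        (8 / (γ ^ 2 * (lam a s h ^ 2 * lam a s (k - h) ^ 2))) := by gcongr
    _ = _ := by
      unfold momentConst pairBound
      have h1 := one_le_freqSq h0.1
      have h2 := one_le_freqSq h0.2
      field_simp

lemma memLp_quadTerm (hs : 0 < s) (hγ : 0 < γ) {k : ℤ × ℤ} (hk : k ≠ 0) (h : ℤ × ℤ) :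
    MemLp (quadTerm a s k h) 2 (productGaussian a s γ) := by
  refine ⟨(continuous_quadTerm k h).measurable.aestronglyMeasurable, ?_⟩
  have h1 := (lintegral_quadTerm_le hs hγ hk h (a := a)).trans_lt ENNReal.ofReal_lt_top
  rw [← eLpNorm_two_sq] at h1
  exact (ENNReal.pow_lt_top_iff.1 h1).resolve_right (by norm_num)

/-- Different terms are orthogonal in `L²`: the measure is invariant under the change of sign of a
coordinate that occurs an odd number of times. -/
lemma integral_quadTerm_mul_conj_eq_zero (hγ : 0 < γ) {k h j : ℤ × ℤ} (hk : k ≠ 0) (h1 : j ≠ h)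
    (h2 : j ≠ k - h) :
    ∫ v, quadTerm a s k h v * (starRingEnd ℂ) (quadTerm a s k j v) ∂(productGaussian a s γ) =
      0 := by
  by_cases hh : h = 0 ∨ k - h = 0
  · simp [quadTerm_eq_zero hh]
  by_cases hj : j = 0 ∨ k - j = 0
  · simp [quadTerm_eq_zero hj]
  rw [not_or] at hh hj
  obtain ⟨p, hp⟩ := exists_flipSign_mul_eq_neg_one hk hh.1 hh.2 hj.1 hj.2 h1 h2
  have hconj : ∀ q, (starRingEnd ℂ) (flipSign p q) = flipSign p q := fun q => by
    unfold flipSign; split_ifs <;> simp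
  set F := fun v => quadTerm a s k h v * (starRingEnd ℂ) (quadTerm a s k j v) with hF
  have hflip : ∀ v, F (flipMode p v) = -F v := by
    intro v
    simp only [hF, quadTerm, fullMode_flipMode, map_mul, hconj]
    linear_combination ((coeffB a s h k : ℂ) * fullMode v h * fullMode v (k - h) *
      ((starRingEnd ℂ) (coeffB a s j k : ℂ) * (starRingEnd ℂ) (fullMode v j) *
        (starRingEnd ℂ) (fullMode v (k - j)))) * hp
  have hFc : Continuous F := (continuous_quadTerm k h).mul
    (Complex.continuous_conj.comp (continuous_quadTerm k j))
  have hmp := measurePreserving_flipMode (a := a) (s := s) hγ p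
  have h3 : ∫ v, F (flipMode p v) ∂(productGaussian a s γ) = ∫ v, F v ∂(productGaussian a s γ) := by
    rw [← integral_map hmp.measurable.aemeasurable hFc.aestronglyMeasurable, hmp.map_eq]
  simp_rw [hflip, integral_neg] at h3
  exact self_eq_neg.1 h3.symm

lemma lintegral_quadSum_le (hs : 0 < s) (hγ : 0 < γ) {k : ℤ × ℤ} (hk : k ≠ 0)
    (S : Finset (ℤ × ℤ)) :
    ∫⁻ v, ‖quadSum a s k S v‖ₑ ^ 2 ∂(productGaussian a s γ) ≤
      ENNReal.ofReal (2 * momentConst s γ * ∑ h ∈ S, pairBound k h) := by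
  classical
  have := isProbabilityMeasure_productGaussian (a := a) (s := s) hγ
  set μ := productGaussian a s γ
  set E : ℤ × ℤ → ℝ := fun h => ∫ v, ‖quadTerm a s k h v‖ ^ 2 ∂μ with hE
  have hmem := fun h => memLp_quadTerm (a := a) hs hγ hk h
  have hconj : ∀ h, MemLp (fun v => (starRingEnd ℂ) (quadTerm a s k h v)) 2 μ := fun h =>
    (hmem h).star
  have hint : ∀ h j, Integrable
      (fun v => quadTerm a s k h v * (starRingEnd ℂ) (quadTerm a s k j v)) μ := fun h j =>
    (hmem h).integrable_mul (hconj j)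
  have hE0 : ∀ h, 0 ≤ E h := fun h => integral_nonneg fun v => by positivity
  have hEle : ∀ h, E h ≤ momentConst s γ * pairBound k h := by
    intro h
    have h1 : ENNReal.ofReal (E h) = ∫⁻ v, ‖quadTerm a s k h v‖ₑ ^ 2 ∂μ := by
      rw [hE, ofReal_integral_eq_lintegral_ofReal (hmem h).integrable_norm_pow'
        (Eventually.of_forall fun v => by positivity)]
      refine lintegral_congr fun v => ?_
      rw [ENNReal.ofReal_pow (norm_nonneg _), ofReal_norm]
    exact (ENNReal.ofReal_le_ofReal_iff (mul_nonneg (momentConst_nonneg _ _)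
      (pairBound_nonneg _ _))).1 (h1.le.trans (lintegral_quadTerm_le hs hγ hk h))
  have hself : ∀ h, ‖∫ v, quadTerm a s k h v * (starRingEnd ℂ) (quadTerm a s k h v) ∂μ‖ ≤ E h := by
    intro h
    refine (norm_integral_le_integral_norm _).trans (le_of_eq ?_)
    refine integral_congr_ae (Eventually.of_forall fun v => ?_)
    simp only [norm_mul, RCLike.norm_conj, sq]
  have hcross : ∀ h j, ‖∫ v, quadTerm a s k h v * (starRingEnd ℂ) (quadTerm a s k j v) ∂μ‖ ≤
      (if j = h then E h else 0) + if j = k - h then E h else 0 := by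
    intro h j
    by_cases h1 : j = h
    · subst h1
      rw [if_pos rfl]
      refine (hself j).trans (le_add_of_nonneg_right ?_)
      split_ifs
      · exact hE0 j
      · exact le_rfl
    · rw [if_neg h1, zero_add]
      by_cases h2 : j = k - h
      · subst h2
        rw [if_pos rfl]
        simp_rw [quadTerm_sub]
        exact hself h
      · rw [if_neg h2, integral_quadTerm_mul_conj_eq_zero hγ hk h1 h2, norm_zero]
  have hmain : ∫ v, ‖quadSum a s k S v‖ ^ 2 ∂μ ≤ 2 * momentConst s γ * ∑ h ∈ S, pairBound k h := by
    have h1 : ((∫ v, ‖quadSum a s k S v‖ ^ 2 ∂μ : ℝ) : ℂ) = ∑ h ∈ S, ∑ j ∈ S,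
        ∫ v, quadTerm a s k h v * (starRingEnd ℂ) (quadTerm a s k j v) ∂μ := by
      rw [← integral_complex_ofReal]
      have : ∀ v, ((‖quadSum a s k S v‖ ^ 2 : ℝ) : ℂ) = ∑ h ∈ S, ∑ j ∈ S,
          quadTerm a s k h v * (starRingEnd ℂ) (quadTerm a s k j v) := by
        intro v
        rw [← Complex.normSq_eq_norm_sq, ← Complex.mul_conj, quadSum, map_sum,
          Finset.sum_mul_sum]
      simp_rw [this]
      rw [integral_finsetSum _ fun h _ => integrable_finsetSum _ fun j _ => hint h j]
      exact Finset.sum_congr rfl fun h _ => integral_finsetSum _ fun j _ => hint h j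
    have h2 : ‖((∫ v, ‖quadSum a s k S v‖ ^ 2 ∂μ : ℝ) : ℂ)‖ ≤ ∑ h ∈ S, 2 * E h := by
      rw [h1]
      refine (norm_sum_le _ _).trans (Finset.sum_le_sum fun h _ => ?_)
      refine (norm_sum_le _ _).trans ((Finset.sum_le_sum fun j _ => hcross h j).trans ?_)
      rw [Finset.sum_add_distrib, Finset.sum_ite_eq', Finset.sum_ite_eq', two_mul]
      refine add_le_add ?_ ?_ <;> split_ifs <;> first | exact le_rfl | exact hE0 h
    rw [Complex.norm_real, Real.norm_eq_abs] at h2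
    refine (le_abs_self _).trans (h2.trans ?_)
    rw [Finset.mul_sum]
    refine Finset.sum_le_sum fun h _ => ?_
    rw [mul_assoc]
    exact mul_le_mul_of_nonneg_left (hEle h) (by norm_num)
  have hmemS : MemLp (quadSum a s k S) 2 μ := by
    have := memLp_finsetSum S fun h _ => hmem h
    exact this
  have h3 := ENNReal.ofReal_le_ofReal hmain
  rw [ofReal_integral_eq_lintegral_ofReal hmemS.integrable_norm_pow'
    (Eventually.of_forall fun v => by positivity)] at h3
  refine (le_of_eq (lintegral_congr fun v => ?_)).trans h3
  rw [ENNReal.ofReal_pow (norm_nonneg _), ofReal_norm]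

end SecondMoment

/-! ### Almost everywhere convergence of the vector field -/

section Convergence

/-- A sequence converges if it converges along the squares, quickly, and its variation between
consecutive squares tends to zero. -/
lemma exists_tendsto_of_squares {x : ℕ → ℂ}
    (h1 : Summable fun m : ℕ => ‖x ((m + 1) ^ 2) - x (m ^ 2)‖)
    (h2 : Tendsto (fun m : ℕ => ∑ i ∈ Finset.Ico (m ^ 2) ((m + 1) ^ 2), ‖x (i + 1) - x i‖)
      atTop (𝓝 0)) : ∃ l, Tendsto x atTop (𝓝 l) := by
  have hc : CauchySeq fun m : ℕ => x (m ^ 2) := by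
    refine cauchySeq_of_summable_dist (h1.congr fun m => ?_)
    rw [dist_comm, dist_eq_norm]
  obtain ⟨l, hl⟩ := cauchySeq_tendsto_of_complete hc
  have hsqrt : Tendsto Nat.sqrt atTop atTop :=
    tendsto_atTop_atTop.2 fun b => ⟨b ^ 2, fun n hn => Nat.le_sqrt'.2 hn⟩
  refine ⟨l, ?_⟩
  have h3 : Tendsto (fun n => x n - x (n.sqrt ^ 2)) atTop (𝓝 0) := by
    refine squeeze_zero_norm (fun n => ?_) (h2.comp hsqrt)
    have hle : n.sqrt ^ 2 ≤ n := Nat.sqrt_le' n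
    have hlt : n < (n.sqrt + 1) ^ 2 := Nat.lt_succ_sqrt' n
    rw [← dist_eq_norm, dist_comm]
    refine (dist_le_Ico_sum_dist x hle).trans ?_
    simp only [Function.comp_apply, dist_comm (x _) (x (_ + 1)), dist_eq_norm]
    exact Finset.sum_le_sum_of_subset_of_nonneg (Finset.Ico_subset_Ico le_rfl hlt.le)
      fun _ _ _ => norm_nonneg _
  simpa using h3.add (hl.comp hsqrt)

lemma ae_summable_of_lintegral_le {Y : Type*} [MeasurableSpace Y] {ν : Measure Y}
    {W : ℕ → Y → ℝ} (hW : ∀ m, Measurable (W m)) (hW0 : ∀ m y, 0 ≤ W m y) {G : ℕ → ℝ}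
    (hG0 : ∀ m, 0 ≤ G m) (hG : Summable G)
    (h : ∀ m, ∫⁻ y, ENNReal.ofReal (W m y) ∂ν ≤ ENNReal.ofReal (G m)) :
    ∀ᵐ y ∂ν, Summable fun m => W m y := by
  have h1 : ∫⁻ y, ∑' m, ENNReal.ofReal (W m y) ∂ν ≠ ⊤ := by
    rw [lintegral_tsum fun m => (hW m).ennreal_ofReal.aemeasurable]
    refine ne_top_of_le_ne_top ?_ (ENNReal.tsum_le_tsum h)
    rw [← ENNReal.ofReal_tsum_of_nonneg hG0 hG]
    exact ENNReal.ofReal_ne_top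
  filter_upwards [ae_lt_top (Measurable.tsum fun m => (hW m).ennreal_ofReal) h1] with y hy
  exact (ENNReal.summable_toReal hy.ne).congr fun m => ENNReal.toReal_ofReal (hW0 m y)

lemma tendsto_zero_of_sq {u : ℕ → ENNReal} (h : Tendsto (fun n => u n ^ 2) atTop (𝓝 0)) :
    Tendsto u atTop (𝓝 0) := by
  have h3 := h.ennrpow_const (1 / 2)
  rw [ENNReal.zero_rpow_of_pos (by norm_num)] at h3
  refine h3.congr fun n => ?_
  rw [← ENNReal.rpow_natCast, ← ENNReal.rpow_mul]
  norm_num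

lemma freqBall_mono : Monotone freqBall := fun m n hmn h hh => by
  rw [mem_freqBall] at hh ⊢
  exact hh.trans (by exact_mod_cast hmn)

lemma tendsto_freqBall : Tendsto freqBall atTop atTop :=
  tendsto_atTop_finset_of_monotone freqBall_mono fun h =>
    ⟨⌈freqSq h⌉₊, (mem_freqBall _ _).2 (Nat.le_ceil _)⟩

variable {a s γ : ℝ}

lemma truncB_eq_quadSum (n : ℕ) (k : PosFreq) (v : PosFreq → ℂ) :
    truncB a s n k v = quadSum a s k.1 (freqBall n) v := rfl

lemma lintegral_quadSum_sub_le (hs : 0 < s) (hγ : 0 < γ) {k : ℤ × ℤ} (hk : k ≠ 0)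
    {S T : Finset (ℤ × ℤ)} (hST : S ⊆ T) :
    ∫⁻ v, ‖quadSum a s k T v - quadSum a s k S v‖ₑ ^ 2 ∂(productGaussian a s γ) ≤
      ENNReal.ofReal (2 * momentConst s γ * (∑ h ∈ T, pairBound k h - ∑ h ∈ S, pairBound k h)) := by
  classical
  have h1 := lintegral_quadSum_le (a := a) hs hγ hk (T \ S)
  rw [Finset.sum_sdiff_eq_sub hST] at h1
  refine (le_of_eq (lintegral_congr fun v => ?_)).trans h1
  rw [quadSum, quadSum, quadSum, Finset.sum_sdiff_eq_sub hST]

/-- The sums of `pairBound k` over the shells `m² < h² ≤ (m + 1)²` are summable with the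
weights `(m + 1)^{3/2}`. -/
lemma summable_shell (k : ℤ × ℤ) : Summable fun m : ℕ => ((m : ℝ) + 1) ^ (3 / 2 : ℝ) *
    (∑ h ∈ freqBall ((m + 1) ^ 2), pairBound k h - ∑ h ∈ freqBall (m ^ 2), pairBound k h) := by
  classical
  set f : ℤ × ℤ → ℝ := fun h => freqSq h ^ (3 / 4 : ℝ) * pairBound k h with hf
  have hf0 : ∀ h, 0 ≤ f h := fun h =>
    mul_nonneg (Real.rpow_nonneg (freqSq_nonneg h) _) (pairBound_nonneg k h)
  have hsub : ∀ m : ℕ, freqBall (m ^ 2) ⊆ freqBall ((m + 1) ^ 2) := fun m =>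
    freqBall_mono (Nat.pow_le_pow_left (Nat.le_succ m) 2)
  have hle : ∀ m : ℕ, ((m : ℝ) + 1) ^ (3 / 2 : ℝ) *
      (∑ h ∈ freqBall ((m + 1) ^ 2), pairBound k h - ∑ h ∈ freqBall (m ^ 2), pairBound k h) ≤
      4 * (∑ h ∈ freqBall ((m + 1) ^ 2), f h - ∑ h ∈ freqBall (m ^ 2), f h) := by
    intro m
    rw [← Finset.sum_sdiff_eq_sub (hsub m), ← Finset.sum_sdiff_eq_sub (hsub m), Finset.mul_sum,
      Finset.mul_sum]
    refine Finset.sum_le_sum fun h hh => ?_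
    rw [Finset.mem_sdiff, mem_freqBall, mem_freqBall, not_le] at hh
    have h1 : (m : ℝ) ^ 2 < freqSq h := by exact_mod_cast hh.2
    have h2 : 1 ≤ freqSq h := one_le_freqSq fun h0 => by
      rw [h0, freqSq_zero] at h1
      exact absurd h1 (not_lt.2 (sq_nonneg _))
    have h3 : ((m : ℝ) + 1) ^ 2 ≤ 4 * freqSq h := by
      rcases Nat.eq_zero_or_pos m with rfl | hm
      · norm_num; linarith
      · have : (1 : ℝ) ≤ m := by exact_mod_cast hm
        nlinarith
    have h4 : ((m : ℝ) + 1) ^ (3 / 2 : ℝ) ≤ 4 * freqSq h ^ (3 / 4 : ℝ) := by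
      calc ((m : ℝ) + 1) ^ (3 / 2 : ℝ) = (((m : ℝ) + 1) ^ 2) ^ (3 / 4 : ℝ) := by
            rw [← Real.rpow_natCast, ← Real.rpow_mul (by positivity)]; norm_num
        _ ≤ (4 * freqSq h) ^ (3 / 4 : ℝ) := Real.rpow_le_rpow (by positivity) h3 (by norm_num)
        _ = (4 : ℝ) ^ (3 / 4 : ℝ) * freqSq h ^ (3 / 4 : ℝ) :=
            Real.mul_rpow (by norm_num) (freqSq_nonneg h)
        _ ≤ 4 * freqSq h ^ (3 / 4 : ℝ) := by
            refine mul_le_mul_of_nonneg_right ?_ (Real.rpow_nonneg (freqSq_nonneg h) _)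
            calc (4 : ℝ) ^ (3 / 4 : ℝ) ≤ (4 : ℝ) ^ (1 : ℝ) :=
                  Real.rpow_le_rpow_of_exponent_le (by norm_num) (by norm_num)
              _ = 4 := Real.rpow_one 4
    simp only [hf, ← mul_assoc]
    exact mul_le_mul_of_nonneg_right h4 (pairBound_nonneg k h)
  refine summable_of_sum_range_le (c := 4 * ∑' h, f h) (fun m => ?_) (fun M => ?_)
  · rw [← Finset.sum_sdiff_eq_sub (hsub m)]
    exact mul_nonneg (by positivity) (Finset.sum_nonneg fun h _ => pairBound_nonneg k h)
  · refine (Finset.sum_le_sum fun m _ => hle m).trans ?_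
    rw [← Finset.mul_sum, Finset.sum_range_sub (fun m => ∑ h ∈ freqBall (m ^ 2), f h)]
    refine mul_le_mul_of_nonneg_left ?_ (by norm_num)
    have h1 := (summable_rpow_mul_pairBound k).sum_le_tsum (freqBall (M ^ 2)) fun h _ => hf0 h
    have h2 : 0 ≤ ∑ h ∈ freqBall (0 ^ 2), f h := Finset.sum_nonneg fun h _ => hf0 h
    exact (sub_le_self _ h2).trans h1

/-- The sums for `B_k` over the balls `h² ≤ n` converge almost everywhere: the squared increments
between the radii `m` and `m + 1`, multiplied by `(m + 1)^{3/2}`, have a finite sum in the mean, and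
so does the square of the variation within such a shell. -/
lemma ae_tendsto_truncB (hs : 0 < s) (hγ : 0 < γ) (k : PosFreq) :
    ∀ᵐ v ∂(productGaussian a s γ),
      Tendsto (fun n => truncB a s n k v) atTop (𝓝 (vectorB a s k v)) := by
  set F : ℕ → ℝ := fun n => ∑ h ∈ freqBall n, pairBound k.1 h with hF
  set K := 2 * momentConst s γ with hK
  have hK0 : 0 ≤ K := mul_nonneg (by norm_num) (momentConst_nonneg _ _)
  have hX : ∀ n, Measurable (truncB a s n k) := fun n =>
    (continuous_quadSum (a := a) (s := s) k.1 (freqBall n)).measurable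
  have hFm : Monotone F := fun m n hmn => Finset.sum_le_sum_of_subset_of_nonneg
    (freqBall_mono hmn) fun h _ _ => pairBound_nonneg _ _
  have hE : ∀ m n, m ≤ n → ∫⁻ v, ENNReal.ofReal (‖truncB a s n k v - truncB a s m k v‖ ^ 2)
      ∂(productGaussian a s γ) ≤ ENNReal.ofReal (K * (F n - F m)) := by
    intro m n hmn
    refine (le_of_eq (lintegral_congr fun v => ?_)).trans
      (lintegral_quadSum_sub_le hs hγ k.ne_zero (freqBall_mono hmn) (a := a))
    rw [ENNReal.ofReal_pow (norm_nonneg _), ofReal_norm, truncB_eq_quadSum, truncB_eq_quadSum]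
  have hsq : ∀ m : ℕ, m ^ 2 ≤ (m + 1) ^ 2 := fun m => Nat.pow_le_pow_left (Nat.le_succ m) 2
  have hc : ∀ m : ℕ, 1 ≤ ((m : ℝ) + 1) ^ (3 / 2 : ℝ) := fun m =>
    Real.one_le_rpow (by linarith [(Nat.cast_nonneg m : (0 : ℝ) ≤ m)]) (by norm_num)
  have hshell := summable_shell k.1
  have hG0 : ∀ m : ℕ, 0 ≤ F ((m + 1) ^ 2) - F (m ^ 2) := fun m => sub_nonneg.2 (hFm (hsq m))
  -- the increments along the squares
  have h1 := ae_summable_of_lintegral_le (ν := productGaussian a s γ)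
    (W := fun (m : ℕ) v => ((m : ℝ) + 1) ^ (3 / 2 : ℝ) *
      ‖truncB a s ((m + 1) ^ 2) k v - truncB a s (m ^ 2) k v‖ ^ 2)
    (fun m => (((hX _).fun_sub (hX _)).norm.pow_const 2).const_mul _) (fun m v => by positivity)
    (G := fun m : ℕ => K * (((m : ℝ) + 1) ^ (3 / 2 : ℝ) * (F ((m + 1) ^ 2) - F (m ^ 2))))
    (fun m => mul_nonneg hK0 (mul_nonneg (zero_le_one.trans (hc m)) (hG0 m)))
    (hshell.mul_left K) (fun m => by
      have hc0 := zero_le_one.trans (hc m)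
      simp_rw [ENNReal.ofReal_mul hc0]
      rw [lintegral_const_mul _ (((hX _).fun_sub (hX _)).norm.pow_const 2).ennreal_ofReal,
        mul_left_comm, ENNReal.ofReal_mul hc0]
      exact mul_le_mul_right (hE _ _ (hsq m)) _)
  -- the variation between consecutive squares
  have h2 := ae_summable_of_lintegral_le (ν := productGaussian a s γ)
    (W := fun (m : ℕ) v => ∑ i ∈ Finset.Ico (m ^ 2) ((m + 1) ^ 2), (2 * m + 1) *
      ‖truncB a s (i + 1) k v - truncB a s i k v‖ ^ 2)
    (fun m => Finset.measurable_fun_sum _ fun i _ =>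
      (((hX _).fun_sub (hX _)).norm.pow_const 2).const_mul _) (fun m v => by positivity)
    (G := fun m : ℕ => 2 * (K * (((m : ℝ) + 1) ^ (3 / 2 : ℝ) * (F ((m + 1) ^ 2) - F (m ^ 2)))))
    (fun m => mul_nonneg (by norm_num)
      (mul_nonneg hK0 (mul_nonneg (zero_le_one.trans (hc m)) (hG0 m))))
    ((hshell.mul_left K).mul_left 2) (fun m => by
      have h2m : (0 : ℝ) ≤ 2 * m + 1 := by positivity
      have hi : ∀ i, ∫⁻ v, ENNReal.ofReal ((2 * m + 1) *
          ‖truncB a s (i + 1) k v - truncB a s i k v‖ ^ 2) ∂(productGaussian a s γ) ≤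
          ENNReal.ofReal ((2 * m + 1) * K * (F (i + 1) - F i)) := by
        intro i
        simp_rw [ENNReal.ofReal_mul h2m]
        rw [lintegral_const_mul _ (((hX _).fun_sub (hX _)).norm.pow_const 2).ennreal_ofReal,
          mul_assoc, ENNReal.ofReal_mul h2m]
        exact mul_le_mul_right (hE _ _ (Nat.le_succ i)) _
      have hsum : ∀ v, ENNReal.ofReal (∑ i ∈ Finset.Ico (m ^ 2) ((m + 1) ^ 2), (2 * m + 1) *
          ‖truncB a s (i + 1) k v - truncB a s i k v‖ ^ 2) =
          ∑ i ∈ Finset.Ico (m ^ 2) ((m + 1) ^ 2), ENNReal.ofReal ((2 * m + 1) *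
          ‖truncB a s (i + 1) k v - truncB a s i k v‖ ^ 2) := fun v =>
        ENNReal.ofReal_sum_of_nonneg fun i _ => by positivity
      simp_rw [hsum]
      rw [lintegral_finsetSum _ fun i _ =>
        ((((hX _).fun_sub (hX _)).norm.pow_const 2).const_mul _).ennreal_ofReal]
      refine (Finset.sum_le_sum fun i _ => hi i).trans ?_
      rw [← ENNReal.ofReal_sum_of_nonneg fun i _ =>
        mul_nonneg (mul_nonneg h2m hK0) (sub_nonneg.2 (hFm (Nat.le_succ i))), ← Finset.mul_sum,
        Finset.sum_Ico_sub F (hsq m)]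
      refine ENNReal.ofReal_le_ofReal ?_
      have hb : 2 * (m : ℝ) + 1 ≤ 2 * ((m : ℝ) + 1) ^ (3 / 2 : ℝ) := by
        have h3 := Real.rpow_le_rpow_of_exponent_le (x := (m : ℝ) + 1)
          (by linarith [(Nat.cast_nonneg m : (0 : ℝ) ≤ m)]) (y := 1) (z := 3 / 2) (by norm_num)
        rw [Real.rpow_one] at h3
        linarith
      calc _ = (2 * (m : ℝ) + 1) * (K * (F ((m + 1) ^ 2) - F (m ^ 2))) := by ring
        _ ≤ 2 * ((m : ℝ) + 1) ^ (3 / 2 : ℝ) * (K * (F ((m + 1) ^ 2) - F (m ^ 2))) :=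
          mul_le_mul_of_nonneg_right hb (mul_nonneg hK0 (hG0 m))
        _ = _ := by ring)
  filter_upwards [h1, h2] with v hv1 hv2
  refine tendsto_nhds_limUnder (exists_tendsto_of_squares ?_ ?_)
  · have h3 : Summable fun m : ℕ => (((m : ℝ) + 1) ^ (3 / 2 : ℝ))⁻¹ := by
      have := (summable_nat_add_iff 1).2
        (Real.summable_nat_rpow_inv.2 (by norm_num : (1 : ℝ) < 3 / 2))
      exact this.congr fun m => by push_cast; rfl
    refine Summable.of_nonneg_of_le (fun m => norm_nonneg _) (fun m => ?_) (h3.add hv1)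
    set c := ((m : ℝ) + 1) ^ (3 / 2 : ℝ)
    set z := ‖truncB a s ((m + 1) ^ 2) k v - truncB a s (m ^ 2) k v‖
    have hc0 : 0 < c := zero_lt_one.trans_le (hc m)
    have : c⁻¹ + c * z ^ 2 - z = c⁻¹ * ((1 - c * z / 2) ^ 2 + 3 / 4 * (c * z) ^ 2) := by
      field_simp
      ring
    have h4 : 0 ≤ c⁻¹ * ((1 - c * z / 2) ^ 2 + 3 / 4 * (c * z) ^ 2) := by positivity
    linarith
  · have h3 := hv2.tendsto_atTop_zero
    have h4 := (Real.continuous_sqrt.tendsto 0).comp h3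
    rw [Real.sqrt_zero] at h4
    refine squeeze_zero (fun m => Finset.sum_nonneg fun i _ => norm_nonneg _) (fun m => ?_) h4
    refine Real.le_sqrt_of_sq_le ?_
    refine sq_sum_le_card_mul_sum_sq.trans (le_of_eq ?_)
    rw [Finset.mul_sum, Nat.card_Ico]
    have : (((m + 1) ^ 2 - m ^ 2 : ℕ) : ℝ) = 2 * m + 1 := by
      rw [Nat.cast_sub (hsq m)]; push_cast; ring
    rw [this]

lemma measurable_vectorB (k : PosFreq) : Measurable (vectorB a s k) := by
  have h : ∀ n, StronglyMeasurable (truncB a s n k) := fun n =>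
    (continuous_quadSum (a := a) (s := s) k.1 (freqBall n)).measurable.stronglyMeasurable
  exact (StronglyMeasurable.limUnder h).measurable

/-- The `L²` distance to the almost everywhere limit, by Fatou's lemma. -/
lemma lintegral_quadSum_sub_vectorB_le (hs : 0 < s) (hγ : 0 < γ) (k : PosFreq)
    (S : Finset (ℤ × ℤ)) :
    ∫⁻ v, ‖quadSum a s k.1 S v - vectorB a s k v‖ₑ ^ 2 ∂(productGaussian a s γ) ≤
      ENNReal.ofReal
        (2 * momentConst s γ * (∑' h, pairBound k.1 h - ∑ h ∈ S, pairBound k.1 h)) := by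
  have hK0 : 0 ≤ 2 * momentConst s γ := mul_nonneg (by norm_num) (momentConst_nonneg _ _)
  have hlim : ∀ᵐ v ∂(productGaussian a s γ), ‖quadSum a s k.1 S v - vectorB a s k v‖ₑ ^ 2 =
      liminf (fun n => ‖quadSum a s k.1 (freqBall n) v - quadSum a s k.1 S v‖ₑ ^ 2) atTop := by
    filter_upwards [ae_tendsto_truncB (a := a) hs hγ k] with v hv
    rw [← enorm_neg, neg_sub]
    exact (ENNReal.Tendsto.pow (n := 2) (hv.sub_const _).enorm).liminf_eq.symm
  rw [lintegral_congr_ae hlim]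
  refine (lintegral_liminf_le fun n =>
    ((continuous_quadSum _ _).sub (continuous_quadSum _ _)).measurable.enorm.pow_const 2).trans ?_
  refine liminf_le_of_frequently_le' (Eventually.frequently ?_)
  filter_upwards [tendsto_freqBall.eventually_ge_atTop S] with n hn
  refine (lintegral_quadSum_sub_le hs hγ k.ne_zero hn).trans (ENNReal.ofReal_le_ofReal ?_)
  refine mul_le_mul_of_nonneg_left (sub_le_sub_right ?_ _) hK0
  exact (summable_pairBound k.1).sum_le_tsum _ fun h _ => pairBound_nonneg _ _

lemma tendsto_eLpNorm_quadSum_sub_vectorB (hs : 0 < s) (hγ : 0 < γ) (k : PosFreq)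
    {S : ℕ → Finset (ℤ × ℤ)} (hS : Tendsto S atTop atTop) :
    Tendsto (fun n => eLpNorm (fun v => quadSum a s k.1 (S n) v - vectorB a s k v) 2
      (productGaussian a s γ)) atTop (𝓝 0) := by
  have h1 : Tendsto (fun n => 2 * momentConst s γ *
      (∑' h, pairBound k.1 h - ∑ h ∈ S n, pairBound k.1 h)) atTop (𝓝 0) := by
    have := (((summable_pairBound k.1).hasSum.comp hS).const_sub
      (∑' h, pairBound k.1 h)).const_mul (2 * momentConst s γ)
    simpa using this
  have h2 : Tendsto (fun n => eLpNorm (fun v => quadSum a s k.1 (S n) v - vectorB a s k v) 2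
      (productGaussian a s γ) ^ 2) atTop (𝓝 0) := by
    refine tendsto_of_tendsto_of_tendsto_of_le_of_le tendsto_const_nhds
      (by simpa using ENNReal.tendsto_ofReal h1) (fun n => zero_le) (fun n => ?_)
    rw [eLpNorm_two_sq]
    exact lintegral_quadSum_sub_vectorB_le hs hγ k (S n)
  exact tendsto_zero_of_sq h2

lemma lintegral_vectorB_le (hs : 0 < s) (hγ : 0 < γ) (k : PosFreq) :
    ∫⁻ v, ‖vectorB a s k v‖ₑ ^ 2 ∂(productGaussian a s γ) ≤
      ENNReal.ofReal (2 * momentConst s γ * (2 * ∑' h : ℤ × ℤ, (freqSq h)⁻¹ ^ 2)) := by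
  have hK0 : 0 ≤ 2 * momentConst s γ := mul_nonneg (by norm_num) (momentConst_nonneg _ _)
  have h := lintegral_quadSum_sub_vectorB_le (a := a) hs hγ k ∅
  simp only [quadSum, Finset.sum_empty, zero_sub, enorm_neg, sub_zero] at h
  exact h.trans (ENNReal.ofReal_le_ofReal
    (mul_le_mul_of_nonneg_left (tsum_pairBound_le k.1) hK0))

lemma lintegral_enorm_sq_mode_le (hs : 0 < s) (hγ : 0 < γ) (k : PosFreq) :
    ∫⁻ v, ‖v k‖ₑ ^ 2 ∂(productGaussian a s γ) ≤ ENNReal.ofReal (3 / γ) := by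
  have := isProbabilityMeasure_productGaussian (a := a) (s := s) hγ
  have h1 := sq_lintegral_le (productGaussian a s γ) (h := fun v => ‖v k‖ₑ ^ 2)
    ((measurable_pi_apply k).enorm.pow_const 2).aemeasurable
  have h4 := lintegral_enorm_pow_four (a := a) (s := s) hγ k.ne_zero
  simp only [fullMode_pos] at h4
  simp only [measure_univ, one_mul, ← pow_mul] at h1
  rw [h4] at h1
  have hl : 1 ≤ lam a s k.1 := (one_le_freqSq k.ne_zero).trans (freqSq_le_lam a hs _)
  refine (ENNReal.pow_le_pow_left_iff two_ne_zero).1 (h1.trans ?_)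
  rw [← ENNReal.ofReal_pow (by positivity)]
  refine ENNReal.ofReal_le_ofReal ?_
  have hl4 : 1 ≤ lam a s k.1 ^ 4 := one_le_pow₀ hl
  rw [div_pow, div_le_div_iff₀ (by positivity) (by positivity)]
  nlinarith [sq_nonneg γ, mul_le_mul_of_nonneg_left hl4 (sq_nonneg γ)]

lemma IsQuadLip.zero {ι : Type} : IsQuadLip (fun _ : ι → ℂ => (0 : ℂ)) := ⟨∅, 0, by simp⟩

lemma IsQuadLip.add {ι : Type} {f g : (ι → ℂ) → ℂ} (hf : IsQuadLip f) (hg : IsQuadLip g) :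
    IsQuadLip fun x => f x + g x := by
  classical
  obtain ⟨J, C, hf⟩ := hf
  obtain ⟨J', C', hg⟩ := hg
  refine ⟨J ∪ J', |C| + |C'|, fun x y => ?_⟩
  have key : ∀ I : Finset ι, I ⊆ J ∪ J' → ∀ D : ℝ,
      D * ∑ i ∈ I, ∑ l ∈ I, ‖x i - y i‖ * (‖x l‖ + ‖y l‖) ≤
      |D| * ∑ i ∈ J ∪ J', ∑ l ∈ J ∪ J', ‖x i - y i‖ * (‖x l‖ + ‖y l‖) := by
    intro I hI D
    refine mul_le_mul (le_abs_self D) ?_ (by positivity) (abs_nonneg D)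
    refine (Finset.sum_le_sum_of_subset_of_nonneg hI fun _ _ _ => by positivity).trans ?_
    exact Finset.sum_le_sum fun i _ =>
      Finset.sum_le_sum_of_subset_of_nonneg hI fun _ _ _ => by positivity
  calc ‖f x + g x - (f y + g y)‖ = ‖(f x - f y) + (g x - g y)‖ := by congr 1; ring
    _ ≤ ‖f x - f y‖ + ‖g x - g y‖ := norm_add_le _ _
    _ ≤ _ := by
      rw [add_mul]
      exact add_le_add ((hf x y).trans (key J Finset.subset_union_left C))
        ((hg x y).trans (key J' Finset.subset_union_right C'))

lemma IsQuadLip.sum {ι : Type} {κ : Type*} {S : Finset κ} {f : κ → (ι → ℂ) → ℂ}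
    (hf : ∀ h ∈ S, IsQuadLip (f h)) : IsQuadLip fun x => ∑ h ∈ S, f h x := by
  classical
  induction S using Finset.induction_on with
  | empty => simpa using IsQuadLip.zero
  | insert h S hh ih =>
    simp_rw [Finset.sum_insert hh]
    exact (hf h (Finset.mem_insert_self _ _)).add
      (ih fun j hj => hf j (Finset.mem_insert_of_mem hj))

lemma exists_norm_fullMode_eq {h : ℤ × ℤ} (hh : h ≠ 0) : ∃ p : PosFreq, ∀ x y : PosFreq → ℂ,
    ‖fullMode x h‖ = ‖x p‖ ∧ ‖fullMode x h - fullMode y h‖ = ‖x p - y p‖ := by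
  obtain ⟨p, hp⟩ := exists_posFreq hh
  refine ⟨p, fun x y => ?_⟩
  rcases hp with rfl | rfl
  · simp only [fullMode_pos, and_self]
  · simp only [fullMode_negPos, ← map_sub, RCLike.norm_conj, and_self]

lemma isQuadLip_quadTerm (k h : ℤ × ℤ) : IsQuadLip (quadTerm a s k h) := by
  classical
  by_cases h0 : h = 0 ∨ k - h = 0
  · have : quadTerm a s k h = fun _ => 0 := funext fun v => quadTerm_eq_zero h0 v
    rw [this]
    exact IsQuadLip.zero
  rw [not_or] at h0
  obtain ⟨p, hp⟩ := exists_norm_fullMode_eq h0.1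
  obtain ⟨q, hq⟩ := exists_norm_fullMode_eq h0.2
  refine ⟨{p, q}, |coeffB a s h k|, fun x y => ?_⟩
  have e : quadTerm a s k h x - quadTerm a s k h y = (coeffB a s h k : ℂ) *
      ((fullMode x h - fullMode y h) * fullMode x (k - h) +
        fullMode y h * (fullMode x (k - h) - fullMode y (k - h))) := by
    unfold quadTerm; ring
  rw [e, norm_mul, Complex.norm_real, Real.norm_eq_abs]
  refine mul_le_mul_of_nonneg_left ?_ (abs_nonneg _)
  refine (norm_add_le _ _).trans ?_
  rw [norm_mul, norm_mul, (hp x y).2, (hq x y).1, (hp y x).1, (hq x y).2]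
  by_cases hpq : p = q
  · subst hpq
    simp only [Finset.pair_eq_singleton, Finset.sum_singleton]
    exact le_of_eq (by ring)
  · rw [Finset.sum_pair hpq, Finset.sum_pair hpq, Finset.sum_pair hpq]
    have h1 := norm_nonneg (x p - y p)
    have h2 := norm_nonneg (x q - y q)
    have h3 := norm_nonneg (x p)
    have h4 := norm_nonneg (x q)
    have h5 := norm_nonneg (y p)
    have h6 := norm_nonneg (y q)
    nlinarith [mul_nonneg h1 h3, mul_nonneg h1 h5, mul_nonneg h1 h6, mul_nonneg h2 h3,
      mul_nonneg h2 h4, mul_nonneg h2 h6]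

lemma isQuadLip_truncB (n : ℕ) (k : PosFreq) : IsQuadLip (truncB a s n k) :=
  IsQuadLip.sum fun h _ => isQuadLip_quadTerm k.1 h

end Convergence

/-! ### Maps of product measures that change two coordinates -/

section TwoCoordinates

variable {κ : Type*} [DecidableEq κ] {α : κ → Type*} [∀ i, MeasurableSpace (α i)]
  (ν : ∀ i, Measure (α i)) [∀ i, IsProbabilityMeasure (ν i)]

/-- Resampling one coordinate independently does not change a product measure. -/
lemma measurePreserving_update (i : κ) :
    MeasurePreserving (fun p : (∀ j, α j) × α i => Function.update p.1 i p.2)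
      ((Measure.infinitePi ν).prod (ν i)) (Measure.infinitePi ν) := by
  have hm : Measurable fun p : (∀ j, α j) × α i => Function.update p.1 i p.2 := measurable_update'
  refine ⟨hm, Measure.eq_infinitePi ν fun s t ht => ?_⟩
  rw [Measure.map_apply hm (MeasurableSet.pi s.countable_toSet fun j _ => ht j)]
  by_cases hi : i ∈ s
  · have : (fun p : (∀ j, α j) × α i => Function.update p.1 i p.2) ⁻¹' Set.pi s t =
        Set.pi (s.erase i) t ×ˢ t i := by
      ext ⟨x, u⟩
      simp only [Set.mem_preimage, Set.mem_pi, Set.mem_prod, Finset.coe_erase, Set.mem_sdiff,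
        Finset.mem_coe, Set.mem_singleton_iff]
      refine ⟨fun h => ⟨fun j hj => ?_, ?_⟩, fun h j hj => ?_⟩
      · simpa [Function.update_of_ne hj.2] using h j hj.1
      · simpa using h i hi
      · by_cases hji : j = i
        · subst hji; simpa using h.2
        · simpa [Function.update_of_ne hji] using h.1 j ⟨hj, hji⟩
    rw [this, Measure.prod_prod, Measure.infinitePi_pi ν fun j _ => ht j,
      Finset.prod_erase_mul _ _ hi]
  · have : (fun p : (∀ j, α j) × α i => Function.update p.1 i p.2) ⁻¹' Set.pi s t =
        Set.pi s t ×ˢ Set.univ := by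
      ext ⟨x, u⟩
      simp only [Set.mem_preimage, Set.mem_pi, Set.mem_prod, Finset.mem_coe, Set.mem_univ,
        and_true]
      refine forall₂_congr fun j hj => ?_
      rw [Function.update_of_ne (fun h : j = i => hi (h ▸ hj))]
    rw [this, Measure.prod_prod, Measure.infinitePi_pi ν fun j _ => ht j, measure_univ, mul_one]

lemma measurePreserving_update_update (i j : κ) :
    MeasurePreserving
      (fun p : (∀ l, α l) × (α i × α j) => Function.update (Function.update p.1 i p.2.1) j p.2.2)
      ((Measure.infinitePi ν).prod ((ν i).prod (ν j))) (Measure.infinitePi ν) := by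
  have h1 : MeasurePreserving (MeasurableEquiv.prodAssoc (α := ∀ l, α l) (β := α i) (γ := α j)).symm
      ((Measure.infinitePi ν).prod ((ν i).prod (ν j)))
      (((Measure.infinitePi ν).prod (ν i)).prod (ν j)) :=
    (measurePreserving_prodAssoc _ _ _).symm
  exact (measurePreserving_update ν j).comp
    (((measurePreserving_update ν i).prod (MeasurePreserving.id (ν j))).comp h1)

/-- A transformation `R` of two coordinates that depends on the other coordinates as parameters
preserves a product measure, if it preserves the product of the two measures for all values of the
parameters. -/
lemma measurePreserving_pairMap {i j : κ} (hij : i ≠ j)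
    {R : (∀ l, α l) → α i × α j → α i × α j} (hRm : Measurable (Function.uncurry R))
    (hR : ∀ x u w, R (Function.update (Function.update x i u) j w) = R x)
    (hmp : ∀ x, MeasurePreserving (R x) ((ν i).prod (ν j)) ((ν i).prod (ν j))) :
    MeasurePreserving (fun x => Function.update (Function.update x i (R x (x i, x j)).1) j
      (R x (x i, x j)).2) (Measure.infinitePi ν) (Measure.infinitePi ν) := by
  set Ψ : (∀ l, α l) × (α i × α j) → ∀ l, α l :=
    fun p => Function.update (Function.update p.1 i p.2.1) j p.2.2 with hΨ
  set T : (∀ l, α l) → ∀ l, α l := fun x => Function.update (Function.update x i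
    (R x (x i, x j)).1) j (R x (x i, x j)).2 with hT
  have hΨmp : MeasurePreserving Ψ ((Measure.infinitePi ν).prod ((ν i).prod (ν j)))
    (Measure.infinitePi ν) := measurePreserving_update_update ν i j
  have hskew := (MeasurePreserving.id (Measure.infinitePi ν)).skew_product hRm
    (Eventually.of_forall fun x => (hmp x).map_eq)
  have hpair : Measurable fun x : ∀ l, α l => (x, (x i, x j)) :=
    measurable_id.prodMk ((measurable_pi_apply i).prodMk (measurable_pi_apply j))
  have hTm : Measurable T := by
    have : T = fun x => Ψ (x, Function.uncurry R (x, (x i, x j))) := rfl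
    rw [this]
    exact hΨmp.measurable.comp (measurable_id.prodMk (hRm.comp hpair))
  have hcomm : T ∘ Ψ = Ψ ∘ fun p => (id p.1, R p.1 p.2) := by
    funext ⟨x, u, w⟩
    simp only [Function.comp_apply, hT, hΨ, hR, id]
    rw [Function.update_of_ne hij, Function.update_self, Function.update_self]
    rw [Function.update_comm hij.symm w, Function.update_idem, Function.update_idem]
  refine ⟨hTm, ?_⟩
  conv_lhs => rw [← hΨmp.map_eq, Measure.map_map hTm hΨmp.measurable, hcomm]
  exact (hΨmp.comp hskew).map_eq

end TwoCoordinates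

/-! ### Linear maps that preserve a quadratic form -/

/-- A linear map that preserves a function with bounded sublevel set preserves the volume: it maps
the sublevel set into itself. -/
lemma measurePreserving_of_linear {E : Type*} [NormedAddCommGroup E] [NormedSpace ℝ E]
    [FiniteDimensional ℝ E] [MeasurableSpace E] [BorelSpace E] (ν : Measure E)
    [ν.IsAddHaarMeasure] (f : E →ₗ[ℝ] E) {Q : E → ℝ} (hQ : Continuous Q) (hQ0 : Q 0 = 0)
    (hbdd : Bornology.IsBounded {x | Q x ≤ 1}) (hpos : ∀ x, Q x = 0 → x = 0)
    (hf : ∀ x, Q (f x) = Q x) : MeasurePreserving f ν ν := by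
  have hdet : LinearMap.det f ≠ 0 := fun h => by
    obtain ⟨x, hx, hx0⟩ := Submodule.exists_mem_ne_zero_of_ne_bot
      (LinearMap.bot_lt_ker_of_det_eq_zero h).ne'
    refine hx0 (hpos x ?_)
    rw [← hf, LinearMap.mem_ker.1 hx, hQ0]
  have hfm : Measurable f := f.continuous_of_finiteDimensional.measurable
  have hclosed : IsClosed {x | Q x ≤ 1} := isClosed_le hQ continuous_const
  have hmap := Measure.map_linearMap_addHaar_eq_smul_addHaar ν hdet
  have h1 : ν.map f {x | Q x ≤ 1} = ν {x | Q x ≤ 1} := by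
    rw [Measure.map_apply hfm hclosed.measurableSet]
    congr 1
    ext x
    simp [hf]
  have hfin : ν {x | Q x ≤ 1} ≠ ⊤ := hbdd.measure_lt_top.ne
  have hne : ν {x | Q x ≤ 1} ≠ 0 := by
    have hopen : IsOpen {x | Q x < 1} := isOpen_lt hQ continuous_const
    have h0 : (0 : E) ∈ {x | Q x < 1} := by simp [hQ0]
    have h2 := hopen.measure_pos ν ⟨0, h0⟩
    exact (h2.trans_le (measure_mono fun x (hx : Q x < 1) => hx.le)).ne'
  rw [hmap, Measure.smul_apply, smul_eq_mul] at h1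
  have h2 : ENNReal.ofReal |(LinearMap.det f)⁻¹| = 1 :=
    (ENNReal.mul_left_inj hne hfin).1 (by rw [h1, one_mul])
  refine ⟨hfm, ?_⟩
  rw [hmap, h2, one_smul]

/-- If a map preserves a measure and a density, it preserves the measure with this density. -/
lemma MeasurePreserving.withDensity {E : Type*} [MeasurableSpace E] {ν : Measure E} {f : E → E}
    (hf : MeasurePreserving f ν ν) {D : E → ENNReal} (hD : Measurable D)
    (hfD : ∀ x, D (f x) = D x) :
    MeasurePreserving f (ν.withDensity D) (ν.withDensity D) := by
  refine ⟨hf.measurable, ?_⟩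
  ext S hS
  rw [Measure.map_apply hf.measurable hS, withDensity_apply _ hS,
    withDensity_apply _ (hf.measurable hS), ← hf.setLIntegral_comp_preimage hS hD]
  simp_rw [hfD]

/-- A linear map of `ℂ × ℂ` that preserves `lam_p² |u|² + lam_q² |w|²` preserves the Gaussian
measure of the modes `p` and `q`. -/
lemma measurePreserving_modeMeasure_prod {a s γ : ℝ} (hγ : 0 < γ) (p q : PosFreq)
    (f : ℂ × ℂ →ₗ[ℝ] ℂ × ℂ)
    (hf : ∀ z, lam a s p.1 ^ 2 * ‖(f z).1‖ ^ 2 + lam a s q.1 ^ 2 * ‖(f z).2‖ ^ 2 =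
      lam a s p.1 ^ 2 * ‖z.1‖ ^ 2 + lam a s q.1 ^ 2 * ‖z.2‖ ^ 2) :
    MeasurePreserving f ((modeMeasure a s γ p).prod (modeMeasure a s γ q))
      ((modeMeasure a s γ p).prod (modeMeasure a s γ q)) := by
  have hp := pow_pos (lam_pos a s p.ne_zero) 2
  have hq := pow_pos (lam_pos a s q.ne_zero) 2
  have hvol : MeasurePreserving f ((volume : Measure ℂ).prod (volume : Measure ℂ))
      ((volume : Measure ℂ).prod (volume : Measure ℂ)) := by
    refine measurePreserving_of_linear _ f
      (Q := fun z => lam a s p.1 ^ 2 * ‖z.1‖ ^ 2 + lam a s q.1 ^ 2 * ‖z.2‖ ^ 2) (by fun_prop)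
      (by simp) ?_ (fun z hz => ?_) hf
    · refine (Metric.isBounded_closedBall (x := (0 : ℂ × ℂ))
        (r := Real.sqrt ((lam a s p.1 ^ 2)⁻¹ + (lam a s q.1 ^ 2)⁻¹))).subset fun z hz => ?_
      have hz' : lam a s p.1 ^ 2 * ‖z.1‖ ^ 2 + lam a s q.1 ^ 2 * ‖z.2‖ ^ 2 ≤ 1 := hz
      have hpi := inv_pos.2 hp
      have hqi := inv_pos.2 hq
      have h1 : ‖z.1‖ ^ 2 ≤ (lam a s p.1 ^ 2)⁻¹ := by
        rw [← one_div, le_div_iff₀' hp]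
        nlinarith [mul_nonneg hq.le (sq_nonneg ‖z.2‖)]
      have h2 : ‖z.2‖ ^ 2 ≤ (lam a s q.1 ^ 2)⁻¹ := by
        rw [← one_div, le_div_iff₀' hq]
        nlinarith [mul_nonneg hp.le (sq_nonneg ‖z.1‖)]
      rw [mem_closedBall_zero_iff, Prod.norm_def]
      exact max_le (Real.le_sqrt_of_sq_le (by linarith)) (Real.le_sqrt_of_sq_le (by linarith))
    · have h1 : ‖z.1‖ ^ 2 = 0 := by
        nlinarith [mul_nonneg hp.le (sq_nonneg ‖z.1‖), mul_nonneg hq.le (sq_nonneg ‖z.2‖),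
          sq_nonneg ‖z.1‖]
      have h2 : ‖z.2‖ ^ 2 = 0 := by
        nlinarith [mul_nonneg hp.le (sq_nonneg ‖z.1‖), mul_nonneg hq.le (sq_nonneg ‖z.2‖),
          sq_nonneg ‖z.2‖]
      exact Prod.ext (by simpa using h1) (by simpa using h2)
  have hprob := isProbabilityMeasure_modeMeasure a s γ hγ q
  have hdens : (modeMeasure a s γ p).prod (modeMeasure a s γ q) =
      ((volume : Measure ℂ).prod (volume : Measure ℂ)).withDensity fun z => ENNReal.ofReal
        (γ * lam a s p.1 ^ 2 / (2 * Real.pi) * (γ * lam a s q.1 ^ 2 / (2 * Real.pi)) *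
          Real.exp (-(1 / 2) * γ *
            (lam a s p.1 ^ 2 * ‖z.1‖ ^ 2 + lam a s q.1 ^ 2 * ‖z.2‖ ^ 2))) := by
    have hsf : SFinite (modeMeasure a s γ q) := inferInstance
    unfold modeMeasure at hsf ⊢
    rw [prod_withDensity (by fun_prop) (by fun_prop)]
    congr 1
    funext z
    have := Real.pi_pos
    rw [← ENNReal.ofReal_mul (by positivity), mul_mul_mul_comm, ← Real.exp_add]
    congr 2
    · unfold lam; ring
    · unfold lam; ring_nf
  rw [hdens]
  refine MeasurePreserving.withDensity hvol (by fun_prop) fun z => ?_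
  rw [hf]

/-! ### Exchange of enstrophy between two modes -/

/-- The identity (`true`) or the complex conjugation (`false`). -/
def conjIf : Bool → ℂ →ₐ[ℝ] ℂ
  | true => AlgHom.id ℝ ℂ
  | false => Complex.conjAe

/-- The frequency `k` (`true`) or `-k` (`false`). -/
def signIf : Bool → ℤ × ℤ → ℤ × ℤ
  | true, k => k
  | false, k => -k

lemma conjIf_conjIf (σ : Bool) (z : ℂ) : conjIf σ (conjIf σ z) = z := by
  cases σ <;> simp [conjIf]

lemma norm_conjIf (σ : Bool) (z : ℂ) : ‖conjIf σ z‖ = ‖z‖ := by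
  cases σ <;> simp [conjIf]

lemma conjIf_ofReal (σ : Bool) (r : ℝ) : conjIf σ (r : ℂ) = r := by
  cases σ <;> simp [conjIf]

lemma continuous_conjIf (σ : Bool) : Continuous (conjIf σ) := by
  cases σ
  · exact Complex.continuous_conj
  · exact continuous_id

lemma fullMode_signIf (σ : Bool) (b : PosFreq) (x : PosFreq → ℂ) :
    fullMode x (signIf σ b.1) = conjIf σ (x b) := by
  cases σ
  · exact fullMode_negPos x b
  · exact fullMode_pos x b

/-- `(cos (δ |g|) - 1) / δ`, written in a way that is continuous at `δ = 0`. -/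
def cosRate (δ : ℝ) (g : ℂ) : ℝ := -(‖g‖ * Real.sin (δ * ‖g‖ / 2) * Real.sinc (δ * ‖g‖ / 2))

/-- `sin (δ |g|) / (δ |g|)`. -/
def sinRate (δ : ℝ) (g : ℂ) : ℝ := Real.sinc (δ * ‖g‖)

lemma mul_sinc (t : ℝ) : t * Real.sinc t = Real.sin t := by
  rcases eq_or_ne t 0 with rfl | ht
  · simp
  · rw [Real.sinc_of_ne_zero ht]; field_simp

lemma cosRate_sinRate_sq (δ : ℝ) (g : ℂ) :
    (1 + δ * cosRate δ g) ^ 2 + (δ * sinRate δ g) ^ 2 * ‖g‖ ^ 2 = 1 := by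
  have h1 : 1 + δ * cosRate δ g = Real.cos (δ * ‖g‖) := by
    have h := mul_sinc (δ * ‖g‖ / 2)
    have h2 := Real.cos_two_mul (δ * ‖g‖ / 2)
    have h3 := Real.sin_sq_add_cos_sq (δ * ‖g‖ / 2)
    rw [mul_div_cancel₀ _ (two_ne_zero' ℝ)] at h2
    unfold cosRate
    linear_combination (-2 * Real.sin (δ * ‖g‖ / 2)) * h - h2 - 2 * h3
  have h2 : δ * sinRate δ g * ‖g‖ = Real.sin (δ * ‖g‖) := by
    rw [← mul_sinc (δ * ‖g‖)]; unfold sinRate; ring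
  rw [h1, ← mul_pow, h2, Real.cos_sq_add_sin_sq]

lemma abs_cosRate_le (δ : ℝ) (g : ℂ) : |cosRate δ g| ≤ ‖g‖ := by
  unfold cosRate
  rw [abs_neg, abs_mul, abs_mul, abs_norm]
  calc _ ≤ ‖g‖ * 1 * 1 := by
        gcongr
        · exact Real.abs_sin_le_one _
        · exact Real.abs_sinc_le_one _
    _ = ‖g‖ := by ring

lemma abs_sinRate_le (δ : ℝ) (g : ℂ) : |sinRate δ g| ≤ 1 := Real.abs_sinc_le_one _

lemma cosRate_zero (g : ℂ) : cosRate 0 g = 0 := by simp [cosRate]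

lemma sinRate_zero (g : ℂ) : sinRate 0 g = 1 := by simp [sinRate]

lemma continuous_cosRate : Continuous fun p : ℝ × ℂ => cosRate p.1 p.2 := by
  have h : Continuous fun p : ℝ × ℂ => p.1 * ‖p.2‖ / 2 := by fun_prop
  exact ((continuous_snd.norm.mul (Real.continuous_sin.comp h)).mul
    (Real.continuous_sinc.comp h)).neg

lemma continuous_sinRate : Continuous fun p : ℝ × ℂ => sinRate p.1 p.2 :=
  Real.continuous_sinc.comp (by fun_prop : Continuous fun p : ℝ × ℂ => p.1 * ‖p.2‖)

/-- First component of the increment rate of the rotation `swapLin`. -/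
def rateFst (r : ℝ) (σ : Bool) (δ : ℝ) (g u w : ℂ) : ℂ :=
  cosRate δ g * u + sinRate δ g * g * r * conjIf σ w

/-- Second component of the increment rate of the rotation `swapLin`. -/
def rateSnd (r : ℝ) (σ : Bool) (δ : ℝ) (g u w : ℂ) : ℂ :=
  cosRate δ g * w - sinRate δ g * conjIf σ ((starRingEnd ℂ) g) * r * conjIf σ u

/-- The time `δ` map of the linear equation `l u' = g (m w)`, `m w' = -ḡ (l u)`, or of the same
equation with the conjugate of `w` in place of `w`. -/
def swapLin (l m : ℝ) (σ : Bool) (δ : ℝ) (g : ℂ) : ℂ × ℂ →ₗ[ℝ] ℂ × ℂ where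
  toFun z := (z.1 + δ • rateFst (m / l) σ δ g z.1 z.2, z.2 + δ • rateSnd (l / m) σ δ g z.1 z.2)
  map_add' y z := by
    ext1 <;> simp only [rateFst, rateSnd, Prod.fst_add, Prod.snd_add, map_add,
      Complex.real_smul] <;> ring
  map_smul' c z := by
    ext1 <;> simp only [rateFst, rateSnd, Prod.smul_fst, Prod.smul_snd, Complex.real_smul, map_mul,
      conjIf_ofReal, RingHom.id_apply] <;> ring

lemma norm_sq_rotation (C S : ℝ) (g U W : ℂ) (h : C ^ 2 + S ^ 2 * ‖g‖ ^ 2 = 1) :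
    ‖C * U + S * g * W‖ ^ 2 + ‖C * W - S * (starRingEnd ℂ) g * U‖ ^ 2 = ‖U‖ ^ 2 + ‖W‖ ^ 2 := by
  simp only [Complex.sq_norm, Complex.normSq_apply] at h ⊢
  simp
  linear_combination (U.re * U.re + U.im * U.im + W.re * W.re + W.im * W.im) * h

lemma norm_sq_swapLin {l m : ℝ} (hl : l ≠ 0) (hm : m ≠ 0) (σ : Bool) (δ : ℝ) (g : ℂ) (z : ℂ × ℂ) :
    l ^ 2 * ‖(swapLin l m σ δ g z).1‖ ^ 2 + m ^ 2 * ‖(swapLin l m σ δ g z).2‖ ^ 2 =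
      l ^ 2 * ‖z.1‖ ^ 2 + m ^ 2 * ‖z.2‖ ^ 2 := by
  have hl' : (l : ℂ) ≠ 0 := by exact_mod_cast hl
  have hm' : (m : ℂ) ≠ 0 := by exact_mod_cast hm
  have key : ∀ (r : ℝ) (y : ℂ), r ^ 2 * ‖y‖ ^ 2 = ‖(r : ℂ) * y‖ ^ 2 := fun r y => by
    rw [norm_mul, mul_pow, Complex.norm_real, Real.norm_eq_abs, sq_abs]
  have h := norm_sq_rotation (1 + δ * cosRate δ g) (δ * sinRate δ g) g (l * z.1)
    (m * conjIf σ z.2) (cosRate_sinRate_sq δ g)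
  have h1 : (l : ℂ) * (swapLin l m σ δ g z).1 = ((1 + δ * cosRate δ g : ℝ) : ℂ) * (l * z.1) +
      ((δ * sinRate δ g : ℝ) : ℂ) * g * (m * conjIf σ z.2) := by
    simp only [swapLin, LinearMap.coe_mk, AddHom.coe_mk, rateFst, Complex.real_smul]
    push_cast
    field_simp
    ring
  have h2 : (m : ℂ) * (swapLin l m σ δ g z).2 = conjIf σ (((1 + δ * cosRate δ g : ℝ) : ℂ) *
      (m * conjIf σ z.2) - ((δ * sinRate δ g : ℝ) : ℂ) * (starRingEnd ℂ) g * (l * z.1)) := by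
    simp only [swapLin, LinearMap.coe_mk, AddHom.coe_mk, rateSnd, Complex.real_smul, map_sub,
      map_mul, conjIf_ofReal, conjIf_conjIf]
    push_cast
    field_simp
    ring
  rw [key, key, h1, h2, norm_conjIf, h, norm_mul, norm_mul, norm_conjIf, mul_pow, mul_pow,
    Complex.norm_real, Complex.norm_real, Real.norm_eq_abs, Real.norm_eq_abs, sq_abs, sq_abs]

lemma norm_rateFst_le {r : ℝ} (hr : 0 ≤ r) (σ : Bool) (δ : ℝ) (g u w : ℂ) :
    ‖rateFst r σ δ g u w‖ ≤ ‖g‖ * ‖u‖ + r * (‖g‖ * ‖w‖) := by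
  refine (norm_add_le _ _).trans (add_le_add ?_ ?_)
  · rw [norm_mul, Complex.norm_real]
    exact mul_le_mul_of_nonneg_right (abs_cosRate_le δ g) (norm_nonneg _)
  · rw [norm_mul, norm_mul, norm_mul, Complex.norm_real, Complex.norm_real, norm_conjIf,
      Real.norm_of_nonneg hr]
    have := abs_sinRate_le δ g
    calc _ ≤ 1 * ‖g‖ * r * ‖w‖ := by gcongr; exact this
      _ = _ := by ring

lemma norm_rateSnd_le {r : ℝ} (hr : 0 ≤ r) (σ : Bool) (δ : ℝ) (g u w : ℂ) :
    ‖rateSnd r σ δ g u w‖ ≤ ‖g‖ * ‖w‖ + r * (‖g‖ * ‖u‖) := by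
  refine (norm_sub_le _ _).trans (add_le_add ?_ ?_)
  · rw [norm_mul, Complex.norm_real]
    exact mul_le_mul_of_nonneg_right (abs_cosRate_le δ g) (norm_nonneg _)
  · rw [norm_mul, norm_mul, norm_mul, Complex.norm_real, Complex.norm_real, norm_conjIf,
      norm_conjIf, RCLike.norm_conj, Real.norm_of_nonneg hr]
    have := abs_sinRate_le δ g
    calc _ ≤ 1 * ‖g‖ * r * ‖u‖ := by gcongr; exact this
      _ = _ := by ring

section Continuity

variable {Y : Type*} [TopologicalSpace Y] {d : Y → ℝ} {g u w : Y → ℂ}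

lemma continuous_rateFst (r : ℝ) (σ : Bool) (hd : Continuous d) (hg : Continuous g)
    (hu : Continuous u) (hw : Continuous w) :
    Continuous fun y => rateFst r σ (d y) (g y) (u y) (w y) := by
  have h1 := Complex.continuous_ofReal.comp (continuous_cosRate.comp (hd.prodMk hg))
  have h2 := Complex.continuous_ofReal.comp (continuous_sinRate.comp (hd.prodMk hg))
  exact (h1.mul hu).add (((h2.mul hg).mul continuous_const).mul ((continuous_conjIf σ).comp hw))

lemma continuous_rateSnd (r : ℝ) (σ : Bool) (hd : Continuous d) (hg : Continuous g)
    (hu : Continuous u) (hw : Continuous w) :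
    Continuous fun y => rateSnd r σ (d y) (g y) (u y) (w y) := by
  have h1 := Complex.continuous_ofReal.comp (continuous_cosRate.comp (hd.prodMk hg))
  have h2 := Complex.continuous_ofReal.comp (continuous_sinRate.comp (hd.prodMk hg))
  exact (h1.mul hw).sub (((h2.mul ((continuous_conjIf σ).comp
    (Complex.continuous_conj.comp hg))).mul continuous_const).mul ((continuous_conjIf σ).comp hu))

lemma continuous_swapLin (l m : ℝ) (σ : Bool) (hd : Continuous d) (hg : Continuous g)
    (hu : Continuous u) (hw : Continuous w) :
    Continuous fun y => swapLin l m σ (d y) (g y) (u y, w y) :=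
  (hu.add (hd.smul (continuous_rateFst (m / l) σ hd hg hu hw))).prodMk
    (hw.add (hd.smul (continuous_rateSnd (l / m) σ hd hg hu hw)))

end Continuity

/-! ### The elementary steps of the splitting -/

/-- The matrix element of the advection by the truncated velocity field, between the modes `a` and
`q` of the vorticity: the coefficient of index `a - q` of `φ`, times `-(a · q^⊥) / (2π)`. -/
def advect (N : ℕ) (a q : ℤ × ℤ) (x : PosFreq → ℂ) : ℂ :=
  if freqSq (a - q) ≤ N then -((dotPerp a q / (2 * Real.pi) : ℝ) : ℂ) * fullMode x (a - q) else 0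

lemma continuous_advect (N : ℕ) (a q : ℤ × ℤ) : Continuous (advect N a q) := by
  unfold advect
  split_ifs
  · exact continuous_const.mul (continuous_fullMode _)
  · exact continuous_const

/-- The advection is antihermitian. -/
lemma advect_swap (N : ℕ) (a q : ℤ × ℤ) (x : PosFreq → ℂ) :
    advect N q a x = -(starRingEnd ℂ) (advect N a q x) := by
  have h : q - a = -(a - q) := by abel
  have h2 : dotPerp q a = -dotPerp a q := by unfold dotPerp; ring
  unfold advect
  rw [h, freqSq_neg, h2]
  split_ifs
  · rw [fullMode_neg, map_mul, map_neg, Complex.conj_ofReal, neg_div]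
    push_cast
    ring
  · simp

/-- The advection maps real functions to real functions. -/
lemma advect_neg_neg (N : ℕ) (a q : ℤ × ℤ) (x : PosFreq → ℂ) :
    advect N (-a) (-q) x = (starRingEnd ℂ) (advect N a q x) := by
  have h : -a - -q = -(a - q) := by abel
  have h2 : dotPerp (-a) (-q) = dotPerp a q := by simp [dotPerp]
  unfold advect
  rw [h, freqSq_neg, h2]
  split_ifs
  · rw [fullMode_neg, map_mul, map_neg, Complex.conj_ofReal]
  · simp

lemma dotPerp_signIf (σ : Bool) (a b : ℤ × ℤ) (h : dotPerp a b = 0) :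
    dotPerp a (signIf σ b) = 0 := by
  cases σ
  · simp only [signIf, dotPerp, Prod.fst_neg, Prod.snd_neg, Int.cast_neg] at h ⊢
    linear_combination -h
  · exact h

lemma fullMode_update {h : ℤ × ℤ} {c : PosFreq} (h1 : h ≠ c.1) (h2 : h ≠ -c.1) (x : PosFreq → ℂ)
    (u : ℂ) : fullMode (Function.update x c u) h = fullMode x h := by
  rcases eq_or_ne h 0 with rfl | hh
  · rw [fullMode_zero, fullMode_zero]
  obtain ⟨p, rfl | rfl⟩ := exists_posFreq hh
  · rw [fullMode_pos, fullMode_pos, Function.update_of_ne fun e => h1 (congrArg Subtype.val e)]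
  · rw [fullMode_negPos, fullMode_negPos,
      Function.update_of_ne fun e => h2 (congrArg (fun y : PosFreq => -y.1) e)]

/-- If `a` and `q` are not parallel, the advecting mode `a - q` is different from both. -/
lemma advect_update (N : ℕ) {a b : PosFreq} (σ : Bool) (hab : dotPerp a.1 b.1 ≠ 0)
    (x : PosFreq → ℂ) (u w : ℂ) :
    advect N a.1 (signIf σ b.1) (Function.update (Function.update x a u) b w) =
      advect N a.1 (signIf σ b.1) x := by
  have key : ∀ c : PosFreq, (c = a ∨ c = b) →
      a.1 - signIf σ b.1 ≠ c.1 ∧ a.1 - signIf σ b.1 ≠ -c.1 := by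
    rintro c (rfl | rfl) <;> constructor <;> intro h <;> apply hab <;>
      have h1 := congrArg (fun k : ℤ × ℤ => (k.1 : ℝ)) h <;>
      have h2 := congrArg (fun k : ℤ × ℤ => (k.2 : ℝ)) h <;>
      cases σ <;> simp only [signIf, Prod.fst_sub, Prod.snd_sub, Prod.fst_neg, Prod.snd_neg,
        Int.cast_sub, Int.cast_neg] at h1 h2 <;> unfold dotPerp
    · linear_combination -(c.1.1 : ℝ) * h2 + (c.1.2 : ℝ) * h1
    · linear_combination (c.1.1 : ℝ) * h2 - (c.1.2 : ℝ) * h1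
    · linear_combination -(c.1.1 : ℝ) * h2 + (c.1.2 : ℝ) * h1
    · linear_combination (c.1.1 : ℝ) * h2 - (c.1.2 : ℝ) * h1
    · linear_combination -(c.1.2 : ℝ) * h1 + (c.1.1 : ℝ) * h2
    · linear_combination -(c.1.2 : ℝ) * h1 + (c.1.1 : ℝ) * h2
    · linear_combination -(c.1.2 : ℝ) * h1 + (c.1.1 : ℝ) * h2
    · linear_combination -(c.1.2 : ℝ) * h1 + (c.1.1 : ℝ) * h2
  unfold advect
  rw [fullMode_update (key b (Or.inr rfl)).1 (key b (Or.inr rfl)).2,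
    fullMode_update (key a (Or.inl rfl)).1 (key a (Or.inl rfl)).2]

/-- The increment rate over the time `δ` of the step that couples the modes `p` and `±q`. Each pair
of modes occurs twice among the steps, hence the factor `1/2`. -/
def stepRate (a s : ℝ) (N : ℕ) (p q : PosFreq) (σ : Bool) (δ : ℝ) (x : PosFreq → ℂ) :
    PosFreq → ℂ :=
  Pi.single p (rateFst (lam a s q.1 / lam a s p.1) σ δ (advect N p.1 (signIf σ q.1) x / 2)
    (x p) (x q)) +
  Pi.single q (rateSnd (lam a s p.1 / lam a s q.1) σ δ (advect N p.1 (signIf σ q.1) x / 2)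
    (x p) (x q))

lemma stepRate_eq_zero {a s : ℝ} (N : ℕ) {p q : PosFreq} (σ : Bool) (h : dotPerp p.1 q.1 = 0)
    (δ : ℝ) (x : PosFreq → ℂ) : stepRate a s N p q σ δ x = 0 := by
  have hg : advect N p.1 (signIf σ q.1) x = 0 := by
    unfold advect
    rw [dotPerp_signIf σ _ _ h]
    simp
  simp [stepRate, rateFst, rateSnd, hg, cosRate]

lemma ne_of_dotPerp_ne_zero {p q : PosFreq} (h : dotPerp p.1 q.1 ≠ 0) : p ≠ q := by
  rintro rfl
  exact h (by unfold dotPerp; ring)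

lemma add_stepRate {a s : ℝ} (N : ℕ) {p q : PosFreq} (σ : Bool) (h : p ≠ q)
    (δ : ℝ) (x : PosFreq → ℂ) : x + δ • stepRate a s N p q σ δ x =
      Function.update (Function.update x p (swapLin (lam a s p.1) (lam a s q.1) σ δ
        (advect N p.1 (signIf σ q.1) x / 2) (x p, x q)).1) q
        (swapLin (lam a s p.1) (lam a s q.1) σ δ
        (advect N p.1 (signIf σ q.1) x / 2) (x p, x q)).2 := by
  funext c
  by_cases hq : c = q
  · subst hq
    rw [Function.update_self]
    simp [stepRate, swapLin, Pi.single_eq_of_ne h.symm]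
  · rw [Function.update_of_ne hq]
    by_cases hp : c = p
    · subst hp
      rw [Function.update_self]
      simp [stepRate, swapLin, Pi.single_eq_of_ne h]
    · rw [Function.update_of_ne hp]
      simp [stepRate, Pi.single_eq_of_ne hp, Pi.single_eq_of_ne hq]

lemma continuous_stepRate (a s : ℝ) (N : ℕ) (p q : PosFreq) (σ : Bool) :
    Continuous fun y : ℝ × (PosFreq → ℂ) => stepRate a s N p q σ y.1 y.2 := by
  have hg : Continuous fun y : ℝ × (PosFreq → ℂ) => advect N p.1 (signIf σ q.1) y.2 / 2 :=
    ((continuous_advect N p.1 (signIf σ q.1)).comp continuous_snd).div_const 2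
  have hu : ∀ i : PosFreq, Continuous fun y : ℝ × (PosFreq → ℂ) => y.2 i := fun i => by fun_prop
  have h3 : ∀ (i : PosFreq) (f : ℝ × (PosFreq → ℂ) → ℂ), Continuous f →
      Continuous fun y => (Pi.single i (f y) : PosFreq → ℂ) := fun i f hf =>
    (continuous_single i).comp hf
  exact (h3 p _ (continuous_rateFst _ σ continuous_fst hg (hu p) (hu q))).add
    (h3 q _ (continuous_rateSnd _ σ continuous_fst hg (hu p) (hu q)))

lemma measurePreserving_add_stepRate {a s γ : ℝ} (hγ : 0 < γ) (N : ℕ) (p q : PosFreq) (σ : Bool)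
    (δ : ℝ) : MeasurePreserving (fun x => x + δ • stepRate a s N p q σ δ x)
      (productGaussian a s γ) (productGaussian a s γ) := by
  by_cases h : dotPerp p.1 q.1 = 0
  · simp_rw [stepRate_eq_zero N σ h, smul_zero, add_zero]
    exact MeasurePreserving.id _
  have := isProbabilityMeasure_modeMeasure a s γ hγ
  simp_rw [add_stepRate N σ (ne_of_dotPerp_ne_zero h)]
  refine measurePreserving_pairMap (modeMeasure a s γ) (ne_of_dotPerp_ne_zero h)
    (R := fun x => swapLin (lam a s p.1) (lam a s q.1) σ δ (advect N p.1 (signIf σ q.1) x / 2))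
    ?_ (fun x u w => by rw [advect_update N σ h]) (fun x => ?_)
  · have hg : Continuous fun y : (PosFreq → ℂ) × ℂ × ℂ =>
        advect N p.1 (signIf σ q.1) y.1 / 2 :=
      ((continuous_advect N p.1 (signIf σ q.1)).comp continuous_fst).div_const 2
    exact (continuous_swapLin (lam a s p.1) (lam a s q.1) σ (continuous_const (y := δ)) hg
      continuous_snd.fst continuous_snd.snd).measurable
  · exact measurePreserving_modeMeasure_prod hγ p q _ fun z =>
      norm_sq_swapLin (lam_pos a s p.ne_zero).ne' (lam_pos a s q.ne_zero).ne' σ δ _ z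

/-! ### Composition of the steps -/

open scoped Classical in
/-- The finite set of the positive frequencies with `k² ≤ N`. -/
def posBall (N : ℕ) : Finset PosFreq := (freqBall N).subtype IsPos

lemma mem_posBall {N : ℕ} {c : PosFreq} : c ∈ posBall N ↔ freqSq c.1 ≤ N := by
  classical
  exact Finset.mem_subtype.trans (mem_freqBall N c.1)

/-- The contribution of the modes with `k² ≤ N` to the (averaged) enstrophy. -/
def enstrophy (a s : ℝ) (N : ℕ) (x : PosFreq → ℂ) : ℝ :=
  ∑ c ∈ posBall N, lam a s c.1 ^ 2 * ‖x c‖ ^ 2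

lemma enstrophy_nonneg (a s : ℝ) (N : ℕ) (x : PosFreq → ℂ) : 0 ≤ enstrophy a s N x :=
  Finset.sum_nonneg fun _ _ => by positivity

variable {a s γ : ℝ} {N : ℕ}

lemma norm_sq_mode_le (hs : 0 < s) {c : PosFreq} (hc : c ∈ posBall N) (x : PosFreq → ℂ) :
    ‖x c‖ ^ 2 ≤ enstrophy a s N x := by
  have hl : 1 ≤ lam a s c.1 ^ 2 :=
    one_le_pow₀ ((one_le_freqSq c.ne_zero).trans (freqSq_le_lam a hs _))
  have h1 := Finset.single_le_sum (f := fun c : PosFreq => lam a s c.1 ^ 2 * ‖x c‖ ^ 2)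
    (fun _ _ => by positivity) hc
  exact (le_mul_of_one_le_left (sq_nonneg _) hl).trans h1

lemma norm_sq_fullMode_le (hs : 0 < s) {h : ℤ × ℤ} (hh : freqSq h ≤ N) (x : PosFreq → ℂ) :
    ‖fullMode x h‖ ^ 2 ≤ enstrophy a s N x := by
  rcases eq_or_ne h 0 with rfl | h0
  · rw [fullMode_zero]
    simpa using enstrophy_nonneg a s N x
  obtain ⟨p, rfl | rfl⟩ := exists_posFreq h0
  · rw [fullMode_pos]
    exact norm_sq_mode_le hs (mem_posBall.2 hh) x
  · rw [fullMode_negPos, RCLike.norm_conj]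
    exact norm_sq_mode_le hs (mem_posBall.2 (by rwa [freqSq_neg] at hh)) x

lemma norm_advect_mul_le (hs : 0 < s) {c : PosFreq} (hc : c ∈ posBall N) (k q : ℤ × ℤ)
    (x : PosFreq → ℂ) : ‖advect N k q x / 2‖ * ‖x c‖ ≤
      |dotPerp k q / (2 * Real.pi)| * enstrophy a s N x := by
  have hρ := enstrophy_nonneg a s N x
  unfold advect
  split_ifs with h
  · rw [norm_div, norm_mul, norm_neg, Complex.norm_real, Real.norm_eq_abs]
    have h1 := norm_sq_fullMode_le (a := a) hs h x
    have h2 := norm_sq_mode_le (a := a) hs hc x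
    have h3 : ‖fullMode x (k - q)‖ * ‖x c‖ ≤ enstrophy a s N x := by
      nlinarith [sq_nonneg (‖fullMode x (k - q)‖ - ‖x c‖)]
    have h4 := mul_le_mul_of_nonneg_left h3 (abs_nonneg (dotPerp k q / (2 * Real.pi)))
    have h5 := mul_nonneg (abs_nonneg (dotPerp k q / (2 * Real.pi))) hρ
    rw [Complex.norm_ofNat]
    nlinarith
  · simp only [zero_div, norm_zero, zero_mul]
    positivity

lemma exists_norm_stepRate_le (hs : 0 < s) {p q : PosFreq} (hp : p ∈ posBall N)
    (hq : q ∈ posBall N) (σ : Bool) : ∃ C : ℝ, 0 ≤ C ∧ ∀ δ x k,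
      ‖stepRate a s N p q σ δ x k‖ ≤ C * enstrophy a s N x := by
  set D := |dotPerp p.1 (signIf σ q.1) / (2 * Real.pi)|
  have hr1 : 0 ≤ lam a s q.1 / lam a s p.1 :=
    div_nonneg (lam_pos a s q.ne_zero).le (lam_pos a s p.ne_zero).le
  have hr2 : 0 ≤ lam a s p.1 / lam a s q.1 :=
    div_nonneg (lam_pos a s p.ne_zero).le (lam_pos a s q.ne_zero).le
  have hD : 0 ≤ D := abs_nonneg _
  refine ⟨(D + lam a s q.1 / lam a s p.1 * D) + (D + lam a s p.1 / lam a s q.1 * D),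
    by positivity, fun δ x k => ?_⟩
  have h1 := norm_advect_mul_le (a := a) hs hp p.1 (signIf σ q.1) x
  have h2 := norm_advect_mul_le (a := a) hs hq p.1 (signIf σ q.1) x
  have hsingle : ∀ (i : PosFreq) (z : ℂ), ‖(Pi.single i z : PosFreq → ℂ) k‖ ≤ ‖z‖ := by
    intro i z
    rw [Pi.single_apply]
    split_ifs <;> simp
  have h3 := norm_rateFst_le hr1 σ δ (advect N p.1 (signIf σ q.1) x / 2) (x p) (x q)
  have h4 := norm_rateSnd_le hr2 σ δ (advect N p.1 (signIf σ q.1) x / 2) (x p) (x q)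
  refine (norm_add_le _ _).trans ((add_le_add (hsingle _ _) (hsingle _ _)).trans ?_)
  nlinarith [mul_le_mul_of_nonneg_left h1 hr2, mul_le_mul_of_nonneg_left h2 hr1]

lemma enstrophy_add_stepRate {p q : PosFreq} (hp : p ∈ posBall N) (hq : q ∈ posBall N) (σ : Bool)
    (δ : ℝ) (x : PosFreq → ℂ) :
    enstrophy a s N (x + δ • stepRate a s N p q σ δ x) = enstrophy a s N x := by
  by_cases h : dotPerp p.1 q.1 = 0
  · rw [stepRate_eq_zero N σ h, smul_zero, add_zero]
  have hpq := ne_of_dotPerp_ne_zero h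
  have hq' : q ∈ (posBall N).erase p := Finset.mem_erase.2 ⟨hpq.symm, hq⟩
  have key : ∀ y : PosFreq → ℂ, enstrophy a s N y = lam a s p.1 ^ 2 * ‖y p‖ ^ 2 +
      lam a s q.1 ^ 2 * ‖y q‖ ^ 2 +
      ∑ c ∈ ((posBall N).erase p).erase q, lam a s c.1 ^ 2 * ‖y c‖ ^ 2 := fun y => by
    rw [enstrophy, ← Finset.add_sum_erase _ _ hp, ← Finset.add_sum_erase _ _ hq', add_assoc]
  rw [add_stepRate N σ hpq, key, key x]
  congr 1
  · rw [Function.update_of_ne hpq, Function.update_self, Function.update_self]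
    exact norm_sq_swapLin (lam_pos a s p.ne_zero).ne' (lam_pos a s q.ne_zero).ne' σ δ _ (x p, x q)
  · refine Finset.sum_congr rfl fun c hc => ?_
    rw [Finset.mem_erase, Finset.mem_erase] at hc
    rw [Function.update_of_ne hc.1, Function.update_of_ne hc.2.1]

/-- The maps `x ↦ x + δ Φ(δ, x)`, `δ ∈ ℝ`, preserve the Gaussian measure and the enstrophy of the
modes with `k² ≤ N`, and `Φ` is continuous and bounded by a multiple of this enstrophy. Such a
family approximates the flow of the vector field `Φ(0, ·)`. -/
structure IsConservativeStep (a s γ : ℝ) (N : ℕ) (Φ : ℝ → (PosFreq → ℂ) → PosFreq → ℂ) : Prop where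
  continuous : Continuous fun y : ℝ × (PosFreq → ℂ) => Φ y.1 y.2
  measurePreserving : ∀ δ : ℝ, MeasurePreserving (fun x => x + δ • Φ δ x)
    (productGaussian a s γ) (productGaussian a s γ)
  enstrophy_eq : ∀ (δ : ℝ) x, enstrophy a s N (x + δ • Φ δ x) = enstrophy a s N x
  bound : ∃ C : ℝ, 0 ≤ C ∧ ∀ δ x k, ‖Φ δ x k‖ ≤ C * enstrophy a s N x

lemma isConservativeStep_stepRate (hs : 0 < s) (hγ : 0 < γ) {p q : PosFreq} (hp : p ∈ posBall N)
    (hq : q ∈ posBall N) (σ : Bool) : IsConservativeStep a s γ N (stepRate a s N p q σ) :=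
  ⟨continuous_stepRate a s N p q σ, measurePreserving_add_stepRate hγ N p q σ,
    enstrophy_add_stepRate hp hq σ, exists_norm_stepRate_le hs hp hq σ⟩

/-- The composition of two conservative steps: the vector fields add up. -/
lemma IsConservativeStep.comp {Φ Ψ : ℝ → (PosFreq → ℂ) → PosFreq → ℂ}
    (hΦ : IsConservativeStep a s γ N Φ) (hΨ : IsConservativeStep a s γ N Ψ) :
    IsConservativeStep a s γ N fun δ x => Φ δ x + Ψ δ (x + δ • Φ δ x) := by
  have e : ∀ (δ : ℝ) (x : PosFreq → ℂ), x + δ • (Φ δ x + Ψ δ (x + δ • Φ δ x)) =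
      (x + δ • Φ δ x) + δ • Ψ δ (x + δ • Φ δ x) := fun δ x => by rw [smul_add, add_assoc]
  obtain ⟨C, hC0, hC⟩ := hΦ.bound
  obtain ⟨D, hD0, hD⟩ := hΨ.bound
  refine ⟨hΦ.continuous.add (hΨ.continuous.comp (continuous_fst.prodMk
    (continuous_snd.add (continuous_fst.smul hΦ.continuous)))), fun δ => ?_, fun δ x => ?_,
    C + D, add_nonneg hC0 hD0, fun δ x k => ?_⟩
  · simp_rw [e]
    exact (hΨ.measurePreserving δ).comp (hΦ.measurePreserving δ)
  · rw [e, hΨ.enstrophy_eq, hΦ.enstrophy_eq]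
  · refine (norm_add_le _ _).trans ((add_le_add (hC δ x k) (hD δ _ k)).trans (le_of_eq ?_))
    rw [hΦ.enstrophy_eq, add_mul]

lemma exists_isConservativeStep_sum {κ : Type*} (S : Finset κ)
    {Φ : κ → ℝ → (PosFreq → ℂ) → PosFreq → ℂ} (hΦ : ∀ i ∈ S, IsConservativeStep a s γ N (Φ i)) :
    ∃ Ψ, IsConservativeStep a s γ N Ψ ∧ ∀ x, Ψ 0 x = ∑ i ∈ S, Φ i 0 x := by
  classical
  induction S using Finset.induction_on with
  | empty =>
    refine ⟨fun _ _ => 0, ⟨continuous_const, fun δ => ?_, fun δ x => ?_, 0, le_rfl, by simp⟩,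
      by simp⟩
    · simp_rw [smul_zero, add_zero]
      exact MeasurePreserving.id _
    · rw [smul_zero, add_zero]
  | insert i S hi ih =>
    obtain ⟨Ψ, hΨ, hΨ0⟩ := ih fun j hj => hΦ j (Finset.mem_insert_of_mem hj)
    refine ⟨_, (hΦ i (Finset.mem_insert_self _ _)).comp hΨ, fun x => ?_⟩
    rw [zero_smul, add_zero, Finset.sum_insert hi, hΨ0]

/-! ### The truncated vector field -/

lemma conjIf_conj_advect (N : ℕ) (p c : ℤ × ℤ) (σ : Bool) (x : PosFreq → ℂ) :
    conjIf σ ((starRingEnd ℂ) (advect N p (signIf σ c) x)) = -advect N c (signIf σ p) x := by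
  cases σ
  · have h1 := advect_neg_neg N (-c) p x
    rw [neg_neg] at h1
    change (starRingEnd ℂ) ((starRingEnd ℂ) (advect N p (-c) x)) = -advect N c (-p) x
    rw [h1, advect_swap N p (-c), map_neg, neg_neg]
  · change (starRingEnd ℂ) (advect N p c x) = -advect N c p x
    rw [advect_swap N p c, neg_neg]

/-- At time zero the rates for the component `c` form the row `c` of the advection matrix: every
entry is the sum of two halves, from the pairs `(c, q)` and `(q, c)`. -/
lemma sum_stepRate_zero {c : PosFreq} (hc : c ∈ posBall N) (x : PosFreq → ℂ) :
    ∑ p ∈ posBall N, ∑ q ∈ posBall N, ∑ σ : Bool, stepRate a s N p q σ 0 x c =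
      ∑ q ∈ posBall N, ∑ σ : Bool, advect N c.1 (signIf σ q.1) x * (lam a s q.1 / lam a s c.1 : ℝ) *
        fullMode x (signIf σ q.1) := by
  have h1 : ∀ p q σ, stepRate a s N p q σ 0 x c =
      (if c = p then advect N c.1 (signIf σ q.1) x / 2 * (lam a s q.1 / lam a s c.1 : ℝ) *
        fullMode x (signIf σ q.1) else 0) +
      (if c = q then advect N c.1 (signIf σ p.1) x / 2 * (lam a s p.1 / lam a s c.1 : ℝ) *
        fullMode x (signIf σ p.1) else 0) := by
    intro p q σ
    simp only [stepRate, Pi.add_apply, Pi.single_apply]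
    congr 1
    · split_ifs with h
      · subst h
        simp only [rateFst, cosRate_zero, sinRate_zero, fullMode_signIf]
        push_cast
        ring
      · rfl
    · split_ifs with h
      · subst h
        simp only [rateSnd, cosRate_zero, sinRate_zero, fullMode_signIf, map_div₀,
          conjIf_conj_advect, map_ofNat]
        push_cast
        ring
      · rfl
  simp_rw [h1, Finset.sum_add_distrib]
  have h2 : ∑ p ∈ posBall N, ∑ q ∈ posBall N, ∑ σ : Bool,
      (if c = p then advect N c.1 (signIf σ q.1) x / 2 * (lam a s q.1 / lam a s c.1 : ℝ) *
        fullMode x (signIf σ q.1) else 0) = ∑ q ∈ posBall N, ∑ σ : Bool,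
      advect N c.1 (signIf σ q.1) x / 2 * (lam a s q.1 / lam a s c.1 : ℝ) *
        fullMode x (signIf σ q.1) := by
    rw [Finset.sum_eq_single_of_mem c hc fun p _ hp => by simp [hp.symm]]
    simp
  have h3 : ∑ p ∈ posBall N, ∑ q ∈ posBall N, ∑ σ : Bool,
      (if c = q then advect N c.1 (signIf σ p.1) x / 2 * (lam a s p.1 / lam a s c.1 : ℝ) *
        fullMode x (signIf σ p.1) else 0) = ∑ p ∈ posBall N, ∑ σ : Bool,
      advect N c.1 (signIf σ p.1) x / 2 * (lam a s p.1 / lam a s c.1 : ℝ) *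
        fullMode x (signIf σ p.1) := by
    refine Finset.sum_congr rfl fun p _ => ?_
    rw [Finset.sum_eq_single_of_mem c hc fun q _ hq => by simp [hq.symm]]
    simp
  rw [h2, h3, ← Finset.sum_add_distrib]
  refine Finset.sum_congr rfl fun q _ => ?_
  rw [← Finset.sum_add_distrib]
  exact Finset.sum_congr rfl fun σ _ => by ring

lemma sum_freqBall_eq (N : ℕ) (f : ℤ × ℤ → ℂ) (hf : f 0 = 0) :
    ∑ h ∈ freqBall N, f h = ∑ q ∈ posBall N, ∑ σ : Bool, f (signIf σ q.1) := by
  classical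
  have h1 : ∑ q ∈ posBall N, ∑ σ : Bool, f (signIf σ q.1) =
      ∑ q ∈ posBall N, (f q.1 + f (-q.1)) :=
    Finset.sum_congr rfl fun q _ => by rw [Fintype.sum_bool]; rfl
  have h2 : ∑ q ∈ posBall N, (f q.1 + f (-q.1)) =
      ∑ h ∈ (freqBall N).filter IsPos, (f h + f (-h)) := by
    unfold posBall
    rw [← Finset.sum_subtype_eq_sum_filter]
  have h3 : ∑ h ∈ (freqBall N).filter IsPos, f (-h) =
      ∑ h ∈ (freqBall N).filter fun h => ¬ IsPos h, f h := by
    refine Finset.sum_bij_ne_zero (fun h _ _ => -h) (fun h hh _ => ?_)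
      (fun _ _ _ _ _ _ e => neg_injective e) (fun h hh h0 => ?_) (fun _ _ _ => rfl)
    · rw [Finset.mem_filter, mem_freqBall] at hh ⊢
      exact ⟨by rw [freqSq_neg]; exact hh.1, not_isPos_neg hh.2⟩
    · rw [Finset.mem_filter, mem_freqBall] at hh
      have hpos : IsPos (-h) := by
        rcases isPos_trichotomy h with rfl | h1 | h1
        · exact absurd hf h0
        · exact absurd h1 hh.2
        · exact h1
      refine ⟨-h, ?_, by rwa [neg_neg], neg_neg h⟩
      rw [Finset.mem_filter, mem_freqBall]
      exact ⟨by rw [freqSq_neg]; exact hh.1, hpos⟩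
  rw [h1, h2, Finset.sum_add_distrib, h3]
  exact (Finset.sum_filter_add_sum_filter_not _ _ _).symm

/-- The finite set of the `h` such that `h² ≤ N` and `(k - h)² ≤ N`. -/
def pairBall (N : ℕ) (k : ℤ × ℤ) : Finset (ℤ × ℤ) :=
  (freqBall N).filter fun h => freqSq (k - h) ≤ N

/-- The sum of the rates at time zero is the advection form of the vector field, which is not
symmetric in `h` and `k - h`. Its symmetrization has the coefficients `α_{h,k}`, and the two sums
agree because `pairBall` is invariant under `h ↦ k - h`. -/
lemma sum_stepRate_zero_eq_quadSum {c : PosFreq} (hc : c ∈ posBall N) (x : PosFreq → ℂ) :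
    ∑ p ∈ posBall N, ∑ q ∈ posBall N, ∑ σ : Bool, stepRate a s N p q σ 0 x c =
      quadSum a s c.1 (pairBall N c.1) x := by
  set G : ℤ × ℤ → ℂ := fun h => ((-dotPerp (c.1 - h) h * freqSq h * symbolA a s h /
    (2 * Real.pi * freqSq c.1 * symbolA a s c.1) : ℝ) : ℂ) * (fullMode x h * fullMode x (c.1 - h))
    with hG
  have hsig : ∀ (σ : Bool) (q : ℤ × ℤ), lam a s (signIf σ q) = lam a s q := fun σ q => by
    cases σ
    · exact lam_neg a s q
    · rfl
  have h1 : ∑ q ∈ posBall N, ∑ σ : Bool, advect N c.1 (signIf σ q.1) x *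
      (lam a s q.1 / lam a s c.1 : ℝ) * fullMode x (signIf σ q.1) =
      ∑ h ∈ freqBall N, advect N c.1 h x * (lam a s h / lam a s c.1 : ℝ) * fullMode x h := by
    rw [sum_freqBall_eq N _ (by simp [fullMode_zero])]
    simp_rw [hsig]
  have h2 : ∑ h ∈ freqBall N, advect N c.1 h x * (lam a s h / lam a s c.1 : ℝ) * fullMode x h =
      ∑ h ∈ pairBall N c.1, G h := by
    rw [pairBall, Finset.sum_filter]
    refine Finset.sum_congr rfl fun h _ => ?_
    unfold advect
    split_ifs
    · have hd : dotPerp (c.1 - h) h = dotPerp c.1 h := by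
        unfold dotPerp; push_cast [Prod.fst_sub, Prod.snd_sub]; ring
      simp only [hG, hd, lam]
      push_cast
      ring
    · simp
  have h3 : ∑ h ∈ pairBall N c.1, G (c.1 - h) = ∑ h ∈ pairBall N c.1, G h := by
    have hmem : ∀ h ∈ pairBall N c.1, c.1 - h ∈ pairBall N c.1 := fun h hh => by
      rw [pairBall, Finset.mem_filter, mem_freqBall] at hh ⊢
      rw [sub_sub_cancel]
      exact hh.symm
    exact Finset.sum_nbij' (fun h => c.1 - h) (fun h => c.1 - h) hmem hmem
      (fun h _ => sub_sub_cancel _ _) (fun h _ => sub_sub_cancel _ _) fun h _ => rfl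
  have h4 : ∀ h, quadTerm a s c.1 h x = (G (c.1 - h) + G h) / 2 := by
    intro h
    unfold quadTerm
    rw [coeffB_eq_symmetrization a s h (c.1 - h) c.1 (by abel)]
    simp only [hG, sub_sub_cancel]
    push_cast
    ring
  rw [sum_stepRate_zero hc, h1, h2, quadSum]
  simp_rw [h4]
  rw [← Finset.sum_div, Finset.sum_add_distrib, h3]
  ring

/-! ### Convergence of the increments -/

section Increments

variable {a s γ : ℝ} {N : ℕ}

lemma lintegral_enstrophy_sq_lt_top (hγ : 0 < γ) (C : ℝ) :
    ∫⁻ x, ENNReal.ofReal (C * enstrophy a s N x ^ 2) ∂(productGaussian a s γ) < ⊤ := by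
  have h1 : ∀ x : PosFreq → ℂ, ENNReal.ofReal (C * enstrophy a s N x ^ 2) ≤
      ∑ c ∈ posBall N, ENNReal.ofReal (|C| * (posBall N).card * lam a s c.1 ^ 4) * ‖x c‖ₑ ^ 4 := by
    intro x
    have h2 : enstrophy a s N x ^ 2 ≤ (posBall N).card *
        ∑ c ∈ posBall N, (lam a s c.1 ^ 2 * ‖x c‖ ^ 2) ^ 2 := sq_sum_le_card_mul_sum_sq
    have h3 : C * enstrophy a s N x ^ 2 ≤
        ∑ c ∈ posBall N, |C| * (posBall N).card * lam a s c.1 ^ 4 * ‖x c‖ ^ 4 := by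
      refine (mul_le_mul (le_abs_self C) h2 (sq_nonneg _) (abs_nonneg C)).trans (le_of_eq ?_)
      rw [← mul_assoc, Finset.mul_sum]
      exact Finset.sum_congr rfl fun c _ => by ring
    refine (ENNReal.ofReal_le_ofReal h3).trans (le_of_eq ?_)
    rw [ENNReal.ofReal_sum_of_nonneg fun c _ => by positivity]
    refine Finset.sum_congr rfl fun c _ => ?_
    rw [ENNReal.ofReal_mul (by positivity), ENNReal.ofReal_pow (norm_nonneg _), ofReal_norm]
  refine (lintegral_mono h1).trans_lt ?_
  have hm : ∀ c : PosFreq, Measurable fun x : PosFreq → ℂ => ‖x c‖ₑ ^ 4 := fun c =>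
    (measurable_pi_apply c).enorm.pow_const 4
  rw [lintegral_finsetSum _ fun c _ => (hm c).const_mul _]
  refine ENNReal.sum_lt_top.2 fun c _ => ?_
  rw [lintegral_const_mul _ (hm c)]
  have h4 := lintegral_enorm_pow_four (a := a) (s := s) hγ c.ne_zero
  simp only [fullMode_pos] at h4
  rw [h4]
  exact ENNReal.mul_lt_top ENNReal.ofReal_lt_top ENNReal.ofReal_lt_top

lemma IsConservativeStep.tendsto_eLpNorm {Φ : ℝ → (PosFreq → ℂ) → PosFreq → ℂ}
    (hΦ : IsConservativeStep a s γ N Φ) (hγ : 0 < γ) {δ : ℕ → ℝ} (hδ : Tendsto δ atTop (𝓝 0))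
    (k : PosFreq) : Tendsto (fun n => eLpNorm (fun x => Φ (δ n) x k - Φ 0 x k) 2
      (productGaussian a s γ)) atTop (𝓝 0) := by
  obtain ⟨C, hC0, hC⟩ := hΦ.bound
  have hcont : ∀ d, Continuous fun x => Φ d x k := fun d =>
    (continuous_apply k).comp (hΦ.continuous.comp (continuous_const.prodMk continuous_id))
  refine tendsto_zero_of_sq ?_
  simp_rw [eLpNorm_two_sq]
  have h := tendsto_lintegral_of_dominated_convergence (μ := productGaussian a s γ)
    (F := fun n x => ‖Φ (δ n) x k - Φ 0 x k‖ₑ ^ 2) (f := fun _ => 0)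
    (fun x => ENNReal.ofReal ((2 * C) ^ 2 * enstrophy a s N x ^ 2))
    (fun n => ((hcont _).sub (hcont _)).measurable.enorm.pow_const 2)
    (fun n => Eventually.of_forall fun x => ?_) (lintegral_enstrophy_sq_lt_top hγ _).ne
    (Eventually.of_forall fun x => ?_)
  · simpa using h
  · beta_reduce
    rw [← ofReal_norm, ← ENNReal.ofReal_pow (norm_nonneg _)]
    refine ENNReal.ofReal_le_ofReal ?_
    rw [← mul_pow]
    refine pow_le_pow_left₀ (norm_nonneg _) ((norm_sub_le _ _).trans ?_) 2
    linarith [hC (δ n) x k, hC 0 x k]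
  · have h1 : Continuous fun d => Φ d x k :=
      (continuous_apply k).comp (hΦ.continuous.comp (continuous_id.prodMk continuous_const))
    have h2 : Tendsto (fun n => Φ (δ n) x k - Φ 0 x k) atTop (𝓝 0) := by
      simpa using ((h1.tendsto 0).comp hδ).sub_const (Φ 0 x k)
    have h3 := ENNReal.Tendsto.pow (n := 2) h2.enorm
    simpa using h3

lemma tendsto_pairBall (k : ℤ × ℤ) : Tendsto (fun N => pairBall N k) atTop atTop := by
  refine tendsto_atTop_finset_of_monotone (fun m n hmn h hh => ?_) fun h =>
    ⟨max ⌈freqSq h⌉₊ ⌈freqSq (k - h)⌉₊, ?_⟩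
  · rw [pairBall, Finset.mem_filter, mem_freqBall] at hh ⊢
    have : (m : ℝ) ≤ n := by exact_mod_cast hmn
    exact ⟨hh.1.trans this, hh.2.trans this⟩
  · rw [pairBall, Finset.mem_filter, mem_freqBall]
    push_cast
    exact ⟨(Nat.le_ceil _).trans (le_max_left _ _), (Nat.le_ceil _).trans (le_max_right _ _)⟩

/-- There are transformations that preserve the Gaussian measure, and whose increments over a time
step `2⁻ʲ` are asymptotic in `L²` to those of the averaged-Euler vector field. -/
theorem exists_measurePreserving_approximation (hs : 0 < s) (hγ : 0 < γ) :
    ∃ (T : ℕ → (PosFreq → ℂ) → PosFreq → ℂ) (j : ℕ → ℕ),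
      (∀ n, MeasurePreserving (T n) (productGaussian a s γ) (productGaussian a s γ)) ∧
      (∀ n, n ≤ j n) ∧
      ∀ k, Tendsto (fun n => eLpNorm (fun x => (((2 : ℝ) ^ j n)⁻¹)⁻¹ • (T n x k - x k) -
        vectorB a s k x) 2 (productGaussian a s γ)) atTop (𝓝 0) := by
  set μ := productGaussian a s γ
  have hstep : ∀ N, ∃ Φ, IsConservativeStep a s γ N Φ ∧ ∀ c ∈ posBall N, ∀ x,
      Φ 0 x c = quadSum a s c.1 (pairBall N c.1) x := by
    intro N
    obtain ⟨Φ, hΦ, hΦ0⟩ := exists_isConservativeStep_sum (a := a) (s := s) (γ := γ) (N := N)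
      (posBall N ×ˢ posBall N ×ˢ (Finset.univ : Finset Bool))
      (Φ := fun i => stepRate a s N i.1 i.2.1 i.2.2) (fun i hi => by
        rw [Finset.mem_product, Finset.mem_product] at hi
        exact isConservativeStep_stepRate hs hγ hi.1 hi.2.1 i.2.2)
    refine ⟨Φ, hΦ, fun c hc x => ?_⟩
    rw [hΦ0, ← sum_stepRate_zero_eq_quadSum hc, Finset.sum_product, Finset.sum_apply]
    refine Finset.sum_congr rfl fun p _ => ?_
    rw [Finset.sum_product, Finset.sum_apply]
    refine Finset.sum_congr rfl fun q _ => ?_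
    rw [Finset.sum_apply]
  choose Φ hΦ hΦ0 using hstep
  have h2 : Tendsto (fun j : ℕ => ((2 : ℝ) ^ j)⁻¹) atTop (𝓝 0) :=
    tendsto_inv_atTop_zero.comp (tendsto_pow_atTop_atTop_of_one_lt (by norm_num))
  have hsel : ∀ N : ℕ, ∃ j, N ≤ j ∧ ∀ c ∈ posBall N,
      eLpNorm (fun x => Φ N ((2 : ℝ) ^ j)⁻¹ x c - Φ N 0 x c) 2 μ ≤
        ENNReal.ofReal (1 / (N + 1)) := by
    intro N
    have h3 : ∀ᶠ j in atTop, ∀ c ∈ posBall N,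
        eLpNorm (fun x => Φ N ((2 : ℝ) ^ j)⁻¹ x c - Φ N 0 x c) 2 μ ≤
          ENNReal.ofReal (1 / (N + 1)) := by
      refine (Filter.eventually_all_finset _).2 fun c _ => ?_
      exact ((hΦ N).tendsto_eLpNorm hγ h2 c).eventually_le_const
        (ENNReal.ofReal_pos.2 (by positivity))
    obtain ⟨j, hj1, hj2⟩ := ((eventually_ge_atTop N).and h3).exists
    exact ⟨j, hj1, hj2⟩
  choose j hj hjs using hsel
  refine ⟨fun n x => x + ((2 : ℝ) ^ j n)⁻¹ • Φ n ((2 : ℝ) ^ j n)⁻¹ x, j,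
    fun n => (hΦ n).measurePreserving _, hj, fun k => ?_⟩
  have h4 : Tendsto (fun n : ℕ => ENNReal.ofReal (1 / ((n : ℝ) + 1)) +
      eLpNorm (fun x => quadSum a s k.1 (pairBall n k.1) x - vectorB a s k x) 2 μ) atTop (𝓝 0) := by
    have h5 := ENNReal.tendsto_ofReal (tendsto_one_div_add_atTop_nhds_zero_nat (𝕜 := ℝ))
    have h6 := tendsto_eLpNorm_quadSum_sub_vectorB (a := a) hs hγ k (tendsto_pairBall k.1)
    simpa using h5.add h6
  refine tendsto_of_tendsto_of_tendsto_of_le_of_le' tendsto_const_nhds h4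
    (Eventually.of_forall fun _ => zero_le) ?_
  filter_upwards [eventually_ge_atTop ⌈freqSq k.1⌉₊] with n hn
  have hk : k ∈ posBall n := mem_posBall.2 ((Nat.le_ceil _).trans (by exact_mod_cast hn))
  have hcont : ∀ d, Continuous fun x => Φ n d x k := fun d =>
    (continuous_apply k).comp ((hΦ n).continuous.comp (continuous_const.prodMk continuous_id))
  have e : (fun x : PosFreq → ℂ => (((2 : ℝ) ^ j n)⁻¹)⁻¹ •
      ((x + ((2 : ℝ) ^ j n)⁻¹ • Φ n ((2 : ℝ) ^ j n)⁻¹ x) k - x k) - vectorB a s k x) =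
      (fun x => Φ n ((2 : ℝ) ^ j n)⁻¹ x k - Φ n 0 x k) +
        fun x => quadSum a s k.1 (pairBall n k.1) x - vectorB a s k x := by
    funext x
    have h0 : ((2 : ℝ) ^ j n)⁻¹ ≠ 0 := by positivity
    rw [Pi.add_apply, Pi.add_apply, Pi.smul_apply, add_sub_cancel_left, inv_smul_smul₀ h0,
      hΦ0 n k hk x]
    ring
  rw [e]
  refine (eLpNorm_add_le ((hcont _).sub (hcont _)).measurable.aestronglyMeasurable
    ((continuous_quadSum _ _).measurable.sub (measurable_vectorB k)).aestronglyMeasurable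
    (by norm_num)).trans (add_le_add (hjs n k hk) le_rfl)

end Increments

/-! ### Paths in the Sobolev space -/

section Paths

variable {a s p γ : ℝ}

/-- The element of `H^{p,s}` with given Fourier coefficients. -/
def ofModes (v : PosFreq → ℂ) (hv : v ∈ sobolevSubmodule a s p) : Sobolev a s p := ⟨v, hv⟩

lemma modes_ofModes (v : PosFreq → ℂ) (hv : v ∈ sobolevSubmodule a s p) :
    modes (ofModes v hv) = v := rfl

lemma modes_sub (v w : Sobolev a s p) : modes (v - w) = modes v - modes w := rfl

lemma modes_zero : modes (0 : Sobolev a s p) = 0 := rfl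

/-- A path that is continuous coordinatewise, and locally dominated by a family of finite norm, is
continuous in `H^{p,s}`. -/
lemma continuous_ofModes {u : ℝ → PosFreq → ℂ} (hu : Continuous u)
    (hdom : ∀ T : ℕ, ∃ M : PosFreq → ℝ, (Summable fun k => weight a s p k * M k) ∧
      ∀ t : ℝ, |t| ≤ T → ∀ k, ‖u t k‖ ^ 2 ≤ M k)
    (hmem : ∀ t, u t ∈ sobolevSubmodule a s p) : Continuous fun t => ofModes (u t) (hmem t) := by
  refine continuous_iff_continuousAt.2 fun t₀ => ?_
  obtain ⟨M, hM, hMu⟩ := hdom (⌈|t₀|⌉₊ + 1)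
  have hev := eventually_abs_le_nat t₀
  have h1 : Tendsto (fun t => ∑' k, weight a s p k * ‖u t k - u t₀ k‖ ^ 2) (𝓝 t₀)
      (𝓝 (∑' _ : PosFreq, (0 : ℝ))) := by
    refine tendsto_tsum_of_dominated_convergence (bound := fun k => 4 * (weight a s p k * M k))
      (hM.mul_left 4) (fun k => ?_) ?_
    · have hk : Continuous fun t => weight a s p k * ‖u t k - u t₀ k‖ ^ 2 := by fun_prop
      simpa using hk.tendsto t₀
    · filter_upwards [hev] with t ht k
      have h2 := hMu t ht k
      have h3 := hMu t₀ hev.self_of_nhds k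
      have h4 := norm_sub_le (u t k) (u t₀ k)
      have hw := weight_pos a s p k
      have h5 : ‖u t k - u t₀ k‖ ^ 2 ≤ 4 * M k := by
        nlinarith [norm_nonneg (u t k - u t₀ k), norm_nonneg (u t k), norm_nonneg (u t₀ k),
          sq_nonneg (‖u t k‖ - ‖u t₀ k‖)]
      rw [Real.norm_of_nonneg (by positivity)]
      nlinarith [mul_le_mul_of_nonneg_left h5 hw.le]
  rw [tsum_zero] at h1
  refine tendsto_iff_norm_sub_tendsto_zero.2 ?_
  have h2 := (Real.continuous_sqrt.tendsto 0).comp h1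
  rw [Real.sqrt_zero] at h2
  refine h2.congr fun t => ?_
  have h3 := norm_sq_eq (ofModes (u t) (hmem t) - ofModes (u t₀) (hmem t₀))
  rw [modes_sub, modes_ofModes, modes_ofModes] at h3
  rw [Function.comp_apply, ← Real.sqrt_sq (norm_nonneg _), h3]
  rfl

/-- The integral of `|B_k|²` along a path, over the time interval `[-T, T]`. -/
def actionB (a s : ℝ) (k : PosFreq) (T : ℝ) (u : C(ℝ, PosFreq → ℂ)) : ENNReal :=
  ∫⁻ r in Set.Ioc (-T) T, ‖vectorB a s k (u r)‖ₑ ^ 2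

lemma measurable_vectorB_path (k : PosFreq) :
    Measurable fun q : C(ℝ, PosFreq → ℂ) × ℝ => vectorB a s k (q.1 q.2) :=
  (measurable_vectorB k).comp measurable_path_eval

lemma measurable_vectorB_comp (k : PosFreq) (u : C(ℝ, PosFreq → ℂ)) :
    Measurable fun r => vectorB a s k (u r) :=
  (measurable_vectorB k).comp u.continuous.measurable

lemma measurable_actionB (k : PosFreq) (T : ℝ) : Measurable (actionB a s k T) :=
  Measurable.lintegral_prod_right'
    (f := fun q : C(ℝ, PosFreq → ℂ) × ℝ => ‖vectorB a s k (q.1 q.2)‖ₑ ^ 2)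
    ((measurable_vectorB_path k).enorm.pow_const 2)

lemma uIoc_subset_Ioc {T x y : ℝ} (hx : |x| ≤ T) (hy : |y| ≤ T) :
    Set.uIoc x y ⊆ Set.Ioc (-T) T :=
  Set.Ioc_subset_Ioc (le_min (abs_le.1 hx).1 (abs_le.1 hy).1)
    (max_le (abs_le.1 hx).2 (abs_le.1 hy).2)

lemma intervalIntegrable_vectorB {k : PosFreq} {u : C(ℝ, PosFreq → ℂ)}
    (h : ∀ T : ℕ, actionB a s k T u ≠ ⊤) (x y : ℝ) :
    IntervalIntegrable (fun r => vectorB a s k (u r)) volume x y := by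
  obtain ⟨T, hT⟩ := exists_nat_ge (max |x| |y|)
  rw [intervalIntegrable_iff]
  refine IntegrableOn.mono_set ?_
    (uIoc_subset_Ioc ((le_max_left _ _).trans hT) ((le_max_right _ _).trans hT))
  have hm : MemLp (fun r => vectorB a s k (u r)) 2 (volume.restrict (Set.Ioc (-(T : ℝ)) T)) := by
    refine ⟨(measurable_vectorB_comp k u).aestronglyMeasurable, ?_⟩
    have h1 : actionB a s k T u < ⊤ := (h T).lt_top
    rw [actionB, ← eLpNorm_two_sq] at h1
    exact (ENNReal.pow_lt_top_iff.1 h1).resolve_right (by norm_num)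
  exact hm.integrable (by norm_num)

/-- Along a solution the coordinates are locally dominated by their initial values and the
integrals of `|B_k|²`. -/
lemma norm_sq_le_of_integral_eq {k : PosFreq} {u : C(ℝ, PosFreq → ℂ)} {T t : ℝ} (ht : |t| ≤ T)
    (hfin : actionB a s k T u ≠ ⊤)
    (heq : u t k = u 0 k + ∫ r in (0 : ℝ)..t, vectorB a s k (u r)) :
    ‖u t k‖ ^ 2 ≤ 2 * ‖u 0 k‖ ^ 2 + 2 * (T * (actionB a s k T u).toReal) := by
  have hT : 0 ≤ T := (abs_nonneg t).trans ht
  set I := ∫ r in (0 : ℝ)..t, vectorB a s k (u r)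
  have h1 : ‖I‖ₑ ^ 2 ≤ ENNReal.ofReal T * actionB a s k T u := by
    refine (sq_enorm_intervalIntegral_le (measurable_vectorB_comp k u) 0 t).trans ?_
    rw [sub_zero]
    exact mul_le_mul' (ENNReal.ofReal_le_ofReal ht)
      (lintegral_mono_set (uIoc_subset_Ioc (by simpa using hT) ht))
  have h2 : ‖I‖ ^ 2 ≤ T * (actionB a s k T u).toReal := by
    rw [← ENNReal.ofReal_toReal hfin, ← ENNReal.ofReal_mul hT, ← ofReal_norm,
      ← ENNReal.ofReal_pow (norm_nonneg _),
      ENNReal.ofReal_le_ofReal_iff (by positivity)] at h1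
    exact h1
  rw [heq]
  have h3 := norm_add_le (u 0 k) I
  nlinarith [norm_nonneg (u 0 k + I), norm_nonneg (u 0 k), norm_nonneg I,
    sq_nonneg (‖u 0 k‖ - ‖I‖)]

variable {Q : Measure C(ℝ, PosFreq → ℂ)}

/-- If the law of a process at all times is the Gaussian measure, the sums for `B_k` converge
almost surely at almost all times. -/
lemma ae_ae_tendsto_truncB [SFinite Q] (hs : 0 < s) (hγ : 0 < γ)
    (hQ : ∀ t, MeasurePreserving (fun u : C(ℝ, PosFreq → ℂ) => u t) Q (productGaussian a s γ)) :
    ∀ᵐ u ∂Q, ∀ k, ∀ᵐ r : ℝ, Tendsto (fun n : ℕ => truncB a s n k (u r)) atTop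
      (𝓝 (vectorB a s k (u r))) := by
  refine ae_all_iff.2 fun k => ?_
  obtain ⟨A, hA, hAm, hAlim⟩ :=
    (ae_tendsto_truncB (a := a) hs hγ k).exists_measurable_mem
  have h1 : ∀ᵐ r : ℝ, ∀ᵐ u ∂Q, u r ∈ A :=
    Eventually.of_forall fun r => (hQ r).quasiMeasurePreserving.ae hA
  have hm : MeasurableSet {q : C(ℝ, PosFreq → ℂ) × ℝ | q.1 q.2 ∈ A} :=
    measurable_path_eval hAm
  filter_upwards [(Measure.ae_ae_comm hm).2 h1] with u hu
  filter_upwards [hu] with r hr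
  exact hAlim _ hr

lemma lintegral_actionB_le [SFinite Q] (hs : 0 < s) (hγ : 0 < γ)
    (hQ : ∀ t, MeasurePreserving (fun u : C(ℝ, PosFreq → ℂ) => u t) Q (productGaussian a s γ))
    (k : PosFreq) (T : ℝ) : ∫⁻ u, actionB a s k T u ∂Q ≤
      ENNReal.ofReal (2 * momentConst s γ * (2 * ∑' h : ℤ × ℤ, (freqSq h)⁻¹ ^ 2)) *
        volume (Set.Ioc (-T) T) := by
  unfold actionB
  rw [lintegral_lintegral_swap ((measurable_vectorB_path k).enorm.pow_const 2).aemeasurable]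
  have h1 : ∀ r, ∫⁻ u, ‖vectorB a s k (u r)‖ₑ ^ 2 ∂Q ≤
      ENNReal.ofReal (2 * momentConst s γ * (2 * ∑' h : ℤ × ℤ, (freqSq h)⁻¹ ^ 2)) := fun r => by
    refine le_trans (le_of_eq ?_) (lintegral_vectorB_le (a := a) hs hγ k)
    exact (hQ r).lintegral_comp (f := fun v => ‖vectorB a s k v‖ₑ ^ 2)
      ((measurable_vectorB k).enorm.pow_const 2)
  refine (lintegral_mono h1).trans (le_of_eq ?_)
  rw [lintegral_const, Measure.restrict_apply_univ]

/-- Almost all paths are locally dominated by a family of finite norm in `H^{p,s}`, `p < -1`. -/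
lemma ae_tsum_weight_lt_top [SFinite Q] (hs : 0 < s) (hγ : 0 < γ) (hp : p < -1)
    (hQ : ∀ t, MeasurePreserving (fun u : C(ℝ, PosFreq → ℂ) => u t) Q (productGaussian a s γ)) :
    ∀ᵐ u ∂Q, ∀ T : ℕ, ∑' k, ENNReal.ofReal (weight a s p k) *
      (‖u 0 k‖ₑ ^ 2 + actionB a s k T u) < ⊤ := by
  refine ae_all_iff.2 fun T => ?_
  have h0 : ∀ k, Measurable fun u : C(ℝ, PosFreq → ℂ) => ‖u 0 k‖ₑ ^ 2 := fun k =>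
    ((measurable_pi_apply k).comp (hQ 0).measurable).enorm.pow_const 2
  have hm : ∀ k, Measurable fun u : C(ℝ, PosFreq → ℂ) => ENNReal.ofReal (weight a s p k) *
      (‖u 0 k‖ₑ ^ 2 + actionB a s k T u) := fun k =>
    ((h0 k).fun_add (measurable_actionB k T)).const_mul _
  refine ae_lt_top (Measurable.tsum hm) ?_
  rw [lintegral_tsum fun k => (hm k).aemeasurable]
  set C := ENNReal.ofReal (3 / γ) +
    ENNReal.ofReal (2 * momentConst s γ * (2 * ∑' h : ℤ × ℤ, (freqSq h)⁻¹ ^ 2)) *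
      volume (Set.Ioc (-(T : ℝ)) T) with hC
  have hCt : C ≠ ⊤ := by
    rw [hC, Real.volume_Ioc]
    exact ENNReal.add_ne_top.2 ⟨ENNReal.ofReal_ne_top,
      ENNReal.mul_ne_top ENNReal.ofReal_ne_top ENNReal.ofReal_ne_top⟩
  have hle : ∀ k, ∫⁻ u, ENNReal.ofReal (weight a s p k) *
      (‖u 0 k‖ₑ ^ 2 + actionB a s k T u) ∂Q ≤ ENNReal.ofReal (weight a s p k) * C := by
    intro k
    rw [lintegral_const_mul _ ((h0 k).fun_add (measurable_actionB k T)),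
      lintegral_add_left (h0 k)]
    refine mul_le_mul_right (add_le_add ?_ (lintegral_actionB_le hs hγ hQ k T)) _
    refine le_trans (le_of_eq ?_) (lintegral_enorm_sq_mode_le (a := a) hs hγ k)
    exact (hQ 0).lintegral_comp (f := fun v => ‖v k‖ₑ ^ 2)
      ((measurable_pi_apply k).enorm.pow_const 2)
  refine ne_top_of_le_ne_top ?_ (ENNReal.tsum_le_tsum hle)
  rw [ENNReal.tsum_mul_right, ← ENNReal.ofReal_tsum_of_nonneg (fun k => (weight_pos a s p k).le)
    (summable_weight a hs hp)]
  exact ENNReal.mul_ne_top ENNReal.ofReal_ne_top hCt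

lemma actionB_ne_top {u : C(ℝ, PosFreq → ℂ)} {T : ℕ}
    (h : ∑' k, ENNReal.ofReal (weight a s p k) * (‖u 0 k‖ₑ ^ 2 + actionB a s k T u) < ⊤)
    (k : PosFreq) : actionB a s k T u ≠ ⊤ := by
  intro htop
  have h1 := ENNReal.ne_top_of_tsum_ne_top h.ne k
  rw [htop, add_top, ENNReal.mul_top (ENNReal.ofReal_pos.2 (weight_pos a s p k)).ne'] at h1
  exact h1 rfl

/-- The integral equation holds almost surely at all times simultaneously. -/
lemma ae_integral_eq
    (hint : ∀ᵐ u ∂Q, ∀ (k : PosFreq) (T : ℕ), actionB a s k T u ≠ ⊤)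
    (heq : ∀ (k : PosFreq) (x y : ℝ), x ≤ y → ∀ᵐ u ∂Q,
      u y k - u x k = ∫ r in x..y, vectorB a s k (u r)) :
    ∀ᵐ u ∂Q, ∀ (k : PosFreq) (t : ℝ), u t k = u 0 k + ∫ r in (0 : ℝ)..t, vectorB a s k (u r) := by
  have h1 : ∀ᵐ u ∂Q, ∀ (k : PosFreq) (q : ℚ),
      u (q : ℝ) k = u 0 k + ∫ r in (0 : ℝ)..q, vectorB a s k (u r) := by
    refine ae_all_iff.2 fun k => ae_all_iff.2 fun q => ?_
    rcases le_total 0 (q : ℝ) with hq | hq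
    · filter_upwards [heq k 0 q hq] with u hu
      rw [← hu]; ring
    · filter_upwards [heq k q 0 hq] with u hu
      rw [intervalIntegral.integral_symm, ← hu]; ring
  filter_upwards [hint, h1] with u hu1 hu2 k
  have hc1 : Continuous fun t => u t k := (continuous_apply k).comp u.continuous
  have hc2 : Continuous fun t => u 0 k + ∫ r in (0 : ℝ)..t, vectorB a s k (u r) :=
    continuous_const.add
      (intervalIntegral.continuous_primitive (intervalIntegrable_vectorB (hu1 k)) 0)
  exact congrFun (Rat.denseRange_cast.equalizer hc1 hc2 (funext (hu2 k)))

/-- A path that solves the integral equation, with finite weighted sums of initial values and of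
integrals of `|B_k|²`, is locally dominated by a family of finite norm. -/
lemma exists_dominating_family {u : C(ℝ, PosFreq → ℂ)}
    (hfin : ∀ T : ℕ, ∑' k, ENNReal.ofReal (weight a s p k) *
      (‖u 0 k‖ₑ ^ 2 + actionB a s k T u) < ⊤)
    (heq : ∀ (k : PosFreq) (t : ℝ), u t k = u 0 k + ∫ r in (0 : ℝ)..t, vectorB a s k (u r))
    (T : ℕ) : ∃ M : PosFreq → ℝ, (Summable fun k => weight a s p k * M k) ∧
      ∀ t : ℝ, |t| ≤ T → ∀ k, ‖u t k‖ ^ 2 ≤ M k := by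
  refine ⟨fun k => 2 * ‖u 0 k‖ ^ 2 + 2 * (T * (actionB a s k T u).toReal), ?_, fun t ht k =>
    norm_sq_le_of_integral_eq ht (actionB_ne_top (hfin T) k) (heq k t)⟩
  have h1 := ENNReal.summable_toReal (hfin T).ne
  have h2 : ∀ k, (ENNReal.ofReal (weight a s p k) * (‖u 0 k‖ₑ ^ 2 + actionB a s k T u)).toReal =
      weight a s p k * (‖u 0 k‖ ^ 2 + (actionB a s k T u).toReal) := by
    intro k
    rw [ENNReal.toReal_mul, ENNReal.toReal_ofReal (weight_pos a s p k).le,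
      ENNReal.toReal_add (by simp) (actionB_ne_top (hfin T) k), ENNReal.toReal_pow,
      toReal_enorm]
  simp_rw [h2] at h1
  refine Summable.of_nonneg_of_le (fun k => ?_) (fun k => ?_) (h1.mul_left (2 * (1 + (T : ℝ))))
  · have := weight_pos a s p k
    positivity
  · have hw := weight_pos a s p k
    have h3 : 0 ≤ (actionB a s k T u).toReal := ENNReal.toReal_nonneg
    have h4 : (0 : ℝ) ≤ T := Nat.cast_nonneg T
    rw [mul_left_comm]
    refine mul_le_mul_of_nonneg_left ?_ hw.le
    nlinarith [mul_nonneg h4 (sq_nonneg ‖u 0 k‖)]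

lemma enstrophyMeasure_eq_map {Ω : Type*} [MeasurableSpace Ω] {P : Measure Ω}
    {V : Ω → Sobolev a s p} (hV : Measurable V)
    (h : P.map (fun ω => modes (V ω)) = productGaussian a s γ) :
    P.map V = enstrophyMeasure a s γ p := by
  have he := measurableEmbedding_modes a s p
  rw [enstrophyMeasure, ← h, ← he.comap_map (P.map V), Measure.map_map he.measurable hV]
  rfl

lemma IsCylinder.continuous {f : Sobolev a s p → ℂ} (hf : IsCylinder f) : Continuous f := by
  obtain ⟨S, g, hg, hfg⟩ := hf
  rw [funext hfg]
  exact hg.continuous.comp (continuous_pi fun k =>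
    (continuous_apply k.1).comp (continuous_modes a s p))

end Paths

end AveragedEuler

end

theorem theorem3p5 (a s γ α : ℝ) (hs : 0 < s) (hγ : 0 < γ) (hα : 2 < α) :
    ∃ (Ω : Type) (_ : MeasurableSpace Ω) (P : Measure Ω) (U : ℝ → Ω → Sobolev a s (1 - α)),
      IsProbabilityMeasure P ∧
      (∀ t, Measurable (U t)) ∧
      (∀ ω, Continuous fun t => U t ω) ∧
      (∀ᵐ ω ∂P, ∀ k : PosFreq,
        (∀ᵐ r : ℝ, Tendsto (fun n : ℕ => truncB a s n k (modes (U r ω))) atTop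
          (𝓝 (vectorB a s k (modes (U r ω))))) ∧
        ∀ t : ℝ,
          IntervalIntegrable (fun r => vectorB a s k (modes (U r ω))) volume 0 t ∧
          modes (U t ω) k = modes (U 0 ω) k + ∫ r in (0 : ℝ)..t, vectorB a s k (modes (U r ω))) ∧
      (∀ (t : ℝ) (f : Sobolev a s (1 - α) → ℂ), IsCylinder f →
        (Integrable (fun ω => f (U t ω)) P ↔ Integrable f (enstrophyMeasure a s γ (1 - α))) ∧
        ∫ ω, f (U t ω) ∂P = ∫ v, f v ∂(enstrophyMeasure a s γ (1 - α))) := by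
  classical
  have hμ := isProbabilityMeasure_productGaussian (a := a) (s := s) hγ
  have hfin : ∀ {x : ENNReal} {c : ℝ}, x ^ 2 ≤ ENNReal.ofReal c → x ≠ ⊤ := fun h =>
    ((ENNReal.pow_lt_top_iff.1 (h.trans_lt ENNReal.ofReal_lt_top)).resolve_right
      (by norm_num)).ne
  obtain ⟨T, j, hT, hj, hTb⟩ := exists_measurePreserving_approximation (a := a) hs hγ
  obtain ⟨Q, hQ, hQt, hQeq⟩ := exists_stationary_pathMeasure (μ := productGaussian a s γ)
    (b := vectorB a s) (f := fun n k => truncB a s n k) (T := T) (j := j)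
    (fun k => hfin ((eLpNorm_two_sq _).trans_le (lintegral_enorm_sq_mode_le hs hγ k)))
    measurable_vectorB
    (fun k => hfin ((eLpNorm_two_sq _).trans_le (lintegral_vectorB_le hs hγ k)))
    isQuadLip_truncB (fun k => tendsto_eLpNorm_quadSum_sub_vectorB hs hγ k tendsto_freqBall)
    hT hj hTb
  have hsum := ae_tsum_weight_lt_top (p := 1 - α) hs hγ (by linarith) hQt
  have hint : ∀ᵐ u ∂Q, ∀ (k : PosFreq) (T : ℕ), actionB a s k T u ≠ ⊤ := by
    filter_upwards [hsum] with u hu k T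
    exact actionB_ne_top (hu T) k
  -- the paths that are continuous in the Sobolev space contain a measurable set of full measure
  obtain ⟨G, hG, hGm, hGu⟩ := (hsum.and (ae_integral_eq hint hQeq)).exists_measurable_mem
  have hdom := fun u hu => exists_dominating_family (hGu u hu).1 (hGu u hu).2
  have hmem : ∀ u ∈ G, ∀ t, u t ∈ sobolevSubmodule a s (1 - α) := by
    intro u hu t
    obtain ⟨n, hn⟩ := exists_nat_ge |t|
    obtain ⟨M, hM, hMu⟩ := hdom u hu n
    refine Summable.of_nonneg_of_le (fun k => ?_) (fun k => ?_) hM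
    · have := weight_pos a s (1 - α) k
      positivity
    · exact mul_le_mul_of_nonneg_left (hMu t hn k) (weight_pos a s (1 - α) k).le
  set U : ℝ → C(ℝ, PosFreq → ℂ) → Sobolev a s (1 - α) := fun t u =>
    if hu : u ∈ G then ofModes (u t) (hmem u hu t) else 0 with hU
  have hUG : ∀ u ∈ G, ∀ t, modes (U t u) = u t := fun u hu t => by
    simp only [hU, dif_pos hu, modes_ofModes]
  have hUmodes : ∀ t, (fun u => modes (U t u)) = G.indicator fun u => u t := by
    intro t
    funext u
    by_cases hu : u ∈ G
    · rw [hUG u hu, Set.indicator_of_mem hu]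
    · rw [Set.indicator_of_notMem hu]
      simp only [hU, dif_neg hu, modes_zero]
  have hUm : ∀ t, Measurable (U t) := fun t => by
    refine (measurableEmbedding_modes a s (1 - α)).measurable_comp_iff.1 ?_
    rw [Function.comp_def, hUmodes t]
    exact (hQt t).measurable.indicator hGm
  have hlaw : ∀ t, Q.map (U t) = enstrophyMeasure a s γ (1 - α) := fun t => by
    refine enstrophyMeasure_eq_map (hUm t) ?_
    rw [← (hQt t).map_eq]
    refine Measure.map_congr ?_
    filter_upwards [hG] with u hu
    exact hUG u hu t
  refine ⟨C(ℝ, PosFreq → ℂ), inferInstance, Q, U, hQ, hUm, fun u => ?_, ?_, fun t f hf => ?_⟩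
  · by_cases hu : u ∈ G
    · simp only [hU, dif_pos hu]
      exact continuous_ofModes u.continuous (hdom u hu) (hmem u hu)
    · simp only [hU, dif_neg hu]
      exact continuous_const
  · filter_upwards [hG, hint, ae_ae_tendsto_truncB hs hγ hQt] with u hu hu1 hu2 k
    simp only [hUG u hu]
    exact ⟨hu2 k, fun t => ⟨intervalIntegrable_vectorB (hu1 k) 0 t, (hGu u hu).2 k t⟩⟩
  · have hfm : AEStronglyMeasurable f (Q.map (U t)) := hf.continuous.aestronglyMeasurable
    rw [← hlaw t]
    exact ⟨(integrable_map_measure hfm (hUm t).aemeasurable).symm,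
      (integral_map (hUm t).aemeasurable hfm).symm⟩
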